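/- Let $G$ be a compact Lie group and $K<H<G$ closed Lie subgroups such that $G/K$ is connected and effective and the fibre $H/K$ of the fibration $H/K\to G/K\to G/H$ is connected. Let $\mathfrak p$ be the orthogonal complement of $\mathfrak k$ in $\mathfrak g$ with respect to the Killing form $B$ of $\mathfrak g$, so that $\mathfrak g=\mathfrak k\oplus\mathfrak p$, and suppose that $\mathfrak p=\mathfrak p_1\oplus\mathfrak p_2$, where $\mathfrak p_1,\mathfrak p_2$ are inequivalent irreducible $\mathrm{Ad}|_K$-invariant summands and $\mathfrak h=\mathfrak k\oplus\mathfrak p_1$. Let $Q$ be an $\mathrm{Ad}|_K$-invariant scalar product on $\mathfrak p$ with $-B|_{\mathfrak p_i}=b_iQ|_{\mathfrak p_i}$, $b_i>0$, for $i=1,2$. The $G$-invariant Riemannian metrics on $G/K$ are identified with the $\mathrm{Ad}|_K$-invariant scalar products on $\mathfrak p$; they are the metrics $x_1Q|_{\mathfrak p_1}\oplus x_2Q|_{\mathfrak p_2}$ with $x_1,x_2>0$. Suppose that, up to scaling, $G/K$ carries exactly two $G$-invariant Einstein metrics, namely those with $x_1/x_2=y_1$ and $x_1/x_2=y_2$,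 where $0<y_1<y_2$. Let $g_0=a_1Q|_{\mathfrak p_1}\oplus a_2Q|_{\mathfrak p_2}$, $a_1,a_2>0$, be an initial metric with $a_1/a_2<y_1$. Then there exist $0<T<\infty$ and an ancient solution $$g(t)=x_1(t)\,Q|_{\mathfrak p_1}\oplus x_2(t)\,Q|_{\mathfrak p_2},\qquad t\in(-\infty,T),$$ of the homogeneous Ricci flow $\partial_t g=-2\,\mathrm{Ric}(g)$ with $g(0)=g_0$, such that: 1. $g(t)$ is of type I as an ancient solution, i.e. $\lim_{t\to-\infty}|t|\,\sup_{G/K}|\mathrm{Rm}(g(t))|_{g(t)}$ exists and is finite. 2. $g(t)$ is unique and maximal: if $\tilde g$ is a Ricci flow of $G$-invariant metrics on an interval $J\ni0$ with $\tilde g(0)=g_0$, then $J\subseteq(-\infty,T)$ and $\tilde g=g$ on $J$. 3. As $t\to T$, $x_1(t)\to0$ and the diameter of the fibre $H/K$ with the metric induced by $g(t)$ tends to $0$ (the fibre shrinks to a point), while $x_2(t)$ tends to some $r>0$, and $(G/K,g(t))$ converges in the Gromov–Hausdorff sense to $G/H$ with the $G$-invariant metric given by $r\,Q|_{\mathfrak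 p_2}$. 4. As $t\to-\infty$, $y(t)=x_1(t)/x_2(t)\to y_1$. -/

import Mathlib

open Set Filter Topology MeasureTheory
open scoped ENNReal Manifold ContDiff

namespace HRF

noncomputable section

/-! ### Curvature of an invariant metric on a reductive homogeneous space

`L` is the Lie algebra of `G`, `𝔨` that of the isotropy group and `𝔭` a complement of `𝔨`, identified
with the tangent space of `G/K` at the base point. A metric is a bilinear form on `𝔭`. -/

section Algebra

variable {L : Type*} [LieRing L] [LieAlgebra ℝ L] {𝔨 𝔭 : Submodule ℝ L}

/-- The `𝔭`-component `[X, Y]_𝔭` of the bracket of two elements of `𝔭`. -/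
def bracketP (hc : IsCompl 𝔭 𝔨) : 𝔭 →ₗ[ℝ] 𝔭 →ₗ[ℝ] 𝔭 :=
  LinearMap.mk₂ ℝ (fun X Y => 𝔭.projectionOnto 𝔨 hc ⁅(X : L), (Y : L)⁆)
    (by intros; simp) (by intros; simp) (by intros; simp) (by intros; simp)

/-- The endomorphism `Z ↦ [[X, Y]_𝔨, Z]` of `𝔭` (projected to `𝔭`, where it already takes its values
when the complement `𝔭` is reductive). -/
def isotropyTerm (hc : IsCompl 𝔭 𝔨) : 𝔭 →ₗ[ℝ] 𝔭 →ₗ[ℝ] Module.End ℝ 𝔭 :=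
  LinearMap.mk₂ ℝ
    (fun X Y => (𝔭.projectionOnto 𝔨 hc).comp
      ((LieAlgebra.ad ℝ L (𝔨.projectionOnto 𝔭 hc.symm ⁅(X : L), (Y : L)⁆ : L) :
        Module.End ℝ L).comp 𝔭.subtype))
    (by intros; ext; simp) (by intros; ext; simp) (by intros; ext; simp) (by intros; ext; simp)

/-- Right-hand side of Koszul's formula: `Z ↦ ½ (g([X,Y]_𝔭, Z) - g([Y,Z]_𝔭, X) + g([Z,X]_𝔭, Y))`. -/
def koszul (hc : IsCompl 𝔭 𝔨) (g : LinearMap.BilinForm ℝ 𝔭) :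
    𝔭 →ₗ[ℝ] 𝔭 →ₗ[ℝ] Module.Dual ℝ 𝔭 :=
  LinearMap.mk₂ ℝ
    (fun X Y =>
      { toFun := fun Z => (1 / 2 : ℝ) *
          (g (bracketP hc X Y) Z - g (bracketP hc Y Z) X + g (bracketP hc Z X) Y)
        map_add' := by intros; simp; ring
        map_smul' := by intros; simp; ring })
    (by intros; ext; simp; ring) (by intros; ext; simp; ring)
    (by intros; ext; simp; ring) (by intros; ext; simp; ring)

variable [FiniteDimensional ℝ L]

open Classical in
/-- The Levi-Civita connection of the invariant metric `g` at the base point, as the bilinear map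
`Λ : 𝔭 × 𝔭 → 𝔭` determined by Koszul's formula (`0` if `g` is degenerate). -/
def leviCivita (hc : IsCompl 𝔭 𝔨) (g : LinearMap.BilinForm ℝ 𝔭) : 𝔭 →ₗ[ℝ] 𝔭 →ₗ[ℝ] 𝔭 :=
  if hg : g.Nondegenerate then
    (koszul hc g).compr₂ (g.toDual hg).symm.toLinearMap
  else 0

/-- The curvature tensor
`R(X,Y) = Λ(X) Λ(Y) - Λ(Y) Λ(X) - Λ([X,Y]_𝔭) - ad([X,Y]_𝔨)` of the invariant metric `g`. -/
def curvature (hc : IsCompl 𝔭 𝔨) (g : LinearMap.BilinForm ℝ 𝔭) :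
    𝔭 →ₗ[ℝ] 𝔭 →ₗ[ℝ] Module.End ℝ 𝔭 :=
  LinearMap.mk₂ ℝ
    (fun X Y => (leviCivita hc g X).comp (leviCivita hc g Y)
      - (leviCivita hc g Y).comp (leviCivita hc g X)
      - leviCivita hc g (bracketP hc X Y) - isotropyTerm hc X Y)
    (by intros; ext; simp; abel) (by intros; ext; simp [smul_sub])
    (by intros; ext; simp; abel) (by intros; ext; simp [smul_sub])

/-- The Ricci tensor `Ric(Y, Z) = tr (X ↦ R(X, Y) Z)`. -/
def ricci (hc : IsCompl 𝔭 𝔨) (g : LinearMap.BilinForm ℝ 𝔭) (Y Z : 𝔭) : ℝ :=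
  LinearMap.trace ℝ 𝔭 (((curvature hc g).flip Y).flip Z)

/-- `g` is Einstein: its Ricci tensor is a constant multiple of `g`. -/
def IsEinstein (hc : IsCompl 𝔭 𝔨) (g : LinearMap.BilinForm ℝ 𝔭) : Prop :=
  ∃ c : ℝ, ∀ X Y : 𝔭, ricci hc g X Y = c * g X Y

open Classical in
/-- The norm `|Rm(g)|_g = (∑ g(R(eᵢ,eⱼ)eₖ,eₗ)²)^{1/2}`, for a `g`-orthonormal basis `(eᵢ)` of `𝔭`
(the value does not depend on it). By homogeneity it is the same at every point of `G/K`. -/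
def curvatureNorm (hc : IsCompl 𝔭 𝔨) (g : LinearMap.BilinForm ℝ 𝔭) : ℝ :=
  if h : ∃ e : Module.Basis (Fin (Module.finrank ℝ 𝔭)) ℝ 𝔭,
      ∀ i j, g (e i) (e j) = if i = j then 1 else 0 then
    Real.sqrt (∑ i, ∑ j, ∑ k, ∑ l,
      (g (curvature hc g (h.choose i) (h.choose j) (h.choose k)) (h.choose l)) ^ 2)
  else 0

/-- A solution on `(-∞, T)` is type I as an ancient solution if `|t| sup |Rm(g(t))|_{g(t)}` has a
finite limit as `t → -∞`. -/
def IsTypeIAncient (hc : IsCompl 𝔭 𝔨) (g : ℝ → LinearMap.BilinForm ℝ 𝔭) : Prop :=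
  ∃ l : ℝ, Tendsto (fun t => |t| * curvatureNorm hc (g t)) atBot (𝓝 l)

/-- The form `x₁ Q|_{𝔭₁} ⊕ x₂ Q|_{𝔭₂}` on `𝔭 = 𝔭₁ ⊕ 𝔭₂`. -/
def diagMetric {𝔭₁ 𝔭₂ : Submodule ℝ 𝔭} (h12 : IsCompl 𝔭₁ 𝔭₂) (Q : LinearMap.BilinForm ℝ 𝔭)
    (x₁ x₂ : ℝ) : LinearMap.BilinForm ℝ 𝔭 :=
  x₁ • Q.compl₁₂ (𝔭₁.projection 𝔭₂ h12) (𝔭₁.projection 𝔭₂ h12) +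
    x₂ • Q.compl₁₂ (𝔭₂.projection 𝔭₁ h12.symm) (𝔭₂.projection 𝔭₁ h12.symm)

end Algebra

/-! ### Lie groups, isotropy representation, invariant metrics -/

instance : ENat.LEInfty (minSmoothness ℝ 3) :=
  ⟨by rw [minSmoothness_of_isRCLikeNormedField]; exact ENat.LEInfty.out⟩

section Group

variable {E : Type*} [NormedAddCommGroup E] [NormedSpace ℝ E]
  {G : Type*} [TopologicalSpace G] [ChartedSpace E G] [Group G]

instance [FiniteDimensional ℝ E] : FiniteDimensional ℝ (GroupLieAlgebra 𝓘(ℝ, E) G) :=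
  inferInstanceAs (FiniteDimensional ℝ E)

/-- The adjoint representation: `Ad(a)` is the differential at `1` of `x ↦ a x a⁻¹`. -/
def Ad (E : Type*) [NormedAddCommGroup E] [NormedSpace ℝ E]
    {G : Type*} [TopologicalSpace G] [ChartedSpace E G] [Group G] (a : G) :
    GroupLieAlgebra 𝓘(ℝ, E) G →ₗ[ℝ] GroupLieAlgebra 𝓘(ℝ, E) G :=
  (mfderiv 𝓘(ℝ, E) 𝓘(ℝ, E) (fun x : G => a * x * a⁻¹) 1 : E →L[ℝ] E).toLinearMap

/-- The differential at `1` of the inclusion of a Lie subgroup. -/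
def inclusionDeriv (E : Type*) [NormedAddCommGroup E] [NormedSpace ℝ E]
    {G : Type*} [TopologicalSpace G] [ChartedSpace E G] [Group G]
    (F : Type*) [NormedAddCommGroup F] [NormedSpace ℝ F]
    (S : Subgroup G) [ChartedSpace F S] :
    GroupLieAlgebra 𝓘(ℝ, F) S →ₗ[ℝ] GroupLieAlgebra 𝓘(ℝ, E) G :=
  (mfderiv 𝓘(ℝ, F) 𝓘(ℝ, E) (Subtype.val : S → G) 1 : F →L[ℝ] E).toLinearMap

/-- The Lie algebra of a Lie subgroup, as a subspace of the Lie algebra of the group. -/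
def lieSub (E : Type*) [NormedAddCommGroup E] [NormedSpace ℝ E]
    {G : Type*} [TopologicalSpace G] [ChartedSpace E G] [Group G]
    (F : Type*) [NormedAddCommGroup F] [NormedSpace ℝ F]
    (S : Subgroup G) [ChartedSpace F S] : Submodule ℝ (GroupLieAlgebra 𝓘(ℝ, E) G) :=
  LinearMap.range (inclusionDeriv E F S)

/-- The orthogonal complement of the Lie algebra of `K` with respect to the Killing form of `G`. -/
def isotropySpace (E : Type*) [NormedAddCommGroup E] [NormedSpace ℝ E] [CompleteSpace E]
    {G : Type*} [TopologicalSpace G] [ChartedSpace E G] [Group G] [LieGroup 𝓘(ℝ, E) ∞ G]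
    (F : Type*) [NormedAddCommGroup F] [NormedSpace ℝ F]
    (K : Subgroup G) [ChartedSpace F K] : Submodule ℝ (GroupLieAlgebra 𝓘(ℝ, E) G) :=
  (killingForm ℝ (GroupLieAlgebra 𝓘(ℝ, E) G)).orthogonal (lieSub E F K)

variable {𝔨 𝔭 : Submodule ℝ (GroupLieAlgebra 𝓘(ℝ, E) G)}

/-- The isotropy representation of `K` on `𝔭 ≅ 𝔤/𝔨`, induced by `Ad`. -/
def isotropyRep (hc : IsCompl 𝔭 𝔨) (a : G) : 𝔭 →ₗ[ℝ] 𝔭 :=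
  (𝔭.projectionOnto 𝔨 hc).comp ((Ad E a).comp 𝔭.subtype)

/-- `W` is invariant under the isotropy representation of `K`. -/
def IsInvariant (K : Subgroup G) (hc : IsCompl 𝔭 𝔨) (W : Submodule ℝ 𝔭) : Prop :=
  ∀ a ∈ K, ∀ X ∈ W, isotropyRep hc a X ∈ W

/-- `W` is an irreducible summand of the isotropy representation of `K`. -/
def IsIrreducibleSummand (K : Subgroup G) (hc : IsCompl 𝔭 𝔨) (W : Submodule ℝ 𝔭) : Prop :=
  IsInvariant K hc W ∧ W ≠ ⊥ ∧ ∀ V ≤ W, IsInvariant K hc V → V = ⊥ ∨ V = W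

/-- `W₁` and `W₂` are equivalent as `K`-representations. -/
def AreEquivalent (K : Subgroup G) (hc : IsCompl 𝔭 𝔨) (W₁ W₂ : Submodule ℝ 𝔭) : Prop :=
  ∃ φ : W₁ ≃ₗ[ℝ] W₂, ∀ a ∈ K, ∀ X Y : W₁,
    (Y : 𝔭) = isotropyRep hc a X → (φ Y : 𝔭) = isotropyRep hc a (φ X)

/-- A `G`-invariant Riemannian metric on `G/K`, given by its value at the base point: a scalar
product on `𝔭` invariant under the isotropy representation of `K`. -/
structure IsInvariantMetric (K : Subgroup G) (hc : IsCompl 𝔭 𝔨)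
    (g : LinearMap.BilinForm ℝ 𝔭) : Prop where
  symm : ∀ X Y, g X Y = g Y X
  pos : ∀ X, X ≠ 0 → 0 < g X X
  invariant : ∀ a ∈ K, ∀ X Y, g (isotropyRep hc a X) (isotropyRep hc a Y) = g X Y

/-- `g(t)`, `t ∈ J`, is a homogeneous Ricci flow: a family of `G`-invariant metrics with
`∂g/∂t = -2 Ric(g)`. -/
def IsRicciFlow [CompleteSpace E] [FiniteDimensional ℝ E] [LieGroup 𝓘(ℝ, E) ∞ G]
    (K : Subgroup G) (hc : IsCompl 𝔭 𝔨) (g : ℝ → LinearMap.BilinForm ℝ 𝔭) (J : Set ℝ) : Prop :=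
  ∀ t ∈ J, IsInvariantMetric K hc (g t) ∧
    ∀ X Y : 𝔭, HasDerivWithinAt (fun s => g s X Y) (-2 * ricci hc (g t) X Y) J t

/-! ### Distances and Gromov–Hausdorff convergence -/

/-- The Riemannian distance of `G/S` for an invariant metric. The metric is given by the
semi-definite form `q` on the Lie algebra of `G` obtained by pulling back its value at the base point
under the projection `G → G/S`. Since `C¹` curves in `G/S` lift to `G`, the distance is the infimum
of the `q`-lengths `∫ q(γ⁻¹γ', γ⁻¹γ')^{1/2}` of the `C¹` curves `γ` in `G` that join the two cosets. -/
def quotientEDist (S : Subgroup G) (q : LinearMap.BilinForm ℝ (GroupLieAlgebra 𝓘(ℝ, E) G))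
    (a b : G ⧸ S) : ℝ≥0∞ :=
  letI : ∀ x : G, ENorm (TangentSpace 𝓘(ℝ, E) x) := fun x =>
    ⟨fun v =>
      let w : GroupLieAlgebra 𝓘(ℝ, E) G :=
        (mfderiv 𝓘(ℝ, E) 𝓘(ℝ, E) (fun z : G => x⁻¹ * z) x : E →L[ℝ] E) v
      ENNReal.ofReal (Real.sqrt (q w w))⟩
  ⨅ (x : G) (y : G) (_ : (x : G ⧸ S) = a) (_ : (y : G ⧸ S) = b),
    Manifold.riemannianEDist 𝓘(ℝ, E) x y

/-- `A ∼_ε B`: there is `R ⊆ A × B` projecting onto both factors and with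
`|d_A(p₁, q₁) - d_B(p₂, q₂)| < ε` for all `(p₁, p₂), (q₁, q₂) ∈ R`. -/
def IsApproximation {A B : Type*} (dA : A → A → ℝ≥0∞) (dB : B → B → ℝ≥0∞) (ε : ℝ≥0∞) : Prop :=
  ∃ R : Set (A × B), (∀ a, ∃ b, (a, b) ∈ R) ∧ (∀ b, ∃ a, (a, b) ∈ R) ∧
    ∀ p ∈ R, ∀ q ∈ R, dA p.1 q.1 < dB p.2 q.2 + ε ∧ dB p.2 q.2 < dA p.1 q.1 + ε

/-- The Hausdorff–Gromov distance of two spaces with given distance functions. -/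
def ghEDist {A B : Type*} (dA : A → A → ℝ≥0∞) (dB : B → B → ℝ≥0∞) : ℝ≥0∞ :=
  sInf {ε | IsApproximation dA dB ε}

/-- The distance of `(G/K, g)`, for an invariant metric `g`. -/
def totalEDist (K : Subgroup G) (hc : IsCompl 𝔭 𝔨) (g : LinearMap.BilinForm ℝ 𝔭) :
    G ⧸ K → G ⧸ K → ℝ≥0∞ :=
  quotientEDist K (g.compl₁₂ (𝔭.projectionOnto 𝔨 hc) (𝔭.projectionOnto 𝔨 hc))

/-- The distance of the base `G/H`, with the metric whose value at the base point is `g|_{𝔭₂}`, where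
`𝔤 = 𝔨 ⊕ 𝔭₁ ⊕ 𝔭₂` and `𝔨 ⊕ 𝔭₁` is the Lie algebra of `H`. -/
def baseEDist (H : Subgroup G) (hc : IsCompl 𝔭 𝔨) {𝔭₁ 𝔭₂ : Submodule ℝ 𝔭} (h12 : IsCompl 𝔭₁ 𝔭₂)
    (g : LinearMap.BilinForm ℝ 𝔭) : G ⧸ H → G ⧸ H → ℝ≥0∞ :=
  quotientEDist H (g.compl₁₂
    ((𝔭₂.projection 𝔭₁ h12.symm).comp (𝔭.projectionOnto 𝔨 hc))
    ((𝔭₂.projection 𝔭₁ h12.symm).comp (𝔭.projectionOnto 𝔨 hc)))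

/-- The distance of the fibre `H/K`, with the metric induced by `g`. -/
def fibreEDist {F : Type*} [NormedAddCommGroup F] [NormedSpace ℝ F]
    (K H : Subgroup G) [ChartedSpace F H] (hc : IsCompl 𝔭 𝔨)
    (g : LinearMap.BilinForm ℝ 𝔭) : H ⧸ K.subgroupOf H → H ⧸ K.subgroupOf H → ℝ≥0∞ :=
  quotientEDist (E := F) (K.subgroupOf H)
    (g.compl₁₂ ((𝔭.projectionOnto 𝔨 hc).comp (inclusionDeriv E F H))
      ((𝔭.projectionOnto 𝔨 hc).comp (inclusionDeriv E F H)))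

/-- The diameter of a space with a given distance function. -/
def ediam {A : Type*} (d : A → A → ℝ≥0∞) : ℝ≥0∞ := ⨆ (a : A) (b : A), d a b

end Group

end

end HRF

/-! By Schur's lemma every invariant symmetric form on 𝔭, in particular every invariant metric and
its Ricci tensor, is diagonal with respect to 𝔭₁ ⊕ 𝔭₂, so the flow is a planar system for (x₁, x₂).
Since 𝔥 is a subalgebra, [𝔭₁, 𝔭₁]_𝔭 ⊆ 𝔭₁, and Koszul's formula gives, with y = x₁/x₂, the Ricci
tensor (A + C y²) Q ⊕ (B - D y) Q with C, D ≥ 0 (`IsFibred.ricci_left`, `IsFibred.ricci_right`). The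
Einstein condition is (C + D) y² - B y + A = 0. Its positive solutions are exactly y₁ and y₂, which
determines A and B and forces C + D > 0 (`exists_ricci_diagMetric_of_einstein`).

Along the flow y' = -2 (C + D)(y₁ - y)(y₂ - y) / x₂, so y decreases when it starts below y₁, and
d(log x₂)/dy is a rational function of y. Hence x₂ is an explicit function φ(y), and time is an
integral F(y). The integral diverges logarithmically or faster at y₁ and converges at 0. So the
solution is ancient with y → y₁, and it dies at T = F(0) with x₁ → 0 and x₂ → φ(0) > 0
(`exists_trajectory`). Any other invariant solution is diagonal, hence equal to this one by
uniqueness for ordinary differential equations; it cannot reach T, where x₁ would vanish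
(`trajectory_unique`).

For type I, |Rm| is Θ(y)/x₂ with Θ continuous, while x₂ grows linearly in |t|
(`IsFibred.isTypeIAncient`).

For the collapse, distances on G/K are infima of lengths of curves in G. The fibre diameter is at
most a constant times √x₁. The base distance is a lower bound for the total one because x₂ ≥ r.
Conversely, an almost minimal curve for the base has nearly the same length upstairs, and its ends
are corrected inside fibres; compactness of G makes this uniform (`tendsto_ghEDist`). -/

namespace HRF

/-! ### Traces of skew endomorphisms. -/

section SkewTrace

variable {V : Type*} [AddCommGroup V] [Module ℝ V] [FiniteDimensional ℝ V]

/-- An endomorphism that is skew for a nondegenerate form is traceless. -/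
theorem trace_eq_zero_of_skew {g : LinearMap.BilinForm ℝ V} (hg : g.Nondegenerate)
    {T : Module.End ℝ V} (hT : ∀ X Y, g (T X) Y = -g X (T Y)) :
    LinearMap.trace ℝ V T = 0 := by
  -- The isomorphism of V with its dual given by g carries T to minus its transpose, and
  -- transposition keeps the trace.
  have h1 : (g.toDual hg).conj T = -Module.Dual.transpose (R := ℝ) T := by
    ext f Y
    obtain ⟨X, rfl⟩ := (g.toDual hg).surjective f
    simp [LinearEquiv.conj_apply, LinearMap.BilinForm.toDual_def, Module.Dual.transpose_apply, hT]
  have h2 := LinearMap.trace_conj' T (g.toDual hg)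
  have h3 : LinearMap.trace ℝ (Module.Dual ℝ V) (Module.Dual.transpose (R := ℝ) T)
      = LinearMap.trace ℝ V T :=
    congrArg (fun F => F T) (LinearMap.trace_transpose ℝ V)
  rw [h1] at h2
  have h4 := (LinearMap.trace ℝ (Module.Dual ℝ V)).map_neg (Module.Dual.transpose (R := ℝ) T)
  have h5 : -LinearMap.trace ℝ V T = LinearMap.trace ℝ V T := by
    rw [← h3]; exact (h4.symm.trans h2).trans h3.symm
  linarith

omit [FiniteDimensional ℝ V] in
theorem nondegenerate_of_pos {g : LinearMap.BilinForm ℝ V}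
    (hpos : ∀ X, X ≠ 0 → 0 < g X X) : g.Nondegenerate := by
  constructor
  · intro X hX
    by_contra h
    exact (hpos X h).ne' (hX X)
  · intro X hX
    by_contra h
    exact (hpos X h).ne' (hX X)

end SkewTrace

/-! ### Levi-Civita connection and Ricci tensor from Koszul's formula. -/

section Connection

variable {L : Type*} [LieRing L] [LieAlgebra ℝ L] {𝔨 𝔭 : Submodule ℝ L}

theorem coe_bracketP (hc : IsCompl 𝔭 𝔨) (X Y : 𝔭) :
    bracketP hc X Y = 𝔭.projectionOnto 𝔨 hc ⁅(X : L), (Y : L)⁆ := rfl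

theorem isotropyTerm_apply (hc : IsCompl 𝔭 𝔨) (X Y Z : 𝔭) :
    isotropyTerm hc X Y Z =
      𝔭.projectionOnto 𝔨 hc ⁅((𝔨.projectionOnto 𝔭 hc.symm ⁅(X : L), (Y : L)⁆ : 𝔨) : L), (Z : L)⁆ :=
  rfl

theorem koszul_apply (hc : IsCompl 𝔭 𝔨) (g : LinearMap.BilinForm ℝ 𝔭) (X Y Z : 𝔭) :
    koszul hc g X Y Z = (1 / 2 : ℝ) *
          (g (bracketP hc X Y) Z - g (bracketP hc Y Z) X + g (bracketP hc Z X) Y) := rfl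

theorem bracketP_swap (hc : IsCompl 𝔭 𝔨) (X Y : 𝔭) : bracketP hc X Y = -bracketP hc Y X := by
  rw [coe_bracketP, coe_bracketP, ← lie_skew, map_neg]

/-- The compression of `ad W` to `𝔭`. -/
noncomputable def adP (hc : IsCompl 𝔭 𝔨) (W : L) : Module.End ℝ 𝔭 :=
  (𝔭.projectionOnto 𝔨 hc).comp ((LieAlgebra.ad ℝ L W : Module.End ℝ L).comp 𝔭.subtype)

theorem adP_apply (hc : IsCompl 𝔭 𝔨) (W : L) (X : 𝔭) :
    adP hc W X = 𝔭.projectionOnto 𝔨 hc ⁅W, (X : L)⁆ := rfl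

theorem isotropyTerm_eq (hc : IsCompl 𝔭 𝔨) (X Y Z : 𝔭) :
    isotropyTerm hc X Y Z =
      adP hc ⁅(X : L), (Y : L)⁆ Z - bracketP hc (bracketP hc X Y) Z := by
  have h : ((𝔨.projectionOnto 𝔭 hc.symm ⁅(X : L), (Y : L)⁆ : 𝔨) : L)
      = ⁅(X : L), (Y : L)⁆ - ((bracketP hc X Y : 𝔭) : L) := by
    have := Submodule.projection_add_projection_eq_self hc ⁅(X : L), (Y : L)⁆
    rw [Submodule.projection_apply, Submodule.projection_apply] at this
    rw [coe_bracketP, eq_sub_iff_add_eq, add_comm]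
    exact this
  rw [isotropyTerm_apply, h, sub_lie, map_sub]
  rfl

/-- This is the Jacobi identity. The right side consists of a compressed `ad` and a commutator, so
its trace in X will vanish; that gives the symmetry of the Ricci tensor. -/
theorem isotropyTerm_sub_swap (hc : IsCompl 𝔭 𝔨) (X Y Z : 𝔭) :
    isotropyTerm hc X Y Z - isotropyTerm hc X Z Y =
      -(adP hc ⁅(Y : L), (Z : L)⁆ X) - (bracketP hc Z (bracketP hc Y X)
        - bracketP hc Y (bracketP hc Z X)) := by
  have h1 : adP hc ⁅(X : L), (Y : L)⁆ Z - adP hc ⁅(X : L), (Z : L)⁆ Y =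
      -(adP hc ⁅(Y : L), (Z : L)⁆ X) := by
    simp only [adP_apply]
    rw [← map_sub, ← map_neg]
    congr 1
    rw [lie_lie (X : L) (Y : L), lie_skew, ← lie_skew (Y : L) ⁅(X : L), (Z : L)⁆]
    abel
  have h2 : ∀ A B C : 𝔭, bracketP hc (bracketP hc A B) C = bracketP hc C (bracketP hc B A) := by
    intro A B C
    rw [bracketP_swap hc (bracketP hc A B), bracketP_swap hc A B, map_neg, neg_neg]
  rw [isotropyTerm_eq, isotropyTerm_eq, h2 X Y Z, h2 X Z Y, ← h1]
  abel

variable [FiniteDimensional ℝ L]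

theorem leviCivita_spec (hc : IsCompl 𝔭 𝔨) {g : LinearMap.BilinForm ℝ 𝔭} (hg : g.Nondegenerate)
    (X Y Z : 𝔭) : g (leviCivita hc g X Y) Z = koszul hc g X Y Z := by
  rw [leviCivita, dif_pos hg]
  exact LinearMap.BilinForm.apply_toDual_symm_apply (hB := hg) _ _

omit [FiniteDimensional ℝ L] in
theorem eq_of_forall_apply {g : LinearMap.BilinForm ℝ 𝔭} (hg : g.Nondegenerate) {X Y : 𝔭}
    (h : ∀ Z, g X Z = g Y Z) : X = Y := by
  refine sub_eq_zero.mp (hg.1 _ fun Z => ?_)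
  rw [map_sub, LinearMap.sub_apply, h, sub_self]

theorem leviCivita_skew (hc : IsCompl 𝔭 𝔨) {g : LinearMap.BilinForm ℝ 𝔭} (hg : g.Nondegenerate)
    (hs : ∀ X Y, g X Y = g Y X) (X Y Z : 𝔭) :
    g (leviCivita hc g X Y) Z = -g Y (leviCivita hc g X Z) := by
  rw [hs Y, leviCivita_spec hc hg, leviCivita_spec hc hg, koszul_apply, koszul_apply,
    bracketP_swap hc Z Y, bracketP_swap hc Z X, bracketP_swap hc Y X]
  simp only [map_neg, LinearMap.neg_apply]
  ring

theorem leviCivita_torsion (hc : IsCompl 𝔭 𝔨) {g : LinearMap.BilinForm ℝ 𝔭} (hg : g.Nondegenerate)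
    (X Y : 𝔭) :
    leviCivita hc g X Y - leviCivita hc g Y X = bracketP hc X Y := by
  refine eq_of_forall_apply hg fun Z => ?_
  rw [map_sub, LinearMap.sub_apply, leviCivita_spec hc hg, leviCivita_spec hc hg, koszul_apply,
    koszul_apply, bracketP_swap hc Y X, bracketP_swap hc Z X, bracketP_swap hc Y Z]
  simp only [map_neg, LinearMap.neg_apply]
  ring

theorem curvature_apply (hc : IsCompl 𝔭 𝔨) (g : LinearMap.BilinForm ℝ 𝔭) (X Y Z : 𝔭) :
    curvature hc g X Y Z = leviCivita hc g X (leviCivita hc g Y Z)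
      - leviCivita hc g Y (leviCivita hc g X Z)
      - leviCivita hc g (bracketP hc X Y) Z - isotropyTerm hc X Y Z := rfl

/-- Ricci tensor in terms of the endomorphisms `X ↦ Λ(X) Y`. -/
theorem ricci_eq (hc : IsCompl 𝔭 𝔨) {g : LinearMap.BilinForm ℝ 𝔭} (hg : g.Nondegenerate)
    (hs : ∀ X Y, g X Y = g Y X)
    (htr : ∀ W : 𝔭, LinearMap.trace ℝ 𝔭 (bracketP hc W) = 0) (Y Z : 𝔭) :
    ricci hc g Y Z =
      -LinearMap.trace ℝ 𝔭 ((leviCivita hc g).flip Y * (leviCivita hc g).flip Z)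
      - LinearMap.trace ℝ 𝔭 (((isotropyTerm hc).flip Y).flip Z) := by
  set Λ := leviCivita hc g with hΛ
  -- Write M_W for X ↦ Λ(X) W. Absence of torsion gives M_W = Λ(W) - [W, ·]_𝔭, a difference of two
  -- traceless maps. The curvature terms -Λ(Y) M_Z and M_Z [Y, ·]_𝔭 then combine under the trace to
  -- -M_Y M_Z.
  have hM : ∀ W, Λ.flip W = Λ W - bracketP hc W := by
    intro W
    ext1 X
    rw [LinearMap.flip_apply, LinearMap.sub_apply, ← leviCivita_torsion hc hg W X]
    abel
  have htM : ∀ W, LinearMap.trace ℝ 𝔭 (Λ.flip W) = 0 := by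
    intro W
    rw [hM, map_sub, htr, sub_zero]
    exact trace_eq_zero_of_skew hg (leviCivita_skew hc hg hs W)
  have key : ((curvature hc g).flip Y).flip Z =
      Λ.flip (Λ Y Z) - Λ Y * Λ.flip Z + Λ.flip Z * bracketP hc Y
        - ((isotropyTerm hc).flip Y).flip Z := by
    ext1 X
    change curvature hc g X Y Z = Λ X (Λ Y Z) - Λ Y (Λ X Z) + Λ (bracketP hc Y X) Z
      - isotropyTerm hc X Y Z
    rw [curvature_apply, bracketP_swap hc X Y, map_neg, LinearMap.neg_apply]
    abel
  rw [ricci, key, map_sub, map_add, map_sub, htM, LinearMap.trace_mul_comm ℝ (Λ.flip Z), hM Y,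
    sub_mul, map_sub]
  ring

end Connection

/-! ### The Killing form on a reductive complement. -/

section Killing

variable {L : Type*} [LieRing L] [LieAlgebra ℝ L] {𝔨 𝔭 : Submodule ℝ L}

/-- `𝔭` is a reductive complement, orthogonal to `𝔨` for the Killing form, which is negative
definite on `𝔭`. -/
structure IsReductive (𝔨 𝔭 : Submodule ℝ L) : Prop where
  orth : ∀ X ∈ 𝔭, ∀ k ∈ 𝔨, killingForm ℝ L X k = 0
  neg : ∀ X ∈ 𝔭, X ≠ 0 → killingForm ℝ L X X < 0

variable (𝔭) in
/-- The form `-B|_𝔭`. -/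
noncomputable def killP : LinearMap.BilinForm ℝ 𝔭 :=
  (-(killingForm ℝ L)).compl₁₂ 𝔭.subtype 𝔭.subtype

theorem killP_apply (X Y : 𝔭) : killP 𝔭 X Y = -killingForm ℝ L X Y := rfl

theorem killP_symm (X Y : 𝔭) : killP 𝔭 X Y = killP 𝔭 Y X := by
  rw [killP_apply, killP_apply, LieModule.traceForm_comm]

theorem killP_pos (h : IsReductive 𝔨 𝔭) (X : 𝔭) (hX : X ≠ 0) : 0 < killP 𝔭 X X := by
  rw [killP_apply]
  have := h.neg X X.2 (by simpa using hX)
  linarith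

theorem killP_projectionOnto (hc : IsCompl 𝔭 𝔨) (h : IsReductive 𝔨 𝔭) (W : L) (Y : 𝔭) :
    killP 𝔭 (𝔭.projectionOnto 𝔨 hc W) Y = -killingForm ℝ L W Y := by
  rw [killP_apply]
  have h1 := Submodule.projection_add_projection_eq_self hc W
  rw [Submodule.projection_apply, Submodule.projection_apply] at h1
  conv_rhs => rw [← h1, map_add, LinearMap.add_apply,
    LieModule.traceForm_comm _ _ _ ((𝔨.projectionOnto 𝔭 hc.symm W : 𝔨) : L),
    h.orth Y Y.2 _ (𝔨.projectionOnto 𝔭 hc.symm W).2, add_zero]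

/-- The Killing form is invariant, and orthogonality of 𝔨 and 𝔭 lets the projection be dropped. W is
arbitrary in the Lie algebra, not only in 𝔭 or 𝔨. -/
theorem adP_skew (hc : IsCompl 𝔭 𝔨) (h : IsReductive 𝔨 𝔭) (W : L) (X Y : 𝔭) :
    killP 𝔭 (adP hc W X) Y = -killP 𝔭 X (adP hc W Y) := by
  rw [killP_symm X, adP_apply, adP_apply, killP_projectionOnto hc h, killP_projectionOnto hc h,
    ← lie_skew, map_neg, LinearMap.neg_apply, LieModule.traceForm_apply_lie_apply,
    LieModule.traceForm_comm]

theorem bracketP_skew (hc : IsCompl 𝔭 𝔨) (h : IsReductive 𝔨 𝔭) (W X Y : 𝔭) :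
    killP 𝔭 (bracketP hc W X) Y = -killP 𝔭 X (bracketP hc W Y) :=
  adP_skew hc h W X Y

variable [FiniteDimensional ℝ L]

omit [FiniteDimensional ℝ L] in
theorem killP_nondegenerate (h : IsReductive 𝔨 𝔭) : (killP 𝔭).Nondegenerate :=
  nondegenerate_of_pos (killP_pos h)

theorem trace_adP (hc : IsCompl 𝔭 𝔨) (h : IsReductive 𝔨 𝔭) (W : L) :
    LinearMap.trace ℝ 𝔭 (adP hc W) = 0 :=
  trace_eq_zero_of_skew (killP_nondegenerate h) (adP_skew hc h W)

theorem trace_bracketP (hc : IsCompl 𝔭 𝔨) (h : IsReductive 𝔨 𝔭) (W : 𝔭) :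
    LinearMap.trace ℝ 𝔭 (bracketP hc W) = 0 :=
  trace_adP hc h W

theorem trace_isotropyTerm_symm (hc : IsCompl 𝔭 𝔨) (h : IsReductive 𝔨 𝔭) (Y Z : 𝔭) :
    LinearMap.trace ℝ 𝔭 (((isotropyTerm hc).flip Y).flip Z) =
      LinearMap.trace ℝ 𝔭 (((isotropyTerm hc).flip Z).flip Y) := by
  have key : ((isotropyTerm hc).flip Y).flip Z - ((isotropyTerm hc).flip Z).flip Y =
      -(adP hc ⁅(Y : L), (Z : L)⁆) - (bracketP hc Z * bracketP hc Y
        - bracketP hc Y * bracketP hc Z) := by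
    ext1 X
    exact isotropyTerm_sub_swap hc X Y Z
  have := congrArg (LinearMap.trace ℝ 𝔭) key
  rw [map_sub, map_sub, map_neg, map_sub, trace_adP hc h,
    LinearMap.trace_mul_comm ℝ (bracketP hc Z)] at this
  linarith

/-- Symmetry is what makes Schur's lemma applicable to the Ricci tensor. -/
theorem ricci_symm (hc : IsCompl 𝔭 𝔨) (h : IsReductive 𝔨 𝔭) {g : LinearMap.BilinForm ℝ 𝔭}
    (hg : g.Nondegenerate) (hs : ∀ X Y, g X Y = g Y X) (Y Z : 𝔭) :
    ricci hc g Y Z = ricci hc g Z Y := by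
  rw [ricci_eq hc hg hs (trace_bracketP hc h), ricci_eq hc hg hs (trace_bracketP hc h),
    LinearMap.trace_mul_comm, trace_isotropyTerm_symm hc h]

end Killing

/-! ### Orthonormal bases and eigenvectors for a positive definite form. -/

section OrthonormalBasis

variable {V : Type*} [AddCommGroup V] [Module ℝ V] [FiniteDimensional ℝ V]

/-- An inner product space structure given by a positive definite symmetric form. -/
theorem exists_orthonormal_basis {g : LinearMap.BilinForm ℝ V} (hs : ∀ X Y, g X Y = g Y X)
    (hpos : ∀ X, X ≠ 0 → 0 < g X X) :
    ∃ e : Module.Basis (Fin (Module.finrank ℝ V)) ℝ V,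
      ∀ i j, g (e i) (e j) = if i = j then 1 else 0 := by
  let core : InnerProductSpace.Core ℝ V :=
    { inner := fun X Y => g X Y
      conj_inner_symm := fun X Y => by simpa using hs Y X
      re_inner_nonneg := fun X => by
        rcases eq_or_ne X 0 with rfl | h
        · simp
        · simpa using (hpos X h).le
      add_left := fun X Y Z => by simp
      smul_left := fun X Y r => by simp
      definite := fun X h => by
        by_contra h'
        exact (hpos X h').ne' h }
  let _ : NormedAddCommGroup V := core.toNormedAddCommGroup
  let _ : InnerProductSpace ℝ V := InnerProductSpace.ofCore core.toCore
  let b := stdOrthonormalBasis ℝ V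
  refine ⟨b.toBasis, fun i j => ?_⟩
  have := orthonormal_iff_ite.mp b.orthonormal i j
  rw [OrthonormalBasis.coe_toBasis]
  exact this

/-- A symmetric form has an eigenvector with respect to a positive definite one. -/
theorem exists_eigenvector [Nontrivial V] {g B : LinearMap.BilinForm ℝ V}
    (hs : ∀ X Y, g X Y = g Y X) (hpos : ∀ X, X ≠ 0 → 0 < g X X)
    (hB : ∀ X Y, B X Y = B Y X) :
    ∃ c : ℝ, ∃ X : V, X ≠ 0 ∧ ∀ Y, B X Y = c * g X Y := by
  let core : InnerProductSpace.Core ℝ V :=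
    { inner := fun X Y => g X Y
      conj_inner_symm := fun X Y => by simpa using hs Y X
      re_inner_nonneg := fun X => by
        rcases eq_or_ne X 0 with rfl | h
        · simp
        · simpa using (hpos X h).le
      add_left := fun X Y Z => by simp
      smul_left := fun X Y r => by simp
      definite := fun X h => by
        by_contra h'
        exact (hpos X h').ne' h }
  let _ : NormedAddCommGroup V := core.toNormedAddCommGroup
  let _ : InnerProductSpace ℝ V := InnerProductSpace.ofCore core.toCore
  have hg : g.Nondegenerate := nondegenerate_of_pos hpos
  let T : V →ₗ[ℝ] V := (g.toDual hg).symm.toLinearMap.comp B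
  have hT : ∀ X Y, g (T X) Y = B X Y := fun X Y =>
    LinearMap.BilinForm.apply_toDual_symm_apply (hB := hg) _ _
  have hsym : T.IsSymmetric := fun X Y => by
    change g (T X) Y = g X (T Y)
    rw [hT, hs X, hT, hB]
  have hev := hsym.hasEigenvalue_iSup_of_finiteDimensional
  obtain ⟨X, hX⟩ := hev.exists_hasEigenvector
  obtain ⟨c, hc⟩ : ∃ c : ℝ, T X = c • X := ⟨_, hX.apply_eq_smul⟩
  refine ⟨c, X, hX.2, fun Y => ?_⟩
  rw [← hT, hc, map_smul, LinearMap.smul_apply, smul_eq_mul]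

omit [FiniteDimensional ℝ V] in
theorem repr_orthonormal {ι : Type*} [Fintype ι] [DecidableEq ι] {g : LinearMap.BilinForm ℝ V}
    {e : Module.Basis ι ℝ V} (he : ∀ i j, g (e i) (e j) = if i = j then 1 else 0) (X : V) (i : ι) :
    e.repr X i = g X (e i) := by
  conv_rhs => rw [← e.sum_repr X]
  rw [map_sum, LinearMap.sum_apply]
  simp_rw [map_smul, LinearMap.smul_apply, he, smul_eq_mul]
  simp

omit [FiniteDimensional ℝ V] in
theorem trace_orthonormal {ι : Type*} [Fintype ι] [DecidableEq ι] {g : LinearMap.BilinForm ℝ V}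
    {e : Module.Basis ι ℝ V} (he : ∀ i j, g (e i) (e j) = if i = j then 1 else 0)
    (T : Module.End ℝ V) : LinearMap.trace ℝ V T = ∑ i, g (T (e i)) (e i) := by
  rw [LinearMap.trace_eq_matrix_trace ℝ e, Matrix.trace]
  refine Finset.sum_congr rfl fun i _ => ?_
  rw [Matrix.diag_apply, LinearMap.toMatrix_apply, repr_orthonormal he]

/-- In an orthonormal basis the diagonal entries of T² are -g(Teᵢ, Teᵢ). This is the source of the
signs C ≥ 0 and D ≥ 0. -/
theorem trace_sq_nonpos_of_skew {g : LinearMap.BilinForm ℝ V} (hs : ∀ X Y, g X Y = g Y X)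
    (hpos : ∀ X, X ≠ 0 → 0 < g X X) {T : Module.End ℝ V} (hT : ∀ X Y, g (T X) Y = -g X (T Y)) :
    LinearMap.trace ℝ V (T * T) ≤ 0 := by
  obtain ⟨e, he⟩ := exists_orthonormal_basis hs hpos
  rw [trace_orthonormal he]
  refine Finset.sum_nonpos fun i _ => ?_
  rw [Module.End.mul_apply, hT, neg_nonpos]
  rcases eq_or_ne (T (e i)) 0 with h | h
  · simp [h]
  · exact (hpos _ h).le

end OrthonormalBasis

/-! ### Diagonal metrics. -/

section Diag

variable {L : Type*} [LieRing L] [LieAlgebra ℝ L] {𝔭 : Submodule ℝ L} {𝔭₁ 𝔭₂ : Submodule ℝ 𝔭}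

theorem diagMetric_apply (h12 : IsCompl 𝔭₁ 𝔭₂) (Q : LinearMap.BilinForm ℝ 𝔭) (x₁ x₂ : ℝ)
    (X Y : 𝔭) : diagMetric h12 Q x₁ x₂ X Y =
      x₁ * Q (𝔭₁.projection 𝔭₂ h12 X) (𝔭₁.projection 𝔭₂ h12 Y) +
      x₂ * Q (𝔭₂.projection 𝔭₁ h12.symm X) (𝔭₂.projection 𝔭₁ h12.symm Y) := rfl

theorem diagMetric_symm (h12 : IsCompl 𝔭₁ 𝔭₂) {Q : LinearMap.BilinForm ℝ 𝔭}
    (hQ : ∀ X Y, Q X Y = Q Y X) (x₁ x₂ : ℝ) (X Y : 𝔭) :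
    diagMetric h12 Q x₁ x₂ X Y = diagMetric h12 Q x₁ x₂ Y X := by
  rw [diagMetric_apply, diagMetric_apply, hQ (𝔭₁.projection 𝔭₂ h12 X),
    hQ (𝔭₂.projection 𝔭₁ h12.symm X)]

theorem diagMetric_pos (h12 : IsCompl 𝔭₁ 𝔭₂) {Q : LinearMap.BilinForm ℝ 𝔭}
    (hQ : ∀ X, X ≠ 0 → 0 < Q X X) {x₁ x₂ : ℝ} (h₁ : 0 < x₁) (h₂ : 0 < x₂) (X : 𝔭) (hX : X ≠ 0) :
    0 < diagMetric h12 Q x₁ x₂ X X := by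
  have hnn : ∀ Y, 0 ≤ Q Y Y := fun Y => by
    rcases eq_or_ne Y 0 with rfl | h
    · simp
    · exact (hQ Y h).le
  rw [diagMetric_apply]
  by_cases h : 𝔭₁.projection 𝔭₂ h12 X = 0
  · have h' : 𝔭₂.projection 𝔭₁ h12.symm X ≠ 0 := by
      intro h'
      apply hX
      rw [← Submodule.projection_add_projection_eq_self h12 X, h, h', add_zero]
    exact add_pos_of_nonneg_of_pos (mul_nonneg h₁.le (hnn _)) (mul_pos h₂ (hQ _ h'))
  · exact add_pos_of_pos_of_nonneg (mul_pos h₁ (hQ _ h)) (mul_nonneg h₂.le (hnn _))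

theorem diagMetric_apply_left (h12 : IsCompl 𝔭₁ 𝔭₂) (Q : LinearMap.BilinForm ℝ 𝔭) (x₁ x₂ : ℝ)
    {X Y : 𝔭} (hX : X ∈ 𝔭₁) (hY : Y ∈ 𝔭₁) : diagMetric h12 Q x₁ x₂ X Y = x₁ * Q X Y := by
  rw [diagMetric_apply, Submodule.projection_apply_of_mem_left h12 hX,
    Submodule.projection_apply_of_mem_left h12 hY, (Submodule.projection_apply_eq_zero_iff _).2 hX]
  simp

theorem diagMetric_apply_right (h12 : IsCompl 𝔭₁ 𝔭₂) (Q : LinearMap.BilinForm ℝ 𝔭) (x₁ x₂ : ℝ)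
    {X Y : 𝔭} (hX : X ∈ 𝔭₂) (hY : Y ∈ 𝔭₂) : diagMetric h12 Q x₁ x₂ X Y = x₂ * Q X Y := by
  rw [diagMetric_apply, Submodule.projection_apply_of_mem_left h12.symm hX,
    Submodule.projection_apply_of_mem_left h12.symm hY,
    (Submodule.projection_apply_eq_zero_iff _).2 hX]
  simp

/-- Two diagonal forms that are proportional on each summand. -/
theorem diagMetric_congr (h12 : IsCompl 𝔭₁ 𝔭₂) {Q Q' : LinearMap.BilinForm ℝ 𝔭}
    {x₁ x₂ x₁' x₂' : ℝ} (h₁ : ∀ X ∈ 𝔭₁, ∀ Y ∈ 𝔭₁, x₁ * Q X Y = x₁' * Q' X Y)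
    (h₂ : ∀ X ∈ 𝔭₂, ∀ Y ∈ 𝔭₂, x₂ * Q X Y = x₂' * Q' X Y) :
    diagMetric h12 Q x₁ x₂ = diagMetric h12 Q' x₁' x₂' := by
  refine LinearMap.ext fun X => LinearMap.ext fun Y => ?_
  rw [diagMetric_apply, diagMetric_apply,
    h₁ _ (Submodule.projection_apply_mem _ _) _ (Submodule.projection_apply_mem _ _),
    h₂ _ (Submodule.projection_apply_mem _ _) _ (Submodule.projection_apply_mem _ _)]

/-- Curvature is computed with -B in place of Q, since it is for -B that brackets are skew. The
ratio of the coefficients changes by the factor b₂/b₁. -/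
theorem diagMetric_eq_killP (h12 : IsCompl 𝔭₁ 𝔭₂) {Q : LinearMap.BilinForm ℝ 𝔭}
    {b₁ b₂ : ℝ} (hb₁ : 0 < b₁) (hb₂ : 0 < b₂)
    (hQ₁ : ∀ X ∈ 𝔭₁, ∀ Y ∈ 𝔭₁, killP 𝔭 X Y = b₁ * Q X Y)
    (hQ₂ : ∀ X ∈ 𝔭₂, ∀ Y ∈ 𝔭₂, killP 𝔭 X Y = b₂ * Q X Y) (x₁ x₂ : ℝ) :
    diagMetric h12 Q x₁ x₂ = diagMetric h12 (killP 𝔭) (x₁ / b₁) (x₂ / b₂) := by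
  refine diagMetric_congr h12 (fun X hX Y hY => ?_) (fun X hX Y hY => ?_)
  · rw [hQ₁ X hX Y hY]
    field_simp
  · rw [hQ₂ X hX Y hY]
    field_simp

end Diag

/-! ### Ricci curvature of diagonal metrics on the fibration. -/

section Fibred

variable {L : Type*} [LieRing L] [LieAlgebra ℝ L] {𝔨 𝔭 : Submodule ℝ L}
  {𝔭₁ 𝔭₂ : Submodule ℝ 𝔭}

/-- The algebraic data of the fibration: `𝔭₁`, `𝔭₂` are orthogonal for the Killing form, and
`𝔨 ⊕ 𝔭₁` is a subalgebra. -/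
structure IsFibred (hc : IsCompl 𝔭 𝔨) (𝔭₁ 𝔭₂ : Submodule ℝ 𝔭) : Prop where
  red : IsReductive 𝔨 𝔭
  compl : IsCompl 𝔭₁ 𝔭₂
  orth : ∀ X ∈ 𝔭₁, ∀ Y ∈ 𝔭₂, killP 𝔭 X Y = 0
  lie₁₁ : ∀ X ∈ 𝔭₁, ∀ Y ∈ 𝔭₁, bracketP hc X Y ∈ 𝔭₁

variable {hc : IsCompl 𝔭 𝔨}

theorem IsFibred.mem₂ (h : IsFibred hc 𝔭₁ 𝔭₂) {Y : 𝔭} (hY : ∀ X ∈ 𝔭₁, killP 𝔭 Y X = 0) :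
    Y ∈ 𝔭₂ := by
  have h1 : 𝔭₁.projection 𝔭₂ h.compl Y = 0 := by
    by_contra hne
    have hpos := killP_pos h.red _ hne
    have e := hY _ (Submodule.projection_apply_mem h.compl Y)
    have hd := congrArg (fun W => killP 𝔭 W (𝔭₁.projection 𝔭₂ h.compl Y))
      (Submodule.projection_add_projection_eq_self h.compl Y)
    simp only [map_add, LinearMap.add_apply] at hd
    rw [killP_symm (𝔭₂.projection 𝔭₁ _ Y),
      h.orth _ (Submodule.projection_apply_mem h.compl Y) _
        (Submodule.projection_apply_mem h.compl.symm Y), add_zero, e] at hd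
    exact hpos.ne' hd
  exact (Submodule.projection_apply_eq_zero_iff _).1 h1

/-- The map [X, ·]_𝔭 is skew and preserves 𝔭₁, hence it preserves the orthogonal complement 𝔭₂. -/
theorem IsFibred.lie₁₂ (h : IsFibred hc 𝔭₁ 𝔭₂) {X Y : 𝔭} (hX : X ∈ 𝔭₁) (hY : Y ∈ 𝔭₂) :
    bracketP hc X Y ∈ 𝔭₂ :=
  h.mem₂ fun Z hZ => by
    rw [bracketP_skew hc h.red, killP_symm, h.orth _ (h.lie₁₁ X hX Z hZ) Y hY, neg_zero]

theorem IsFibred.lie₂₁ (h : IsFibred hc 𝔭₁ 𝔭₂) {X Y : 𝔭} (hX : X ∈ 𝔭₂) (hY : Y ∈ 𝔭₁) :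
    bracketP hc X Y ∈ 𝔭₂ := by
  rw [bracketP_swap]
  exact neg_mem (h.lie₁₂ hY hX)

/-- The Levi-Civita connection of `u₁ (-B)|_𝔭₁ ⊕ u₂ (-B)|_𝔭₂` as a function of `z = u₁/u₂`. -/
noncomputable def diagConnection (hc : IsCompl 𝔭 𝔨) (h12 : IsCompl 𝔭₁ 𝔭₂) (z : ℝ) :
    𝔭 →ₗ[ℝ] 𝔭 →ₗ[ℝ] 𝔭 :=
  (1 / 2 : ℝ) • bracketP hc + ((1 - z) / 2) •
    ((bracketP hc).compl₁₂ (𝔭₁.projection 𝔭₂ h12) (𝔭₂.projection 𝔭₁ h12.symm)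
      - (bracketP hc).compl₁₂ (𝔭₂.projection 𝔭₁ h12.symm) (𝔭₁.projection 𝔭₂ h12))

theorem diagConnection_apply (h12 : IsCompl 𝔭₁ 𝔭₂) (z : ℝ) (X Y : 𝔭) :
    diagConnection hc h12 z X Y = (1 / 2 : ℝ) • bracketP hc X Y + ((1 - z) / 2) •
      (bracketP hc (𝔭₁.projection 𝔭₂ h12 X) (𝔭₂.projection 𝔭₁ h12.symm Y)
        - bracketP hc (𝔭₂.projection 𝔭₁ h12.symm X) (𝔭₁.projection 𝔭₂ h12 Y)) := rfl

theorem IsFibred.killP_projection₁ (h : IsFibred hc 𝔭₁ 𝔭₂) (X Y : 𝔭) :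
    killP 𝔭 (𝔭₁.projection 𝔭₂ h.compl X) Y =
      killP 𝔭 (𝔭₁.projection 𝔭₂ h.compl X) (𝔭₁.projection 𝔭₂ h.compl Y) := by
  conv_lhs => rw [← Submodule.projection_add_projection_eq_self h.compl Y]
  rw [map_add, h.orth _ (Submodule.projection_apply_mem h.compl X) _
        (Submodule.projection_apply_mem h.compl.symm Y), add_zero]

theorem IsFibred.killP_projection₂ (h : IsFibred hc 𝔭₁ 𝔭₂) (X Y : 𝔭) :
    killP 𝔭 (𝔭₂.projection 𝔭₁ h.compl.symm X) Y =
      killP 𝔭 (𝔭₂.projection 𝔭₁ h.compl.symm X) (𝔭₂.projection 𝔭₁ h.compl.symm Y) := by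
  conv_lhs => rw [← Submodule.projection_add_projection_eq_self h.compl Y]
  rw [map_add, killP_symm _ (𝔭₁.projection 𝔭₂ h.compl Y),
    h.orth _ (Submodule.projection_apply_mem h.compl Y) _
        (Submodule.projection_apply_mem h.compl.symm X), zero_add]

theorem IsFibred.killP_projection₁_comm (h : IsFibred hc 𝔭₁ 𝔭₂) (X Y : 𝔭) :
    killP 𝔭 (𝔭₁.projection 𝔭₂ h.compl X) Y = killP 𝔭 X (𝔭₁.projection 𝔭₂ h.compl Y) := by
  rw [h.killP_projection₁ X Y, killP_symm X, h.killP_projection₁ Y X, killP_symm]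

theorem IsFibred.killP_projection₂_comm (h : IsFibred hc 𝔭₁ 𝔭₂) (X Y : 𝔭) :
    killP 𝔭 (𝔭₂.projection 𝔭₁ h.compl.symm X) Y =
      killP 𝔭 X (𝔭₂.projection 𝔭₁ h.compl.symm Y) := by
  rw [h.killP_projection₂ X Y, killP_symm X, h.killP_projection₂ Y X, killP_symm]

variable [FiniteDimensional ℝ L]

/-- In Koszul's formula skewness moves Z out of the brackets. The deviation from ½[X, Y]_𝔭 involves
only mixed brackets; these lie in 𝔭₂, where g is u₂(-B), so dividing by u₂ leaves a dependence on
u₁/u₂ alone. -/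
theorem IsFibred.leviCivita_diagMetric (h : IsFibred hc 𝔭₁ 𝔭₂) {u₁ u₂ : ℝ}
    (h₁ : 0 < u₁) (h₂ : 0 < u₂) :
    leviCivita hc (diagMetric h.compl (killP 𝔭) u₁ u₂) = diagConnection hc h.compl (u₁ / u₂) := by
  set g := diagMetric h.compl (killP 𝔭) u₁ u₂ with hg
  set P₁ := 𝔭₁.projection 𝔭₂ h.compl with hP₁
  set P₂ := 𝔭₂.projection 𝔭₁ h.compl.symm with hP₂
  have hgn : g.Nondegenerate := nondegenerate_of_pos (diagMetric_pos _ (killP_pos h.red) h₁ h₂)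
  have hgS : ∀ X Y, g X Y = u₁ * killP 𝔭 (P₁ X) Y + u₂ * killP 𝔭 (P₂ X) Y := by
    intro X Y
    rw [hP₁, hP₂, h.killP_projection₁ X Y, h.killP_projection₂ X Y]
    rfl
  have hadd : ∀ X, P₁ X + P₂ X = X := Submodule.projection_add_projection_eq_self h.compl
  have hm₁ : ∀ X, P₁ X ∈ 𝔭₁ := Submodule.projection_apply_mem h.compl
  have hm₂ : ∀ X, P₂ X ∈ 𝔭₂ := Submodule.projection_apply_mem h.compl.symm
  have hp12 : ∀ X ∈ 𝔭₂, P₁ X = 0 := fun X hX => (Submodule.projection_apply_eq_zero_iff _).2 hX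
  have hp22 : ∀ X ∈ 𝔭₂, P₂ X = X := fun X hX =>
    Submodule.projection_apply_of_mem_left h.compl.symm hX
  ext1 X
  ext1 Y
  refine eq_of_forall_apply hgn fun Z => ?_
  rw [leviCivita_spec hc hgn, koszul_apply, diagConnection_apply]
  have hsg : ∀ A B, g A B = g B A := diagMetric_symm _ killP_symm _ _
  set W₁ := bracketP hc (P₁ X) (P₂ Y) with hW₁
  set W₂ := bracketP hc (P₂ X) (P₁ Y) with hW₂
  have e1 : g W₁ Z = u₂ * killP 𝔭 W₁ Z := by
    rw [hgS, hp12 _ (h.lie₁₂ (hm₁ X) (hm₂ Y)), hp22 _ (h.lie₁₂ (hm₁ X) (hm₂ Y)), map_zero,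
      LinearMap.zero_apply, mul_zero, zero_add]
  have e2 : g W₂ Z = u₂ * killP 𝔭 W₂ Z := by
    rw [hgS, hp12 _ (h.lie₂₁ (hm₂ X) (hm₁ Y)), hp22 _ (h.lie₂₁ (hm₂ X) (hm₁ Y)), map_zero,
      LinearMap.zero_apply, mul_zero, zero_add]
  have e3 : g (bracketP hc Y Z) X = u₁ * killP 𝔭 (bracketP hc (P₁ X) Y) Z
      + u₂ * killP 𝔭 (bracketP hc (P₂ X) Y) Z := by
    rw [hsg, hgS]
    have : ∀ A, killP 𝔭 A (bracketP hc Y Z) = killP 𝔭 (bracketP hc A Y) Z := by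
      intro A
      rw [bracketP_swap hc A Y, map_neg, LinearMap.neg_apply, bracketP_skew hc h.red, neg_neg]
    rw [this, this]
  have e4 : g (bracketP hc Z X) Y = u₁ * killP 𝔭 (bracketP hc X (P₁ Y)) Z
      + u₂ * killP 𝔭 (bracketP hc X (P₂ Y)) Z := by
    rw [hsg, hgS]
    have : ∀ A, killP 𝔭 A (bracketP hc Z X) = killP 𝔭 (bracketP hc X A) Z := by
      intro A
      rw [bracketP_swap hc Z X, map_neg, bracketP_skew hc h.red]
    rw [this, this]
  have d1 : ∀ A, bracketP hc A Y = bracketP hc A (P₁ Y) + bracketP hc A (P₂ Y) := by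
    intro A; rw [← map_add, hadd]
  have d2 : ∀ A, bracketP hc X A = bracketP hc (P₁ X) A + bracketP hc (P₂ X) A := by
    intro A; rw [← LinearMap.add_apply, ← map_add, hadd]
  rw [e3, e4, d1 (P₁ X), d1 (P₂ X), d2 (P₁ Y), d2 (P₂ Y), ← hW₁, ← hW₂]
  simp only [map_add, map_sub, map_smul, LinearMap.add_apply, LinearMap.sub_apply,
    LinearMap.smul_apply, smul_eq_mul]
  rw [e1, e2]
  field_simp
  ring

/-- On `𝔭₁` the Ricci tensor of the diagonal metric is `A + C z²`, with `C ≥ 0`. -/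
theorem IsFibred.ricci_left (h : IsFibred hc 𝔭₁ 𝔭₂) {Y : 𝔭} (hY : Y ∈ 𝔭₁) :
    ∃ A C : ℝ, 0 ≤ C ∧ ∀ u₁ u₂ : ℝ, 0 < u₁ → 0 < u₂ →
      ricci hc (diagMetric h.compl (killP 𝔭) u₁ u₂) Y Y = A + C * (u₁ / u₂) ^ 2 := by
  set P₁ : Module.End ℝ 𝔭 := 𝔭₁.projection 𝔭₂ h.compl with hP₁
  set P₂ : Module.End ℝ 𝔭 := 𝔭₂.projection 𝔭₁ h.compl.symm with hP₂
  have hadd : P₁ + P₂ = 1 := Submodule.projection_add_projection_eq_id h.compl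
  have hm₁ : ∀ X, P₁ X ∈ 𝔭₁ := Submodule.projection_apply_mem h.compl
  have hm₂ : ∀ X, P₂ X ∈ 𝔭₂ := Submodule.projection_apply_mem h.compl.symm
  have hp12 : ∀ X ∈ 𝔭₂, P₁ X = 0 := fun X hX => (Submodule.projection_apply_eq_zero_iff _).2 hX
  have hp21 : ∀ X ∈ 𝔭₁, P₂ X = 0 := fun X hX => (Submodule.projection_apply_eq_zero_iff _).2 hX
  have hp22 : ∀ X ∈ 𝔭₂, P₂ X = X := fun X hX =>
    Submodule.projection_apply_of_mem_left h.compl.symm hX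
  have hp11 : ∀ X ∈ 𝔭₁, P₁ X = X := fun X hX =>
    Submodule.projection_apply_of_mem_left h.compl hX
  set D : Module.End ℝ 𝔭 := bracketP hc Y with hD
  -- For Y in 𝔭₁ the map D preserves both summands, so the square of Λ(·)Y has no cross terms.
  have h12 : P₁ * D * P₂ = 0 := by
    ext1 X; exact hp12 _ (h.lie₁₂ hY (hm₂ X))
  have h21 : P₂ * D * P₁ = 0 := by
    ext1 X; exact hp21 _ (h.lie₁₁ Y hY _ (hm₁ X))
  have hDP : D * P₂ = P₂ * D * P₂ := by
    have : D * P₂ = (P₁ + P₂) * D * P₂ := by rw [hadd, one_mul]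
    rw [this, add_mul, add_mul, h12, zero_add]
  refine ⟨-(1 / 4) * LinearMap.trace ℝ 𝔭 (D * P₁ * (D * P₁))
    - LinearMap.trace ℝ 𝔭 (((isotropyTerm hc).flip Y).flip Y),
    -(1 / 4) * LinearMap.trace ℝ 𝔭 (D * P₂ * (D * P₂)), ?_, ?_⟩
  -- D P₂ = P₂ D P₂ is skew for -B, which gives C ≥ 0.
  · have := trace_sq_nonpos_of_skew (T := D * P₂) killP_symm (killP_pos h.red) ?_
    · linarith
    · intro A B
      rw [hDP]
      simp only [Module.End.mul_apply]
      rw [h.killP_projection₂_comm, bracketP_skew hc h.red, h.killP_projection₂_comm]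
  · intro u₁ u₂ h₁ h₂
    rw [ricci_eq hc (nondegenerate_of_pos (diagMetric_pos _ (killP_pos h.red) h₁ h₂))
      (diagMetric_symm _ killP_symm _ _) (trace_bracketP hc h.red),
      h.leviCivita_diagMetric h₁ h₂]
    set z := u₁ / u₂
    -- Λ(·)Y is -½ D on 𝔭₁ and -(z/2) D on 𝔭₂, hence z enters the trace of the square only through
    -- z².
    have hM : (diagConnection hc h.compl z).flip Y =
        (-(1 / 2 : ℝ)) • (D * P₁) + (-(z / 2)) • (D * P₂) := by
      ext1 X
      rw [LinearMap.flip_apply, diagConnection_apply, ← hP₁, ← hP₂, hp21 Y hY, hp11 Y hY, map_zero,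
        zero_sub, bracketP_swap hc X Y, bracketP_swap hc _ Y]
      have : D X = (D * P₁) X + (D * P₂) X := by
        rw [← LinearMap.add_apply, ← mul_add, hadd, mul_one]
      simp only [LinearMap.add_apply, LinearMap.smul_apply]
      rw [← hD, this, neg_neg, show D (P₂ X) = (D * P₂) X from rfl]
      module
    have c1 : D * P₁ * (D * P₂) = 0 := by
      rw [mul_assoc, ← mul_assoc P₁, h12, mul_zero]
    have c2 : D * P₂ * (D * P₁) = 0 := by
      rw [mul_assoc, ← mul_assoc P₂, h21, mul_zero]
    rw [hM, add_mul, mul_add, mul_add, smul_mul_smul_comm, smul_mul_smul_comm, smul_mul_smul_comm,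
      smul_mul_smul_comm, c1, c2]
    simp only [smul_zero, add_zero, zero_add, map_add, map_smul, smul_eq_mul]
    ring

/-- On `𝔭₂` the Ricci tensor of the diagonal metric is `B - D z`, with `D ≥ 0`. -/
theorem IsFibred.ricci_right (h : IsFibred hc 𝔭₁ 𝔭₂) {Y : 𝔭} (hY : Y ∈ 𝔭₂) :
    ∃ A C : ℝ, 0 ≤ C ∧ ∀ u₁ u₂ : ℝ, 0 < u₁ → 0 < u₂ →
      ricci hc (diagMetric h.compl (killP 𝔭) u₁ u₂) Y Y = A - C * (u₁ / u₂) := by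
  set P₁ : Module.End ℝ 𝔭 := 𝔭₁.projection 𝔭₂ h.compl with hP₁
  set P₂ : Module.End ℝ 𝔭 := 𝔭₂.projection 𝔭₁ h.compl.symm with hP₂
  have hadd : P₁ + P₂ = 1 := Submodule.projection_add_projection_eq_id h.compl
  have hm₁ : ∀ X, P₁ X ∈ 𝔭₁ := Submodule.projection_apply_mem h.compl
  have hm₂ : ∀ X, P₂ X ∈ 𝔭₂ := Submodule.projection_apply_mem h.compl.symm
  have hp12 : ∀ X ∈ 𝔭₂, P₁ X = 0 := fun X hX => (Submodule.projection_apply_eq_zero_iff _).2 hX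
  have hp21 : ∀ X ∈ 𝔭₁, P₂ X = 0 := fun X hX => (Submodule.projection_apply_eq_zero_iff _).2 hX
  have hp22 : ∀ X ∈ 𝔭₂, P₂ X = X := fun X hX =>
    Submodule.projection_apply_of_mem_left h.compl.symm hX
  set D : Module.End ℝ 𝔭 := bracketP hc Y with hD
  have h11 : P₁ * D * P₁ = 0 := by
    ext1 X; exact hp12 _ (h.lie₂₁ hY (hm₁ X))
  have hp1 : P₁ * P₁ = P₁ := Submodule.isIdempotentElem_projection h.compl
  have hp2 : P₂ * P₂ = P₂ := Submodule.isIdempotentElem_projection h.compl.symm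
  have hq12 : P₁ * P₂ = 0 := by ext1 X; exact hp12 _ (hm₂ X)
  have hq21 : P₂ * P₁ = 0 := by ext1 X; exact hp21 _ (hm₁ X)
  have hk1 : ∀ A B, killP 𝔭 (P₁ A) B = killP 𝔭 A (P₁ B) := h.killP_projection₁_comm
  have hk2 : ∀ A B, killP 𝔭 (P₂ A) B = killP 𝔭 A (P₂ B) := h.killP_projection₂_comm
  -- The off-diagonal part of D is skew and the trace of its square is 2 tr(D P₁ D P₂); so this
  -- trace is nonpositive, which fixes the sign of the slope in z.
  have hsq : (P₁ * D * P₂ + P₂ * D * P₁) * (P₁ * D * P₂ + P₂ * D * P₁)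
      = P₁ * (D * P₂ * D * P₁) + P₂ * (D * P₁ * D * P₂) := by
    have e1 : P₁ * D * P₂ * (P₁ * D * P₂) = 0 := by
      rw [show P₁ * D * P₂ * (P₁ * D * P₂) = P₁ * D * (P₂ * P₁) * D * P₂ by noncomm_ring, hq21]
      noncomm_ring
    have e2 : P₂ * D * P₁ * (P₂ * D * P₁) = 0 := by
      rw [show P₂ * D * P₁ * (P₂ * D * P₁) = P₂ * D * (P₁ * P₂) * D * P₁ by noncomm_ring, hq12]
      noncomm_ring
    have e3 : P₁ * D * P₂ * (P₂ * D * P₁) = P₁ * (D * P₂ * D * P₁) := by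
      rw [show P₁ * D * P₂ * (P₂ * D * P₁) = P₁ * D * (P₂ * P₂) * D * P₁ by noncomm_ring, hp2]
      noncomm_ring
    have e4 : P₂ * D * P₁ * (P₁ * D * P₂) = P₂ * (D * P₁ * D * P₂) := by
      rw [show P₂ * D * P₁ * (P₁ * D * P₂) = P₂ * D * (P₁ * P₁) * D * P₂ by noncomm_ring, hp1]
      noncomm_ring
    rw [add_mul, mul_add, mul_add, e1, e2, e3, e4, zero_add, add_zero]
  have ht1 : LinearMap.trace ℝ 𝔭 (P₁ * (D * P₂ * D * P₁)) =
      LinearMap.trace ℝ 𝔭 (D * P₁ * (D * P₂)) := by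
    rw [LinearMap.trace_mul_comm, mul_assoc _ P₁, hp1,
      show D * P₂ * D * P₁ = D * P₂ * (D * P₁) by noncomm_ring, LinearMap.trace_mul_comm]
  have ht2 : LinearMap.trace ℝ 𝔭 (P₂ * (D * P₁ * D * P₂)) =
      LinearMap.trace ℝ 𝔭 (D * P₁ * (D * P₂)) := by
    rw [LinearMap.trace_mul_comm, mul_assoc _ P₂, hp2,
      show D * P₁ * D * P₂ = D * P₁ * (D * P₂) by noncomm_ring]
  refine ⟨-LinearMap.trace ℝ 𝔭 (D * P₁ * (D * P₂))
    - (1 / 4) * LinearMap.trace ℝ 𝔭 (D * P₂ * (D * P₂))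
    - LinearMap.trace ℝ 𝔭 (((isotropyTerm hc).flip Y).flip Y),
    -(1 / 2) * LinearMap.trace ℝ 𝔭 (D * P₁ * (D * P₂)), ?_, ?_⟩
  · have := trace_sq_nonpos_of_skew (T := P₁ * D * P₂ + P₂ * D * P₁) killP_symm
      (killP_pos h.red) ?_
    · rw [hsq, map_add, ht1, ht2] at this
      linarith
    · intro A B
      simp only [Module.End.mul_apply, LinearMap.add_apply, map_add]
      rw [hk1, hk2, bracketP_skew hc h.red, bracketP_skew hc h.red, hk1, hk2]
      ring
  · intro u₁ u₂ h₁ h₂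
    rw [ricci_eq hc (nondegenerate_of_pos (diagMetric_pos _ (killP_pos h.red) h₁ h₂))
      (diagMetric_symm _ killP_symm _ _) (trace_bracketP hc h.red),
      h.leviCivita_diagMetric h₁ h₂]
    set z := u₁ / u₂
    have hM : (diagConnection hc h.compl z).flip Y =
        (-(1 - z / 2)) • (D * P₁) + (-(1 / 2 : ℝ)) • (D * P₂) := by
      ext1 X
      rw [LinearMap.flip_apply, diagConnection_apply, ← hP₁, ← hP₂, hp22 Y hY, hp12 Y hY, map_zero,
        sub_zero, bracketP_swap hc X Y, bracketP_swap hc _ Y]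
      have : D X = (D * P₁) X + (D * P₂) X := by
        rw [← LinearMap.add_apply, ← mul_add, hadd, mul_one]
      simp only [LinearMap.add_apply, LinearMap.smul_apply]
      rw [← hD, this, show D (P₁ X) = (D * P₁) X from rfl]
      module
    -- D maps 𝔭₁ into 𝔭₂, so the factor (1 - z/2)² multiplies zero and only a linear dependence on z
    -- survives.
    have c1 : D * P₁ * (D * P₁) = 0 := by
      rw [mul_assoc, ← mul_assoc P₁, h11, mul_zero]
    rw [hM, add_mul, mul_add, mul_add, smul_mul_smul_comm, smul_mul_smul_comm, smul_mul_smul_comm,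
      smul_mul_smul_comm, c1]
    simp only [smul_zero, zero_add, map_add, map_smul, smul_eq_mul]
    rw [LinearMap.trace_mul_comm ℝ (D * P₂) (D * P₁)]
    ring

end Fibred

/-! ### Equivariance of curvature under automorphisms. -/

section Equivariance

variable {L : Type*} [LieRing L] [LieAlgebra ℝ L] {𝔨 𝔭 : Submodule ℝ L}

/-- `φ` is the restriction to `𝔭` of an automorphism of the Lie algebra preserving `𝔭` and `𝔨`. -/
def IsAutRestriction (𝔨 : Submodule ℝ L) {𝔭 : Submodule ℝ L} (φ : 𝔭 →ₗ[ℝ] 𝔭) : Prop :=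
  ∃ Φ : L ≃ₗ⁅ℝ⁆ L, (∀ X ∈ 𝔭, Φ X ∈ 𝔭) ∧ (∀ X ∈ 𝔨, Φ X ∈ 𝔨) ∧ ∀ X : 𝔭, (φ X : L) = Φ X

theorem projectionOnto_equivariant (hc : IsCompl 𝔭 𝔨) {φ : 𝔭 →ₗ[ℝ] 𝔭} {Φ : L ≃ₗ⁅ℝ⁆ L}
    (hk : ∀ X ∈ 𝔨, Φ X ∈ 𝔨) (hφ : ∀ X : 𝔭, (φ X : L) = Φ X) (W : L) :
    𝔭.projectionOnto 𝔨 hc (Φ W) = φ (𝔭.projectionOnto 𝔨 hc W) := by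
  have h1 := Submodule.projection_add_projection_eq_self hc W
  rw [Submodule.projection_apply, Submodule.projection_apply] at h1
  conv_lhs => rw [← h1, map_add, map_add, ← hφ, Submodule.projectionOnto_apply_left,
    (Submodule.projectionOnto_apply_eq_zero_iff hc).2 (hk _ (Submodule.coe_mem _)), add_zero]

theorem IsAutRestriction.bracketP (hc : IsCompl 𝔭 𝔨) {φ : 𝔭 →ₗ[ℝ] 𝔭}
    (h : IsAutRestriction 𝔨 φ) (X Y : 𝔭) :
    bracketP hc (φ X) (φ Y) = φ (bracketP hc X Y) := by
  obtain ⟨Φ, -, hk, hφ⟩ := h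
  rw [coe_bracketP, coe_bracketP, hφ, hφ, ← LieEquiv.map_lie, projectionOnto_equivariant hc hk hφ]

theorem IsAutRestriction.isotropyTerm (hc : IsCompl 𝔭 𝔨) {φ : 𝔭 →ₗ[ℝ] 𝔭}
    (h : IsAutRestriction 𝔨 φ) (X Y Z : 𝔭) :
    isotropyTerm hc (φ X) (φ Y) (φ Z) = φ (isotropyTerm hc X Y Z) := by
  have h' := h
  obtain ⟨Φ, -, hk, hφ⟩ := h
  rw [isotropyTerm_eq, isotropyTerm_eq, map_sub, h'.bracketP, h'.bracketP, adP_apply, adP_apply,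
    hφ, hφ, hφ, ← LieEquiv.map_lie, ← LieEquiv.map_lie, projectionOnto_equivariant hc hk hφ]

theorem IsAutRestriction.killP [FiniteDimensional ℝ L] {φ : 𝔭 →ₗ[ℝ] 𝔭}
    (h : IsAutRestriction 𝔨 φ) (X Y : 𝔭) : killP 𝔭 (φ X) (φ Y) = killP 𝔭 X Y := by
  obtain ⟨Φ, -, hk, hφ⟩ := h
  rw [killP_apply, killP_apply, hφ, hφ, LieAlgebra.killingForm_of_equiv_apply]

variable [FiniteDimensional ℝ L]

theorem IsAutRestriction.leviCivita (hc : IsCompl 𝔭 𝔨) {φ : 𝔭 →ₗ[ℝ] 𝔭}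
    (h : IsAutRestriction 𝔨 φ) {g : LinearMap.BilinForm ℝ 𝔭} (hg : g.Nondegenerate)
    (hφg : ∀ X Y, g (φ X) (φ Y) = g X Y) (hφs : Function.Surjective φ) (X Y : 𝔭) :
    leviCivita hc g (φ X) (φ Y) = φ (leviCivita hc g X Y) := by
  refine eq_of_forall_apply hg fun Z => ?_
  obtain ⟨Z, rfl⟩ := hφs Z
  rw [hφg, leviCivita_spec hc hg, leviCivita_spec hc hg, koszul_apply, koszul_apply,
    h.bracketP, h.bracketP, h.bracketP, hφg, hφg, hφg]

/-- The curvature is built from g, the bracket and the projections, all respected by φ. Hence φ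
conjugates the endomorphisms whose traces are the two sides. -/
theorem IsAutRestriction.ricci (hc : IsCompl 𝔭 𝔨) {φ : 𝔭 →ₗ[ℝ] 𝔭}
    (h : IsAutRestriction 𝔨 φ) {g : LinearMap.BilinForm ℝ 𝔭} (hg : g.Nondegenerate)
    (hφg : ∀ X Y, g (φ X) (φ Y) = g X Y) (hφ : Function.Bijective φ) (Y Z : 𝔭) :
    ricci hc g (φ Y) (φ Z) = ricci hc g Y Z := by
  set e := LinearEquiv.ofBijective φ hφ
  have key : ((curvature hc g).flip (φ Y)).flip (φ Z) =
      e.conj (((curvature hc g).flip Y).flip Z) := by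
    ext1 X
    obtain ⟨X, rfl⟩ := e.surjective X
    rw [LinearEquiv.conj_apply_apply, e.symm_apply_apply]
    change curvature hc g (φ X) (φ Y) (φ Z) = φ (curvature hc g X Y Z)
    have hΛ := h.leviCivita hc hg hφg hφ.2
    rw [curvature_apply, curvature_apply, hΛ, hΛ, hΛ, hΛ, h.bracketP, hΛ, h.isotropyTerm,
      map_sub, map_sub, map_sub]
  rw [HRF.ricci, key, LinearMap.trace_conj', HRF.ricci]

/-- The Ricci tensor as a bilinear form. -/
noncomputable def ricciForm (hc : IsCompl 𝔭 𝔨) (g : LinearMap.BilinForm ℝ 𝔭) :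
    LinearMap.BilinForm ℝ 𝔭 :=
  LinearMap.mk₂ ℝ (ricci hc g)
    (fun Y Y' Z => by
      have : ((curvature hc g).flip (Y + Y')).flip Z =
          ((curvature hc g).flip Y).flip Z + ((curvature hc g).flip Y').flip Z := by ext; simp
      rw [ricci, this, map_add]; rfl)
    (fun c Y Z => by
      have : ((curvature hc g).flip (c • Y)).flip Z =
          c • ((curvature hc g).flip Y).flip Z := by ext; simp
      rw [ricci, this, map_smul]; rfl)
    (by intros; simp [ricci]) (by intros; simp [ricci])

theorem ricciForm_apply (hc : IsCompl 𝔭 𝔨) (g : LinearMap.BilinForm ℝ 𝔭) (X Y : 𝔭) :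
    ricciForm hc g X Y = ricci hc g X Y := rfl

end Equivariance

/-! ### Schur's lemma for the isotropy representation. -/

section Schur

variable {E : Type*} [NormedAddCommGroup E] [NormedSpace ℝ E] [FiniteDimensional ℝ E]
  {G : Type*} [TopologicalSpace G] [ChartedSpace E G] [Group G]
  {𝔨 𝔭 : Submodule ℝ (GroupLieAlgebra 𝓘(ℝ, E) G)} {K : Subgroup G} {hc : IsCompl 𝔭 𝔨}
  {Q : LinearMap.BilinForm ℝ 𝔭}

omit [FiniteDimensional ℝ E] in
theorem IsInvariantMetric.injective (hQ : IsInvariantMetric K hc Q) {a : G} (ha : a ∈ K) :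
    Function.Injective (isotropyRep hc a) := by
  refine (injective_iff_map_eq_zero _).2 fun X hX => ?_
  by_contra h
  have := hQ.pos X h
  rw [← hQ.invariant a ha, hX] at this
  simp at this

theorem IsInvariantMetric.bijective (hQ : IsInvariantMetric K hc Q) {a : G} (ha : a ∈ K) :
    Function.Bijective (isotropyRep hc a) :=
  ⟨hQ.injective ha, LinearMap.injective_iff_surjective.1 (hQ.injective ha)⟩

omit [FiniteDimensional ℝ E] in
theorem IsInvariantMetric.nondegenerate (hQ : IsInvariantMetric K hc Q) : Q.Nondegenerate :=
  nondegenerate_of_pos hQ.pos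

theorem IsInvariant.exists_preimage (hQ : IsInvariantMetric K hc Q) {W : Submodule ℝ 𝔭}
    (hW : IsInvariant K hc W) {a : G} (ha : a ∈ K) {Y : 𝔭} (hY : Y ∈ W) :
    ∃ X ∈ W, isotropyRep hc a X = Y := by
  have hinj : Function.Injective ((isotropyRep hc a).restrict (hW a ha)) := by
    intro X Y h
    exact Subtype.ext (hQ.injective ha (congrArg Subtype.val h))
  obtain ⟨X, hX⟩ := LinearMap.injective_iff_surjective.1 hinj ⟨Y, hY⟩
  exact ⟨X, X.2, congrArg Subtype.val hX⟩

/-- Schur's lemma: an invariant symmetric form is a multiple of `Q` on an irreducible summand. -/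
theorem IsIrreducibleSummand.eq_smul (hQ : IsInvariantMetric K hc Q) {W : Submodule ℝ 𝔭}
    (hW : IsIrreducibleSummand K hc W) {B : LinearMap.BilinForm ℝ 𝔭} (hB : ∀ X Y, B X Y = B Y X)
    (hinv : ∀ a ∈ K, ∀ X Y, B (isotropyRep hc a X) (isotropyRep hc a Y) = B X Y) :
    ∃ c : ℝ, ∀ X ∈ W, ∀ Y ∈ W, B X Y = c * Q X Y := by
  obtain ⟨hWi, hW0, hWirr⟩ := hW
  have : Nontrivial W := Submodule.nontrivial_iff_ne_bot.2 hW0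
  obtain ⟨c, X₀, hX₀, hc₀⟩ := exists_eigenvector (V := W)
    (g := Q.compl₁₂ W.subtype W.subtype) (B := B.compl₁₂ W.subtype W.subtype)
    (fun X Y => hQ.symm X Y) (fun X hX => hQ.pos X (by simpa using hX)) (fun X Y => hB X Y)
  -- The eigenspace of B relative to Q for the eigenvalue c. It is invariant and contains X₀, so
  -- irreducibility makes it all of W.
  let N : Submodule ℝ 𝔭 :=
    { carrier := {X | X ∈ W ∧ ∀ Y ∈ W, B X Y = c * Q X Y}
      add_mem' := fun {X X'} h h' => ⟨add_mem h.1 h'.1, fun Y hY => by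
        rw [map_add, map_add, LinearMap.add_apply, LinearMap.add_apply, h.2 Y hY, h'.2 Y hY,
          mul_add]⟩
      zero_mem' := ⟨zero_mem _, fun Y _ => by simp⟩
      smul_mem' := fun r X h => ⟨W.smul_mem r h.1, fun Y hY => by
        rw [map_smul, map_smul, LinearMap.smul_apply, LinearMap.smul_apply, h.2 Y hY,
          smul_eq_mul, smul_eq_mul]
        ring⟩ }
  have hN : IsInvariant K hc N := fun a ha X hX => ⟨hWi a ha X hX.1, fun Y hY => by
    obtain ⟨Z, hZ, rfl⟩ := hWi.exists_preimage hQ ha hY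
    rw [hinv a ha, hQ.invariant a ha, hX.2 Z hZ]⟩
  refine ⟨c, ?_⟩
  rcases hWirr N (fun X hX => hX.1) hN with h | h
  · exfalso
    have hmem : (X₀ : 𝔭) ∈ N := ⟨X₀.2, fun Y hY => hc₀ ⟨Y, hY⟩⟩
    rw [h, Submodule.mem_bot] at hmem
    exact hX₀ (Subtype.ext hmem)
  · intro X hX Y hY
    rw [← h] at hX
    exact hX.2 Y hY

/-- Schur's lemma: inequivalent irreducible summands are orthogonal for every invariant form. -/
theorem orthogonal_of_not_areEquivalent (hQ : IsInvariantMetric K hc Q) {W₁ W₂ : Submodule ℝ 𝔭}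
    (hW₁ : IsIrreducibleSummand K hc W₁) (hW₂ : IsIrreducibleSummand K hc W₂)
    (hne : ¬ AreEquivalent K hc W₁ W₂) {B : LinearMap.BilinForm ℝ 𝔭}
    (hinv : ∀ a ∈ K, ∀ X Y, B (isotropyRep hc a X) (isotropyRep hc a Y) = B X Y) :
    ∀ X ∈ W₁, ∀ Y ∈ W₂, B X Y = 0 := by
  have hnd : (Q.compl₁₂ W₂.subtype W₂.subtype).Nondegenerate :=
    nondegenerate_of_pos fun X hX => hQ.pos X (by simpa using hX)
  -- T represents B through Q, and invariance of both forms makes it an intertwiner. Its kernel and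
  -- range are invariant, so T is zero or an equivalence.
  let T : W₁ →ₗ[ℝ] W₂ := (LinearMap.BilinForm.toDual _ hnd).symm.toLinearMap.comp
    (B.compl₁₂ W₁.subtype W₂.subtype)
  have hT : ∀ (X : W₁) (Y : W₂), Q (T X) Y = B X Y := fun X Y =>
    LinearMap.BilinForm.apply_toDual_symm_apply (hB := hnd) _ _
  have hTeq : ∀ a ∈ K, ∀ X Y : W₁, (Y : 𝔭) = isotropyRep hc a X →
      (T Y : 𝔭) = isotropyRep hc a (T X) := by
    intro a ha X Y hXY
    have : T Y = ⟨isotropyRep hc a (T X), hW₂.1 a ha _ (T X).2⟩ := by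
      refine sub_eq_zero.1 (hnd.1 _ fun Z => ?_)
      obtain ⟨Z', hZ', hZ⟩ := hW₂.1.exists_preimage hQ ha Z.2
      rw [map_sub, LinearMap.sub_apply, sub_eq_zero]
      change Q (T Y) Z = Q (isotropyRep hc a (T X)) Z
      rw [hT, ← hZ, hXY, hinv a ha, hQ.invariant a ha]
      exact (hT X ⟨Z', hZ'⟩).symm
    rw [this]
  have hker : IsInvariant K hc ((LinearMap.ker T).map W₁.subtype) := by
    rintro a ha _ ⟨X, hX, rfl⟩
    refine ⟨⟨isotropyRep hc a X, hW₁.1 a ha _ X.2⟩, ?_, rfl⟩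
    rw [SetLike.mem_coe, LinearMap.mem_ker] at hX ⊢
    refine Subtype.ext ?_
    rw [hTeq a ha X _ rfl, hX]
    simp
  have hrange : IsInvariant K hc ((LinearMap.range T).map W₂.subtype) := by
    rintro a ha _ ⟨_, ⟨X, rfl⟩, rfl⟩
    exact ⟨_, ⟨⟨isotropyRep hc a X, hW₁.1 a ha _ X.2⟩, rfl⟩, hTeq a ha X _ rfl⟩
  have hT0 : T = 0 := by
    by_contra hT0
    rcases hW₁.2.2 _ (Submodule.map_subtype_le _ _) hker with h1 | h1
    · rcases hW₂.2.2 _ (Submodule.map_subtype_le _ _) hrange with h2 | h2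
      · refine hT0 (LinearMap.range_eq_bot.1 ?_)
        refine Submodule.map_injective_of_injective (Submodule.subtype_injective _) ?_
        rw [h2, Submodule.map_bot]
      · have k1 : LinearMap.ker T = ⊥ := by
          refine Submodule.map_injective_of_injective (Submodule.subtype_injective _) ?_
          rw [h1, Submodule.map_bot]
        have k2 : LinearMap.range T = ⊤ :=
          Submodule.map_injective_of_injective W₂.subtype_injective (by rw [h2]; simp)
        exact hne ⟨LinearEquiv.ofBijective T ⟨LinearMap.ker_eq_bot.1 k1,
          LinearMap.range_eq_top.1 k2⟩, hTeq⟩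
    · refine hT0 (LinearMap.ker_eq_top.1 ?_)
      exact Submodule.map_injective_of_injective W₁.subtype_injective (by rw [h1]; simp)
  intro X hX Y hY
  have := hT ⟨X, hX⟩ ⟨Y, hY⟩
  rw [hT0] at this
  simpa using this.symm

variable [CompleteSpace E] [LieGroup 𝓘(ℝ, E) ∞ G]

/-- Invariant symmetric forms on a sum of two inequivalent irreducible summands are diagonal. -/
theorem eq_diagMetric_of_invariant (hQ : IsInvariantMetric K hc Q) {𝔭₁ 𝔭₂ : Submodule ℝ 𝔭}
    (h12 : IsCompl 𝔭₁ 𝔭₂) (h₁ : IsIrreducibleSummand K hc 𝔭₁) (h₂ : IsIrreducibleSummand K hc 𝔭₂)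
    (hne : ¬ AreEquivalent K hc 𝔭₁ 𝔭₂) {B : LinearMap.BilinForm ℝ 𝔭} (hB : ∀ X Y, B X Y = B Y X)
    (hinv : ∀ a ∈ K, ∀ X Y, B (isotropyRep hc a X) (isotropyRep hc a Y) = B X Y) :
    ∃ c₁ c₂ : ℝ, B = diagMetric h12 Q c₁ c₂ := by
  obtain ⟨c₁, hc₁⟩ := h₁.eq_smul hQ hB hinv
  obtain ⟨c₂, hc₂⟩ := h₂.eq_smul hQ hB hinv
  have hor := orthogonal_of_not_areEquivalent hQ h₁ h₂ hne hinv
  refine ⟨c₁, c₂, LinearMap.ext fun X => LinearMap.ext fun Y => ?_⟩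
  have m1 := fun X => Submodule.projection_apply_mem h12 X
  have m2 := fun X => Submodule.projection_apply_mem h12.symm X
  rw [diagMetric_apply, ← hc₁ _ (m1 X) _ (m1 Y), ← hc₂ _ (m2 X) _ (m2 Y)]
  conv_lhs => rw [← Submodule.projection_add_projection_eq_self h12 X,
    ← Submodule.projection_add_projection_eq_self h12 Y]
  simp only [map_add, LinearMap.add_apply]
  rw [hor _ (m1 X) _ (m2 Y), hB (𝔭₂.projection 𝔭₁ _ X), hor _ (m1 Y) _ (m2 X)]
  ring

omit [FiniteDimensional ℝ E] [CompleteSpace E] [LieGroup 𝓘(ℝ, E) ∞ G] in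
theorem projection_isotropyRep {𝔭₁ 𝔭₂ : Submodule ℝ 𝔭} (h12 : IsCompl 𝔭₁ 𝔭₂)
    (h₁ : IsInvariant K hc 𝔭₁) (h₂ : IsInvariant K hc 𝔭₂) {a : G} (ha : a ∈ K) (X : 𝔭) :
    𝔭₁.projection 𝔭₂ h12 (isotropyRep hc a X) = isotropyRep hc a (𝔭₁.projection 𝔭₂ h12 X) := by
  conv_lhs => rw [← Submodule.projection_add_projection_eq_self h12 X]
  rw [map_add, map_add, Submodule.projection_apply_of_mem_left h12
    (h₁ a ha _ (Submodule.projection_apply_mem h12 X)),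
    (Submodule.projection_apply_eq_zero_iff h12).2
    (h₂ a ha _ (Submodule.projection_apply_mem h12.symm X)), add_zero]

omit [FiniteDimensional ℝ E] in
theorem isInvariantMetric_diagMetric (hQ : IsInvariantMetric K hc Q) {𝔭₁ 𝔭₂ : Submodule ℝ 𝔭}
    (h12 : IsCompl 𝔭₁ 𝔭₂) (h₁ : IsInvariant K hc 𝔭₁) (h₂ : IsInvariant K hc 𝔭₂)
    {x₁ x₂ : ℝ} (hx₁ : 0 < x₁) (hx₂ : 0 < x₂) :
    IsInvariantMetric K hc (diagMetric h12 Q x₁ x₂) where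
  symm := diagMetric_symm h12 hQ.symm x₁ x₂
  pos := diagMetric_pos h12 hQ.pos hx₁ hx₂
  invariant a ha X Y := by
    rw [diagMetric_apply, diagMetric_apply, projection_isotropyRep h12 h₁ h₂ ha,
      projection_isotropyRep h12 h₁ h₂ ha, projection_isotropyRep h12.symm h₂ h₁ ha,
      projection_isotropyRep h12.symm h₂ h₁ ha, hQ.invariant a ha, hQ.invariant a ha]

omit [FiniteDimensional ℝ E] [CompleteSpace E] [LieGroup 𝓘(ℝ, E) ∞ G] in
theorem IsIrreducibleSummand.exists_ne_zero {W : Submodule ℝ 𝔭}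
    (hW : IsIrreducibleSummand K hc W) : ∃ X ∈ W, X ≠ 0 :=
  (Submodule.ne_bot_iff W).1 hW.2.1

end Schur

/-! ### Brackets of related vector fields on manifolds. -/

section Related

open VectorField

variable {F : Type*} [NormedAddCommGroup F] [NormedSpace ℝ F]
  {M : Type*} [TopologicalSpace M] [ChartedSpace F M]
  {E : Type*} [NormedAddCommGroup E] [NormedSpace ℝ E]
  {N : Type*} [TopologicalSpace N] [ChartedSpace E N]

/-- A vector field read in the extended chart at `x`. -/
noncomputable def chartField (x : M) (V : Π y : M, TangentSpace 𝓘(ℝ, F) y) : F → F :=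
  mpullbackWithin 𝓘(ℝ, F) 𝓘(ℝ, F) (extChartAt 𝓘(ℝ, F) x).symm V univ

/-- The chart at x has identity differential at x, so the bracket at x is that of the coordinate
expressions. -/
theorem mlieBracket_eq_chartField [IsManifold 𝓘(ℝ, F) 1 M] (x : M)
    (V W : Π y : M, TangentSpace 𝓘(ℝ, F) y) :
    mlieBracket 𝓘(ℝ, F) V W x =
      lieBracket ℝ (chartField x V) (chartField x W) (extChartAt 𝓘(ℝ, F) x x) := by
  have e : ∀ (A : F →L[ℝ] F) (v v' : F), A = ContinuousLinearMap.id ℝ F → v = v' →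
      A.inverse v = v' := by
    rintro _ v _ rfl rfl
    rw [ContinuousLinearMap.inverse_id, ContinuousLinearMap.id_apply]
  have hr : range (𝓘(ℝ, F) : F → F) = univ := range_id
  refine e (mfderiv 𝓘(ℝ, F) 𝓘(ℝ, F) (extChartAt 𝓘(ℝ, F) x) x) _ _ mfderiv_extChartAt_self ?_
  rw [chartField, chartField, ← hr, preimage_univ, univ_inter]
  rw [hr]
  exact congrFun lieBracketWithin_univ _

/-- Relatedness has to be read in charts on a whole neighbourhood, since the bracket differentiates;
off the centre the chart differential is no longer the identity. -/
theorem chartField_eq [IsManifold 𝓘(ℝ, F) 1 M] {x y : M}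
    (hy : y ∈ (extChartAt 𝓘(ℝ, F) x).source)
    (V : Π y : M, TangentSpace 𝓘(ℝ, F) y) :
    chartField x V (extChartAt 𝓘(ℝ, F) x y) = mfderiv 𝓘(ℝ, F) 𝓘(ℝ, F) (extChartAt 𝓘(ℝ, F) x) y
      (V y) := by
  have e : ∀ (A B : F →L[ℝ] F) (v : M → F) (z : M), A.comp B = ContinuousLinearMap.id ℝ F →
      B.comp A = ContinuousLinearMap.id ℝ F → z = y → A.inverse (v z) = B (v y) := by
    intro A B v z h h' hz
    rw [ContinuousLinearMap.inverse_eq h h', hz]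
  have hr : range (𝓘(ℝ, F) : F → F) = univ := range_id
  have h := mfderivWithin_extChartAt_symm_comp_mfderiv_extChartAt' (I := 𝓘(ℝ, F)) hy
  have h' := mfderiv_extChartAt_comp_mfderivWithin_extChartAt_symm' (I := 𝓘(ℝ, F)) hy
  rw [hr] at h h'
  exact e (mfderivWithin 𝓘(ℝ, F) 𝓘(ℝ, F) (extChartAt 𝓘(ℝ, F) x).symm univ
    (extChartAt 𝓘(ℝ, F) x y)) _ V _ h h' (PartialEquiv.left_inv _ hy)

variable [CompleteSpace F] [CompleteSpace E]

theorem differentiableAt_chartField [IsManifold 𝓘(ℝ, F) 2 M] {x : M}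
    {V : Π y : M, TangentSpace 𝓘(ℝ, F) y}
    (hV : MDifferentiableAt 𝓘(ℝ, F) 𝓘(ℝ, F).tangent (fun y => (V y : TangentBundle 𝓘(ℝ, F) M)) x) :
    DifferentiableAt ℝ (chartField x V) (extChartAt 𝓘(ℝ, F) x x) := by
  have := (mdifferentiableWithinAt_univ.2 hV).differentiableWithinAt_mpullbackWithin_vectorField
  have hr : range (𝓘(ℝ, F) : F → F) = univ := range_id
  rw [hr, preimage_univ, univ_inter] at this
  exact differentiableWithinAt_univ.1 this

/-- The brackets of related vector fields are related. -/
theorem mfderiv_mlieBracket_of_related [IsManifold 𝓘(ℝ, F) 2 M] [IsManifold 𝓘(ℝ, E) 2 N]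
    {f : M → N} {x : M} (hf : ContMDiff 𝓘(ℝ, F) 𝓘(ℝ, E) 2 f)
    {V W : Π y : M, TangentSpace 𝓘(ℝ, F) y} {V' W' : Π y : N, TangentSpace 𝓘(ℝ, E) y}
    (hV : MDifferentiableAt 𝓘(ℝ, F) 𝓘(ℝ, F).tangent (fun y => (V y : TangentBundle 𝓘(ℝ, F) M)) x)
    (hW : MDifferentiableAt 𝓘(ℝ, F) 𝓘(ℝ, F).tangent (fun y => (W y : TangentBundle 𝓘(ℝ, F) M)) x)
    (hV' : MDifferentiableAt 𝓘(ℝ, E) 𝓘(ℝ, E).tangent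
      (fun y => (V' y : TangentBundle 𝓘(ℝ, E) N)) (f x))
    (hW' : MDifferentiableAt 𝓘(ℝ, E) 𝓘(ℝ, E).tangent
      (fun y => (W' y : TangentBundle 𝓘(ℝ, E) N)) (f x))
    (hVV' : ∀ y, mfderiv 𝓘(ℝ, F) 𝓘(ℝ, E) f y (V y) = V' (f y))
    (hWW' : ∀ y, mfderiv 𝓘(ℝ, F) 𝓘(ℝ, E) f y (W y) = W' (f y)) :
    mfderiv 𝓘(ℝ, F) 𝓘(ℝ, E) f x (mlieBracket 𝓘(ℝ, F) V W x) =
      mlieBracket 𝓘(ℝ, E) V' W' (f x) := by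
  have : IsManifold 𝓘(ℝ, F) 1 M := .of_le (n := 2) one_le_two
  have : IsManifold 𝓘(ℝ, E) 1 N := .of_le (n := 2) one_le_two
  set φ := extChartAt 𝓘(ℝ, F) x with hφ
  set ψ := extChartAt 𝓘(ℝ, E) (f x) with hψ
  set h : F → E := ψ ∘ f ∘ φ.symm with hh
  have hdf : ∀ y, MDifferentiableAt 𝓘(ℝ, F) 𝓘(ℝ, E) f y := fun y =>
    (hf y).mdifferentiableAt two_ne_zero
  have hder : mfderiv 𝓘(ℝ, F) 𝓘(ℝ, E) f x = fderiv ℝ h (φ x) := by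
    rw [(hdf x).mfderiv]
    simp only [modelWithCornersSelf_coe, range_id, fderivWithin_univ]
    rfl
  have hsm : ContDiffAt ℝ 2 h (φ x) := by
    have := (contMDiffAt_iff.1 (hf x)).2
    have hr : range (𝓘(ℝ, F) : F → F) = univ := range_id
    rw [hr] at this
    exact contDiffWithinAt_univ.1 this
  have hev : ∀ᶠ y in 𝓝 (φ x), y ∈ φ.target ∧ φ.symm y ∈ φ.source ∧ f (φ.symm y) ∈ ψ.source := by
    have h1 : ∀ᶠ y in 𝓝 (φ x), y ∈ φ.target := extChartAt_target_mem_nhds x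
    have hc : ContinuousAt (fun y => f (φ.symm y)) (φ x) := by
      refine ContinuousAt.comp ?_ (continuousAt_extChartAt_symm x)
      exact hf.continuous.continuousAt
    have h2 : ∀ᶠ y in 𝓝 (φ x), f (φ.symm y) ∈ ψ.source := by
      refine hc.preimage_mem_nhds ?_
      rw [φ.left_inv (mem_extChartAt_source x)]
      exact extChartAt_source_mem_nhds (f x)
    filter_upwards [h1, h2] with y hy1 hy2 using ⟨hy1, φ.map_target hy1, hy2⟩
  -- Relatedness in coordinates: dh applied to the first field is the second field composed with h,
  -- near the base point.
  have key : ∀ (U : Π y : M, TangentSpace 𝓘(ℝ, F) y) (U' : Π y : N, TangentSpace 𝓘(ℝ, E) y),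
      (∀ y, mfderiv 𝓘(ℝ, F) 𝓘(ℝ, E) f y (U y) = U' (f y)) →
      (fun y => fderiv ℝ h y (chartField x U y)) =ᶠ[𝓝 (φ x)] chartField (f x) U' ∘ h := by
    intro U U' hUU'
    filter_upwards [hev] with y ⟨hy1, hy2, hy3⟩
    set q := φ.symm y with hq
    have hyq : y = φ q := (φ.right_inv hy1).symm
    have e1 : h y = ψ (f q) := rfl
    have hm1 : MDifferentiableAt 𝓘(ℝ, E) 𝓘(ℝ, E) ψ (f q) :=
      mdifferentiableAt_extChartAt (by rwa [← extChartAt_source 𝓘(ℝ, E)])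
    have hm3 : MDifferentiableAt 𝓘(ℝ, F) 𝓘(ℝ, F) φ q :=
      mdifferentiableAt_extChartAt (by rwa [← extChartAt_source 𝓘(ℝ, F)])
    have hm2 : MDifferentiableAt 𝓘(ℝ, F) 𝓘(ℝ, F) φ.symm y := by
      have := mdifferentiableWithinAt_extChartAt_symm (I := 𝓘(ℝ, F)) hy1
      have hr : range (𝓘(ℝ, F) : F → F) = univ := range_id
      rw [hr] at this
      exact mdifferentiableWithinAt_univ.1 this
    have e2 : (fderiv ℝ h y).comp (mfderiv 𝓘(ℝ, F) 𝓘(ℝ, F) φ q) =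
        (mfderiv 𝓘(ℝ, E) 𝓘(ℝ, E) ψ (f q)).comp (mfderiv 𝓘(ℝ, F) 𝓘(ℝ, E) f q) := by
      have hmh : MDifferentiableAt 𝓘(ℝ, F) 𝓘(ℝ, E) h (φ q) := by
        rw [← hyq]
        exact MDifferentiableAt.comp y hm1 (MDifferentiableAt.comp y (hdf q) hm2)
      have a1 := mfderiv_comp q hmh hm3
      have a2 := mfderiv_comp q hm1 (hdf q)
      have a3 : (h ∘ φ) =ᶠ[𝓝 q] ψ ∘ f := by
        filter_upwards [extChartAt_source_mem_nhds' hy2] with z hz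
        simp only [hh, Function.comp_apply]
        rw [φ.left_inv hz]
      rw [a3.mfderiv_eq, mfderiv_eq_fderiv, ← hyq] at a1
      exact a1.symm.trans a2
    rw [Function.comp_apply, e1, chartField_eq hy3, ← hUU' q]
    rw [hyq, chartField_eq hy2, ← hyq]
    exact congrArg (fun A => A (U q)) e2
  have hhx : h (φ x) = ψ (f x) := by
    simp only [hh, Function.comp_apply]
    rw [φ.left_inv (mem_extChartAt_source x)]
  -- The second derivative of h is symmetric and cancels, so dh of the bracket is a difference of
  -- derivatives of dh(V) and dh(W). By `key` these may be replaced by the fields in the target.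
  have hs := fderiv_apply_lieBracket (n := 2) hsm (by simp) (differentiableAt_chartField hW)
    (differentiableAt_chartField hV)
  rw [(key V V' hVV').fderiv_eq, (key W W' hWW').fderiv_eq,
    fderiv_comp _ (by rw [hhx]; exact differentiableAt_chartField hW')
      (hsm.differentiableAt two_ne_zero),
    fderiv_comp _ (by rw [hhx]; exact differentiableAt_chartField hV')
      (hsm.differentiableAt two_ne_zero),
    ContinuousLinearMap.comp_apply, ContinuousLinearMap.comp_apply,
    show fderiv ℝ h (φ x) (chartField x V (φ x)) = _ from (key V V' hVV').self_of_nhds,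
    show fderiv ℝ h (φ x) (chartField x W (φ x)) = _ from (key W W' hWW').self_of_nhds,
    Function.comp_apply, Function.comp_apply, hhx] at hs
  exact (congrArg₂ (fun (A : F →L[ℝ] E) (v : F) => A v) hder
    (mlieBracket_eq_chartField x V W)).trans
    (hs.trans (mlieBracket_eq_chartField (f x) V' W').symm)

end Related

/-! ### Smooth homomorphisms of Lie groups. -/

section Hom

open VectorField

variable {F : Type*} [NormedAddCommGroup F] [NormedSpace ℝ F]
  {S : Type*} [TopologicalSpace S] [ChartedSpace F S] [Group S]
  {E : Type*} [NormedAddCommGroup E] [NormedSpace ℝ E]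
  {G : Type*} [TopologicalSpace G] [ChartedSpace E G] [Group G]

/-- The differential at `1` of a map of groups. -/
noncomputable def homDeriv (F : Type*) [NormedAddCommGroup F] [NormedSpace ℝ F]
    {S : Type*} [TopologicalSpace S] [ChartedSpace F S] [Group S]
    (E : Type*) [NormedAddCommGroup E] [NormedSpace ℝ E]
    {G : Type*} [TopologicalSpace G] [ChartedSpace E G] [Group G] (f : S → G) :
    GroupLieAlgebra 𝓘(ℝ, F) S →ₗ[ℝ] GroupLieAlgebra 𝓘(ℝ, E) G :=
  (mfderiv 𝓘(ℝ, F) 𝓘(ℝ, E) f 1 : F →L[ℝ] E).toLinearMap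

variable [LieGroup 𝓘(ℝ, F) ∞ S] [LieGroup 𝓘(ℝ, E) ∞ G]

theorem mfderiv_mulInvariantVectorField (f : S →* G) (hf : ContMDiff 𝓘(ℝ, F) 𝓘(ℝ, E) ∞ f)
    (v : GroupLieAlgebra 𝓘(ℝ, F) S) (y : S) :
    mfderiv 𝓘(ℝ, F) 𝓘(ℝ, E) f y (mulInvariantVectorField v y) =
      mulInvariantVectorField (homDeriv F E f v) (f y) := by
  have hd : ∀ y, MDifferentiableAt 𝓘(ℝ, F) 𝓘(ℝ, E) f y := fun y =>
    (hf y).mdifferentiableAt (by simp)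
  have hl : ∀ y z : S, MDifferentiableAt 𝓘(ℝ, F) 𝓘(ℝ, F) (fun x => y * x) z := fun y z =>
    (contMDiff_mul_left (I := 𝓘(ℝ, F)) (n := ∞) z).mdifferentiableAt (by simp)
  have hl' : ∀ y z : G, MDifferentiableAt 𝓘(ℝ, E) 𝓘(ℝ, E) (fun x => y * x) z := fun y z =>
    (contMDiff_mul_left (I := 𝓘(ℝ, E)) (n := ∞) z).mdifferentiableAt (by simp)
  have e1 := mfderiv_comp_apply (I'' := 𝓘(ℝ, E)) (g := f) (f := fun x => y * x) (1 : S)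
    (hd _) (hl y 1) v
  have e2 := mfderiv_comp_apply (I'' := 𝓘(ℝ, E)) (g := fun x => f y * x) (f := f) (1 : S)
    (hl' _ _) (hd 1) v
  have e3 : (f ∘ fun x => y * x) = (fun x => f y * x) ∘ f := by
    ext x; simp
  -- The chain rule produces the derivative at y * 1 rather than y. The tangent spaces are copies of
  -- the same model space, and the two derivatives are compared there.
  have aux : ∀ (z : S), z = y → ∀ w : F,
      (mfderiv 𝓘(ℝ, F) 𝓘(ℝ, E) f z : F →L[ℝ] E) w = (mfderiv 𝓘(ℝ, F) 𝓘(ℝ, E) f y : F →L[ℝ] E) w := by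
    rintro _ rfl w; rfl
  have aux' : ∀ (z : G), z = 1 → ∀ w : E,
      (mfderiv 𝓘(ℝ, E) 𝓘(ℝ, E) (fun x => f y * x) z : E →L[ℝ] E) w =
      (mfderiv 𝓘(ℝ, E) 𝓘(ℝ, E) (fun x => f y * x) 1 : E →L[ℝ] E) w := by
    rintro _ rfl w; rfl
  rw [e3] at e1
  exact (aux _ (mul_one y) _).symm.trans ((e1.symm.trans e2).trans (aux' _ (map_one f) _))

variable [CompleteSpace F] [CompleteSpace E]

/-- The differential at `1` of a smooth homomorphism of Lie groups preserves brackets. -/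
theorem homDeriv_lie (f : S →* G) (hf : ContMDiff 𝓘(ℝ, F) 𝓘(ℝ, E) ∞ f)
    (v w : GroupLieAlgebra 𝓘(ℝ, F) S) :
    homDeriv F E f ⁅v, w⁆ = ⁅homDeriv F E f v, homDeriv F E f w⁆ := by
  have : IsManifold 𝓘(ℝ, F) 2 S := .of_le (n := ∞) ENat.LEInfty.out
  have : IsManifold 𝓘(ℝ, E) 2 G := .of_le (n := ∞) ENat.LEInfty.out
  have h := mfderiv_mlieBracket_of_related (x := (1 : S)) (hf.of_le ENat.LEInfty.out)
    (mdifferentiableAt_mulInvariantVectorField v) (mdifferentiableAt_mulInvariantVectorField w)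
    (mdifferentiableAt_mulInvariantVectorField (homDeriv F E f v))
    (mdifferentiableAt_mulInvariantVectorField (homDeriv F E f w))
    (mfderiv_mulInvariantVectorField f hf v) (mfderiv_mulInvariantVectorField f hf w)
  have aux : ∀ (z : G), z = 1 →
      (mlieBracket 𝓘(ℝ, E) (mulInvariantVectorField (homDeriv F E f v))
        (mulInvariantVectorField (homDeriv F E f w)) z : E) =
      mlieBracket 𝓘(ℝ, E) (mulInvariantVectorField (homDeriv F E f v))
        (mulInvariantVectorField (homDeriv F E f w)) (1 : G) := by
    rintro _ rfl; rfl
  exact h.trans (aux _ (map_one f))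

end Hom

/-! ### The adjoint representation. -/

section Adjoint

variable {E : Type*} [NormedAddCommGroup E] [NormedSpace ℝ E] [CompleteSpace E]
  {G : Type*} [TopologicalSpace G] [ChartedSpace E G] [Group G] [LieGroup 𝓘(ℝ, E) ∞ G]

omit [CompleteSpace E] in
theorem contMDiff_conj (a : G) :
    ContMDiff 𝓘(ℝ, E) 𝓘(ℝ, E) ∞ (fun x : G => a * x * a⁻¹) :=
  (contMDiff_mul_right (a := a⁻¹)).comp (contMDiff_mul_left (a := a))

theorem Ad_lie (a : G) (v w : GroupLieAlgebra 𝓘(ℝ, E) G) :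
    Ad E a ⁅v, w⁆ = ⁅Ad E a v, Ad E a w⁆ :=
  homDeriv_lie (MulAut.conj a).toMonoidHom (contMDiff_conj a) v w

omit [CompleteSpace E] in
theorem Ad_mul (a b : G) (v : GroupLieAlgebra 𝓘(ℝ, E) G) :
    Ad E (a * b) v = Ad E a (Ad E b v) := by
  have hd : ∀ a z : G, MDifferentiableAt 𝓘(ℝ, E) 𝓘(ℝ, E) (fun x : G => a * x * a⁻¹) z :=
    fun a z => (contMDiff_conj a z).mdifferentiableAt (by simp)
  have e1 := mfderiv_comp_apply (I'' := 𝓘(ℝ, E)) (g := fun x : G => a * x * a⁻¹)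
    (f := fun x : G => b * x * b⁻¹) (1 : G) (hd a _) (hd b 1) v
  have e2 : (fun x : G => a * x * a⁻¹) ∘ (fun x : G => b * x * b⁻¹) =
      fun x : G => a * b * x * (a * b)⁻¹ := by
    ext x; simp [mul_assoc]
  have aux : ∀ (z : G), z = 1 → ∀ w : E,
      (mfderiv 𝓘(ℝ, E) 𝓘(ℝ, E) (fun x : G => a * x * a⁻¹) z : E →L[ℝ] E) w =
      (mfderiv 𝓘(ℝ, E) 𝓘(ℝ, E) (fun x : G => a * x * a⁻¹) 1 : E →L[ℝ] E) w := by
    rintro _ rfl w; rfl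
  rw [e2] at e1
  exact e1.trans (aux _ (by simp) _)

omit [CompleteSpace E] [LieGroup 𝓘(ℝ, E) ∞ G] in
theorem Ad_one (v : GroupLieAlgebra 𝓘(ℝ, E) G) : Ad E (1 : G) v = v := by
  have : (fun x : G => (1 : G) * x * 1⁻¹) = id := by ext; simp
  have e : mfderiv 𝓘(ℝ, E) 𝓘(ℝ, E) (fun x : G => (1 : G) * x * 1⁻¹) 1 =
      ContinuousLinearMap.id ℝ E := by
    rw [this]; exact mfderiv_id
  exact congrArg (fun A : E →L[ℝ] E => A v) e

/-- The adjoint representation by automorphisms of the Lie algebra. -/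
noncomputable def AdEquiv (a : G) : GroupLieAlgebra 𝓘(ℝ, E) G ≃ₗ⁅ℝ⁆ GroupLieAlgebra 𝓘(ℝ, E) G where
  toFun := Ad E a
  map_add' := map_add _
  map_smul' := map_smul _
  map_lie' := Ad_lie a _ _
  invFun := Ad E a⁻¹
  left_inv v := by rw [← Ad_mul, inv_mul_cancel, Ad_one]
  right_inv v := by rw [← Ad_mul, mul_inv_cancel, Ad_one]

theorem killingForm_Ad (a : G) (v w : GroupLieAlgebra 𝓘(ℝ, E) G) :
    killingForm ℝ (GroupLieAlgebra 𝓘(ℝ, E) G) (Ad E a v) (Ad E a w) =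
      killingForm ℝ (GroupLieAlgebra 𝓘(ℝ, E) G) v w :=
  LieAlgebra.killingForm_of_equiv_apply (AdEquiv a) v w

variable {F : Type*} [NormedAddCommGroup F] [NormedSpace ℝ F]
  {S : Subgroup G} [ChartedSpace F S] [LieGroup 𝓘(ℝ, F) ∞ S]

theorem lieSub_lie_mem [CompleteSpace F]
    (hS : ContMDiff 𝓘(ℝ, F) 𝓘(ℝ, E) ∞ (Subtype.val : S → G)) {v w : GroupLieAlgebra 𝓘(ℝ, E) G}
    (hv : v ∈ lieSub E F S) (hw : w ∈ lieSub E F S) : ⁅v, w⁆ ∈ lieSub E F S := by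
  obtain ⟨v, rfl⟩ := hv
  obtain ⟨w, rfl⟩ := hw
  exact ⟨⁅v, w⁆, homDeriv_lie S.subtype hS v w⟩

omit [CompleteSpace E] in
theorem inclusionDeriv_Ad (hS : ContMDiff 𝓘(ℝ, F) 𝓘(ℝ, E) ∞ (Subtype.val : S → G)) (a : S)
    (v : GroupLieAlgebra 𝓘(ℝ, F) S) :
    inclusionDeriv E F S (Ad F a v) = Ad E (a : G) (inclusionDeriv E F S v) := by
  have hd : ∀ z, MDifferentiableAt 𝓘(ℝ, F) 𝓘(ℝ, E) (Subtype.val : S → G) z :=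
    fun z => (hS z).mdifferentiableAt (by simp)
  have hc : ∀ z : G, MDifferentiableAt 𝓘(ℝ, E) 𝓘(ℝ, E) (fun x : G => (a : G) * x * (a : G)⁻¹) z :=
    fun z => (contMDiff_conj (a : G) z).mdifferentiableAt (by simp)
  have hc' : ∀ z : S, MDifferentiableAt 𝓘(ℝ, F) 𝓘(ℝ, F) (fun x : S => a * x * a⁻¹) z :=
    fun z => (contMDiff_conj a z).mdifferentiableAt (by simp)
  have e1 := mfderiv_comp_apply (I'' := 𝓘(ℝ, E)) (g := (Subtype.val : S → G))
    (f := fun x : S => a * x * a⁻¹) (1 : S) (hd _) (hc' 1) v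
  have e2 := mfderiv_comp_apply (I'' := 𝓘(ℝ, E)) (g := fun x : G => (a : G) * x * (a : G)⁻¹)
    (f := (Subtype.val : S → G)) (1 : S) (hc _) (hd 1) v
  have e3 : (Subtype.val : S → G) ∘ (fun x : S => a * x * a⁻¹) =
      (fun x : G => (a : G) * x * (a : G)⁻¹) ∘ (Subtype.val : S → G) := by
    ext x; simp
  have aux : ∀ (z : S), z = 1 → ∀ w : F,
      (mfderiv 𝓘(ℝ, F) 𝓘(ℝ, E) (Subtype.val : S → G) z : F →L[ℝ] E) w =
      (mfderiv 𝓘(ℝ, F) 𝓘(ℝ, E) (Subtype.val : S → G) 1 : F →L[ℝ] E) w := by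
    rintro _ rfl w; rfl
  rw [e3] at e1
  have aux' : ∀ (z : G), z = 1 → ∀ w : E,
      (mfderiv 𝓘(ℝ, E) 𝓘(ℝ, E) (fun x : G => (a : G) * x * (a : G)⁻¹) z : E →L[ℝ] E) w =
      (mfderiv 𝓘(ℝ, E) 𝓘(ℝ, E) (fun x : G => (a : G) * x * (a : G)⁻¹) 1 : E →L[ℝ] E) w := by
    rintro _ rfl w; rfl
  exact (aux (a * 1 * a⁻¹) (by simp) _).symm.trans
    ((e1.symm.trans e2).trans (aux' ((1 : S) : G) (by simp) _))

omit [CompleteSpace E] in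
theorem Ad_mem_lieSub (hS : ContMDiff 𝓘(ℝ, F) 𝓘(ℝ, E) ∞ (Subtype.val : S → G)) {a : G}
    (ha : a ∈ S) {v : GroupLieAlgebra 𝓘(ℝ, E) G} (hv : v ∈ lieSub E F S) :
    Ad E a v ∈ lieSub E F S := by
  obtain ⟨v, rfl⟩ := hv
  exact ⟨Ad F (⟨a, ha⟩ : S) v, inclusionDeriv_Ad hS ⟨a, ha⟩ v⟩

omit [LieGroup 𝓘(ℝ, F) ∞ S] in
theorem mem_isotropySpace {v : GroupLieAlgebra 𝓘(ℝ, E) G} :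
    v ∈ isotropySpace E F S ↔
      ∀ w ∈ lieSub E F S, killingForm ℝ (GroupLieAlgebra 𝓘(ℝ, E) G) v w = 0 := by
  rw [isotropySpace, LinearMap.BilinForm.mem_orthogonal_iff]
  refine forall₂_congr fun w _ => ?_
  rw [LieModule.traceForm_comm]

/-- Ad(a) preserves the Killing form, and Ad(a⁻¹) preserves the Lie algebra of S. -/
theorem Ad_mem_isotropySpace (hS : ContMDiff 𝓘(ℝ, F) 𝓘(ℝ, E) ∞ (Subtype.val : S → G)) {a : G}
    (ha : a ∈ S) {v : GroupLieAlgebra 𝓘(ℝ, E) G} (hv : v ∈ isotropySpace E F S) :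
    Ad E a v ∈ isotropySpace E F S := by
  rw [mem_isotropySpace] at hv ⊢
  intro w hw
  have h1 : w = Ad E a (Ad E a⁻¹ w) := by rw [← Ad_mul, mul_inv_cancel, Ad_one]
  rw [h1, killingForm_Ad]
  exact hv _ (Ad_mem_lieSub hS (inv_mem ha) hw)

/-- The isotropy representation acts by restrictions of automorphisms. -/
theorem isAutRestriction_isotropyRep (hS : ContMDiff 𝓘(ℝ, F) 𝓘(ℝ, E) ∞ (Subtype.val : S → G))
    (hc : IsCompl (isotropySpace E F S) (lieSub E F S)) {a : G} (ha : a ∈ S) :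
    IsAutRestriction (lieSub E F S) (isotropyRep hc a) := by
  refine ⟨AdEquiv a, fun X hX => Ad_mem_isotropySpace hS ha hX,
    fun X hX => Ad_mem_lieSub hS ha hX, fun X => ?_⟩
  exact congrArg Subtype.val (Submodule.projectionOnto_apply_left hc
    (⟨Ad E a X, Ad_mem_isotropySpace hS ha X.2⟩ : isotropySpace E F S))

end Adjoint

/-! ### Ricci tensor of invariant metrics and the Einstein equation. -/

section Fibration

variable {E EK EH : Type*}
  [NormedAddCommGroup E] [NormedSpace ℝ E] [FiniteDimensional ℝ E] [CompleteSpace E]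
  [NormedAddCommGroup EK] [NormedSpace ℝ EK]
  [NormedAddCommGroup EH] [NormedSpace ℝ EH]
  {G : Type*} [TopologicalSpace G] [ChartedSpace E G] [Group G] [LieGroup 𝓘(ℝ, E) ∞ G]
  {K H : Subgroup G}
  [ChartedSpace EK K] [LieGroup 𝓘(ℝ, EK) ∞ K]
  [ChartedSpace EH H] [LieGroup 𝓘(ℝ, EH) ∞ H]
  (hKsmooth : ContMDiff 𝓘(ℝ, EK) 𝓘(ℝ, E) ∞ (Subtype.val : K → G))
  (hHsmooth : ContMDiff 𝓘(ℝ, EH) 𝓘(ℝ, E) ∞ (Subtype.val : H → G))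
  {hc : IsCompl (isotropySpace E EK K) (lieSub E EK K)}
  {𝔭₁ 𝔭₂ : Submodule ℝ (isotropySpace E EK K)} (h12 : IsCompl 𝔭₁ 𝔭₂)
  (hirr₁ : IsIrreducibleSummand K hc 𝔭₁) (hirr₂ : IsIrreducibleSummand K hc 𝔭₂)
  (hineq : ¬ AreEquivalent K hc 𝔭₁ 𝔭₂)
  (hLieH : lieSub E EH H = lieSub E EK K ⊔ 𝔭₁.map (isotropySpace E EK K).subtype)
  {Q : LinearMap.BilinForm ℝ (isotropySpace E EK K)} (hQ : IsInvariantMetric K hc Q)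
  {b₁ b₂ : ℝ} (hb₁ : 0 < b₁) (hb₂ : 0 < b₂)
  (hQ₁ : ∀ X ∈ 𝔭₁, ∀ Y ∈ 𝔭₁, -killingForm ℝ (GroupLieAlgebra 𝓘(ℝ, E) G) X Y = b₁ * Q X Y)
  (hQ₂ : ∀ X ∈ 𝔭₂, ∀ Y ∈ 𝔭₂, -killingForm ℝ (GroupLieAlgebra 𝓘(ℝ, E) G) X Y = b₂ * Q X Y)

include hKsmooth h12 hirr₁ hirr₂ hineq hQ hQ₁ hQ₂

/-- The hypotheses compare -B with Q on each summand only. The mixed terms vanish by Schur's lemma,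
since B is Ad(K)-invariant and the summands are inequivalent. Positivity of -B on all of 𝔭 follows.
-/
theorem killP_eq_diagMetric :
    killP (isotropySpace E EK K) = diagMetric h12 Q b₁ b₂ := by
  have hor := orthogonal_of_not_areEquivalent hQ hirr₁ hirr₂ hineq
    (B := killP (isotropySpace E EK K))
    (fun a ha => (isAutRestriction_isotropyRep hKsmooth hc ha).killP)
  refine LinearMap.ext fun X => LinearMap.ext fun Y => ?_
  have m1 := fun X => Submodule.projection_apply_mem h12 X
  have m2 := fun X => Submodule.projection_apply_mem h12.symm X
  rw [diagMetric_apply, ← hQ₁ _ (m1 X) _ (m1 Y), ← hQ₂ _ (m2 X) _ (m2 Y), ← killP_apply,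
    ← killP_apply]
  conv_lhs => rw [← Submodule.projection_add_projection_eq_self h12 X,
    ← Submodule.projection_add_projection_eq_self h12 Y]
  simp only [map_add, LinearMap.add_apply]
  rw [hor _ (m1 X) _ (m2 Y), killP_symm (𝔭₂.projection 𝔭₁ _ X), hor _ (m1 Y) _ (m2 X)]
  ring

include hb₁ hb₂

theorem isReductive_isotropySpace : IsReductive (lieSub E EK K) (isotropySpace E EK K) where
  orth X hX k hk := mem_isotropySpace.1 hX k hk
  neg X hX hX0 := by
    have h := killP_eq_diagMetric hKsmooth h12 hirr₁ hirr₂ hineq hQ hQ₁ hQ₂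
    have hpos := diagMetric_pos h12 hQ.pos hb₁ hb₂ ⟨X, hX⟩ (by simpa using hX0)
    rw [← h, killP_apply] at hpos
    exact neg_pos.1 hpos

include hLieH hHsmooth

theorem isFibred_isotropySpace [CompleteSpace EH] : IsFibred hc 𝔭₁ 𝔭₂ where
  red := isReductive_isotropySpace hKsmooth h12 hirr₁ hirr₂ hineq hQ hb₁ hb₂ hQ₁ hQ₂
  compl := h12
  orth := orthogonal_of_not_areEquivalent hQ hirr₁ hirr₂ hineq
    (fun a ha => (isAutRestriction_isotropyRep hKsmooth hc ha).killP)
  lie₁₁ X hX Y hY := by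
    have hmem : ∀ Z ∈ 𝔭₁, (Z : GroupLieAlgebra 𝓘(ℝ, E) G) ∈ lieSub E EH H := fun Z hZ => by
      rw [hLieH]
      exact Submodule.mem_sup_right ⟨Z, hZ, rfl⟩
    have hb := lieSub_lie_mem hHsmooth (hmem X hX) (hmem Y hY)
    rw [hLieH] at hb
    obtain ⟨k, hk, _, ⟨p, hp, rfl⟩, hkp⟩ := Submodule.mem_sup.1 hb
    rw [coe_bracketP, ← hkp, map_add, (Submodule.projectionOnto_apply_eq_zero_iff hc).2 hk,
      zero_add]
    have : (isotropySpace E EK K).projectionOnto (lieSub E EK K) hc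
        ((isotropySpace E EK K).subtype p) = p := Submodule.projectionOnto_apply_left hc p
    rw [this]
    exact hp

/-- The Ricci tensor of the diagonal metrics. -/
theorem exists_ricci_diagMetric [CompleteSpace EH] :
    ∃ A B C D : ℝ, 0 ≤ C ∧ 0 ≤ D ∧ ∀ x₁ x₂ : ℝ, 0 < x₁ → 0 < x₂ → ∀ X Y,
      ricci hc (diagMetric h12 Q x₁ x₂) X Y =
        diagMetric h12 Q (A + C * (x₁ / x₂) ^ 2) (B - D * (x₁ / x₂)) X Y := by
  have hF := isFibred_isotropySpace hKsmooth hHsmooth h12 hirr₁ hirr₂ hineq hLieH hQ hb₁ hb₂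
    hQ₁ hQ₂
  obtain ⟨Y₁, hY₁, hY₁0⟩ := hirr₁.exists_ne_zero
  obtain ⟨Y₂, hY₂, hY₂0⟩ := hirr₂.exists_ne_zero
  have hq₁ := hQ.pos Y₁ hY₁0
  have hq₂ := hQ.pos Y₂ hY₂0
  obtain ⟨A, C, hC, hAC⟩ := hF.ricci_left hY₁
  obtain ⟨B, D, hD, hBD⟩ := hF.ricci_right hY₂
  -- By Schur the Ricci tensor is diagonal, so one vector in each summand determines it. The powers
  -- of b₂/b₁ come from u₁/u₂ = (b₂/b₁)(x₁/x₂), and the divisors normalise Y₁ and Y₂.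
  refine ⟨A / Q Y₁ Y₁, B / Q Y₂ Y₂, C * (b₂ / b₁) ^ 2 / Q Y₁ Y₁, D * (b₂ / b₁) / Q Y₂ Y₂,
    by positivity, by positivity, fun x₁ x₂ hx₁ hx₂ => ?_⟩
  have hg := isInvariantMetric_diagMetric hQ h12 hirr₁.1 hirr₂.1 hx₁ hx₂
  obtain ⟨c₁, c₂, hcc⟩ := eq_diagMetric_of_invariant hQ h12 hirr₁ hirr₂ hineq
    (B := ricciForm hc (diagMetric h12 Q x₁ x₂))
    (fun X Y => ricci_symm hc hF.red hg.nondegenerate hg.symm X Y)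
    (fun a ha X Y => (isAutRestriction_isotropyRep hKsmooth hc ha).ricci hc hg.nondegenerate
      (hg.invariant a ha) (hQ.bijective ha) X Y)
  have hr : ∀ X Y, ricci hc (diagMetric h12 Q x₁ x₂) X Y = diagMetric h12 Q c₁ c₂ X Y := by
    intro X Y
    rw [← hcc, ricciForm_apply]
  have hz : x₁ / b₁ / (x₂ / b₂) = (b₂ / b₁) * (x₁ / x₂) := by field_simp
  have hdm := diagMetric_eq_killP h12 hb₁ hb₂ hQ₁ hQ₂ x₁ x₂
  have e₁ : c₁ = A / Q Y₁ Y₁ + C * (b₂ / b₁) ^ 2 / Q Y₁ Y₁ * (x₁ / x₂) ^ 2 := by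
    have := hAC (x₁ / b₁) (x₂ / b₂) (by positivity) (by positivity)
    rw [← hdm, hr, diagMetric_apply_left h12 Q c₁ c₂ hY₁ hY₁, hz] at this
    field_simp at this ⊢
    linarith
  have e₂ : c₂ = B / Q Y₂ Y₂ - D * (b₂ / b₁) / Q Y₂ Y₂ * (x₁ / x₂) := by
    have := hBD (x₁ / b₁) (x₂ / b₂) (by positivity) (by positivity)
    rw [← hdm, hr, diagMetric_apply_right h12 Q c₁ c₂ hY₂ hY₂, hz] at this
    field_simp at this ⊢
    linarith
  intro X Y
  rw [hr, e₁, e₂]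

/-- The Ricci tensor of the diagonal metrics, if there are exactly two invariant Einstein metrics
up to scaling. -/
theorem exists_ricci_diagMetric_of_einstein [CompleteSpace EH] {y₁ y₂ : ℝ} (hy₁ : 0 < y₁)
    (hy₁₂ : y₁ < y₂)
    (hEinstein : ∀ g, IsInvariantMetric K hc g →
      (IsEinstein hc g ↔ ∃ s : ℝ, 0 < s ∧
        (g = diagMetric h12 Q (s * y₁) s ∨ g = diagMetric h12 Q (s * y₂) s))) :
    ∃ C D : ℝ, 0 ≤ C ∧ 0 ≤ D ∧ 0 < C + D ∧ ∀ x₁ x₂ : ℝ, 0 < x₁ → 0 < x₂ → ∀ X Y,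
      ricci hc (diagMetric h12 Q x₁ x₂) X Y =
        diagMetric h12 Q ((C + D) * y₁ * y₂ + C * (x₁ / x₂) ^ 2)
          ((C + D) * (y₁ + y₂) - D * (x₁ / x₂)) X Y := by
  obtain ⟨A, B, C, D, hC, hD, hR⟩ := exists_ricci_diagMetric hKsmooth hHsmooth h12 hirr₁ hirr₂
    hineq hLieH hQ hb₁ hb₂ hQ₁ hQ₂
  obtain ⟨Y₁, hY₁, hY₁0⟩ := hirr₁.exists_ne_zero
  obtain ⟨Y₂, hY₂, hY₂0⟩ := hirr₂.exists_ne_zero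
  have hq₁ := hQ.pos Y₁ hY₁0
  have hq₂ := hQ.pos Y₂ hY₂0
  have hcoef : ∀ a₁ a₂ c₁ c₂ : ℝ, diagMetric h12 Q a₁ a₂ = diagMetric h12 Q c₁ c₂ →
      a₁ = c₁ ∧ a₂ = c₂ := by
    intro a₁ a₂ c₁ c₂ h
    have h1 := congrArg (fun g => g Y₁ Y₁) h
    have h2 := congrArg (fun g => g Y₂ Y₂) h
    simp only [diagMetric_apply_left h12 Q _ _ hY₁ hY₁] at h1
    simp only [diagMetric_apply_right h12 Q _ _ hY₂ hY₂] at h2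
    exact ⟨mul_right_cancel₀ hq₁.ne' h1, mul_right_cancel₀ hq₂.ne' h2⟩
  -- Eliminating the Einstein constant from A + C y² = c y and B - D y = c leaves a quadratic
  -- equation for the ratio.
  have hiff : ∀ y : ℝ, 0 < y → (A + C * y ^ 2 = y * (B - D * y) ↔ y = y₁ ∨ y = y₂) := by
    intro y hy
    have hg := isInvariantMetric_diagMetric hQ h12 hirr₁.1 hirr₂.1 hy one_pos
    have hRy := hR y 1 hy one_pos
    rw [div_one] at hRy
    constructor
    · intro h
      have hE : IsEinstein hc (diagMetric h12 Q y 1) := by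
        refine ⟨B - D * y, fun X Y => ?_⟩
        rw [hRy, h, diagMetric_apply, diagMetric_apply]
        ring
      obtain ⟨s, hs, h' | h'⟩ := (hEinstein _ hg).1 hE
      · obtain ⟨e1, e2⟩ := hcoef _ _ _ _ h'
        left; rw [e1, ← e2, one_mul]
      · obtain ⟨e1, e2⟩ := hcoef _ _ _ _ h'
        right; rw [e1, ← e2, one_mul]
    · intro h
      have hE : IsEinstein hc (diagMetric h12 Q y 1) := by
        refine (hEinstein _ hg).2 ⟨1, one_pos, ?_⟩
        rcases h with rfl | rfl
        · left; rw [one_mul]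
        · right; rw [one_mul]
      obtain ⟨c, hc'⟩ := hE
      have h1 := hc' Y₁ Y₁
      have h2 := hc' Y₂ Y₂
      rw [hRy, diagMetric_apply_left h12 Q _ _ hY₁ hY₁, diagMetric_apply_left h12 Q _ _ hY₁ hY₁,
        ← mul_assoc] at h1
      rw [hRy, diagMetric_apply_right h12 Q _ _ hY₂ hY₂, diagMetric_apply_right h12 Q _ _ hY₂ hY₂,
        ← mul_assoc] at h2
      rw [mul_right_cancel₀ hq₁.ne' h1, mul_right_cancel₀ hq₂.ne' h2]
      ring
  -- Two distinct roots determine A and B in terms of C + D, as in Vieta's formulas.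
  have k1 := (hiff y₁ hy₁).2 (Or.inl rfl)
  have k2 := (hiff y₂ (hy₁.trans hy₁₂)).2 (Or.inr rfl)
  have hB : B = (C + D) * (y₁ + y₂) := by
    have : (y₂ - y₁) * (B - (C + D) * (y₁ + y₂)) = 0 := by linear_combination k1 - k2
    rcases mul_eq_zero.1 this with h | h <;> linarith
  have hA : A = (C + D) * y₁ * y₂ := by
    rw [hB] at k1; linear_combination k1
  refine ⟨C, D, hC, hD, ?_, ?_⟩
  · rcases (add_nonneg hC hD).lt_or_eq with h | h
    · exact h
    · exfalso
      -- If C + D = 0 then A = B = 0 and every ratio is Einstein; y₂ + 1 is a third one.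
      have := (hiff (y₂ + 1) (by linarith)).1 (by
        rw [hA, hB]; linear_combination (-(y₂ + 1) ^ 2 - y₁ * y₂ + (y₂ + 1) * (y₁ + y₂)) * h)
      rcases this with h | h <;> linarith
  · rw [← hA, ← hB]
    exact hR

end Fibration

/-! ### Inverse functions and linear asymptotics. -/

section Inverse

/-- A function with negative derivative on `(-∞, b)` (used on `[0, b)`) tending to `-∞` at `b` has an
inverse on `(-∞, F 0)` with values in `(0, b)`. -/
theorem exists_decreasing_inverse {F F' : ℝ → ℝ} {b : ℝ} (hb : 0 < b)
    (hF : ∀ y < b, HasDerivAt F (F' y) y) (hF' : ∀ y < b, F' y < 0)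
    (hlim : Tendsto F (𝓝[<] b) atBot) :
    ∃ Y : ℝ → ℝ, (∀ t < F 0, 0 < Y t ∧ Y t < b ∧ F (Y t) = t ∧ HasDerivAt Y (F' (Y t))⁻¹ t) ∧
      Tendsto Y (𝓝[<] (F 0)) (𝓝 0) ∧ Tendsto Y atBot (𝓝 b) := by
  have hcont : ContinuousOn F (Iio b) := fun y hy => (hF y hy).continuousAt.continuousWithinAt
  have hanti : StrictAntiOn F (Iio b) := by
    refine strictAntiOn_of_deriv_neg (convex_Iio b) hcont fun y hy => ?_
    rw [interior_Iio] at hy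
    rw [(hF y hy).deriv]
    exact hF' y hy
  have hsurj : ∀ t < F 0, ∃ y, 0 < y ∧ y < b ∧ F y = t := by
    intro t ht
    obtain ⟨z, hzt, hz⟩ := ((hlim.eventually (eventually_lt_atBot t)).and
      (Ioo_mem_nhdsLT hb)).exists
    obtain ⟨y, hy, rfl⟩ := intermediate_value_Icc' hz.1.le
      (hcont.mono fun w hw => hw.2.trans_lt hz.2) ⟨hzt.le, ht.le⟩
    refine ⟨y, lt_of_le_of_ne hy.1 ?_, hy.2.trans_lt hz.2, rfl⟩
    rintro rfl
    exact ht.ne rfl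
  choose! Y hY₀ hYb hFY using hsurj
  -- Monotonicity turns every bound on Y t into a bound on t, so continuity and both limits of Y can
  -- be checked in the order topology.
  have key : ∀ t < F 0, ∀ y < b, (y < Y t ↔ t < F y) := fun t ht y hy => by
    rw [← hanti.lt_iff_gt (hYb t ht) hy, hFY t ht]
  have key' : ∀ t < F 0, ∀ y < b, (Y t < y ↔ F y < t) := fun t ht y hy => by
    rw [← hanti.lt_iff_gt hy (hYb t ht), hFY t ht]
  have hYc : ∀ t < F 0, ContinuousAt Y t := by
    intro t ht
    refine tendsto_order.2 ⟨fun y hy => ?_, fun y hy => ?_⟩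
    · have hyb := hy.trans (hYb t ht)
      filter_upwards [Iio_mem_nhds ht, Iio_mem_nhds ((key t ht y hyb).1 hy)] with s hs hs'
      exact (key s hs y hyb).2 hs'
    · rcases lt_or_ge y b with hyb | hyb
      · filter_upwards [Iio_mem_nhds ht, Ioi_mem_nhds ((key' t ht y hyb).1 hy)] with s hs hs'
        exact (key' s hs y hyb).2 hs'
      · filter_upwards [Iio_mem_nhds ht] with s hs using (hYb s hs).trans_le hyb
  refine ⟨Y, fun t ht => ⟨hY₀ t ht, hYb t ht, hFY t ht, ?_⟩, ?_, ?_⟩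
  · refine HasDerivAt.of_local_left_inverse (hYc t ht) (hF _ (hYb t ht)) (hF' _ (hYb t ht)).ne ?_
    filter_upwards [Iio_mem_nhds ht] with s hs using hFY s hs
  · refine tendsto_order.2 ⟨fun y hy => ?_, fun y hy => ?_⟩
    · filter_upwards [self_mem_nhdsWithin] with s hs using hy.trans (hY₀ s hs)
    · rcases lt_or_ge y b with hyb | hyb
      · have : F y < F 0 := hanti hb hyb hy
        filter_upwards [Ioo_mem_nhdsLT this] with s hs
        exact (key' s hs.2 y hyb).2 hs.1
      · filter_upwards [self_mem_nhdsWithin] with s hs using (hYb s hs).trans_le hyb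
  · refine tendsto_order.2 ⟨fun y hy => ?_, fun y hy => ?_⟩
    · filter_upwards [Iio_mem_atBot (F 0), Iio_mem_atBot (F y)] with s hs hs'
      exact (key s hs y hy).2 hs'
    · filter_upwards [Iio_mem_atBot (F 0)] with s hs using (hYb s hs).trans hy

/-- If `f' → l` at `-∞` then `f(t)/t → l`. -/
theorem tendsto_div_atBot_of_deriv {f f' : ℝ → ℝ} {l T : ℝ} (hf : ∀ t < T, HasDerivAt f (f' t) t)
    (hl : Tendsto f' atBot (𝓝 l)) : Tendsto (fun t => f t / t) atBot (𝓝 l) := by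
  rw [Metric.tendsto_nhds]
  intro ε hε
  have h1 := (Metric.tendsto_nhds.1 hl (ε / 2) (half_pos hε))
  obtain ⟨N, hN⟩ := eventually_atBot.1 (h1.and (Iio_mem_atBot T))
  set c := |f N - l * N| with hc
  -- Chosen so that c + (ε/2)(N - t) < ε |t|; the left side bounds |f t - l t| by the mean value
  -- inequality on [t, N].
  have h2 : ∀ᶠ t : ℝ in atBot, t < -(2 * c / ε) - |N| - 1 := Iio_mem_atBot _
  filter_upwards [h2, Iic_mem_atBot N] with t ht htN
  have hb : ‖(f N - l * N) - (f t - l * t)‖ ≤ ε / 2 * ‖N - t‖ := by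
    refine (convex_Iic N).norm_image_sub_le_of_norm_hasDerivWithin_le
      (f := fun s => f s - l * s) (f' := fun s => f' s - l) (fun s hs => ?_) (fun s hs => ?_)
      htN (mem_Iic.2 le_rfl)
    · have : HasDerivAt (fun s => f s - l * s) (f' s - l * 1) s :=
        (hf s (hN s hs).2).sub ((hasDerivAt_id s).const_mul l)
      rw [mul_one] at this
      exact this.hasDerivWithinAt
    · exact ((Real.dist_eq _ _).symm ▸ (hN s hs).1).le
  have hc0 : 0 ≤ c := abs_nonneg _
  have hce : 0 ≤ 2 * c / ε := by positivity
  have hN0 := abs_nonneg N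
  have ht0 : t < 0 := by linarith
  rw [Real.norm_eq_abs, Real.norm_eq_abs,
    abs_of_nonneg (sub_nonneg.2 (mem_Iic.1 htN) : (0 : ℝ) ≤ N - t)] at hb
  have hft : |f t - l * t| ≤ c + ε / 2 * (N - t) := by
    calc |f t - l * t| = |(f N - l * N) - ((f N - l * N) - (f t - l * t))| := by congr 1; ring
      _ ≤ |f N - l * N| + |(f N - l * N) - (f t - l * t)| := abs_sub _ _
      _ ≤ _ := by linarith
  rw [Real.dist_eq, show f t / t - l = (f t - l * t) / t by
      rw [sub_div, mul_div_cancel_right₀ _ ht0.ne], abs_div,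
    div_lt_iff₀ (abs_pos.2 ht0.ne), abs_of_neg ht0]
  have h3 : 2 * c / ε * ε = 2 * c := by field_simp
  have h4 : N ≤ |N| := le_abs_self N
  nlinarith [mul_pos hε (show (0:ℝ) < -(2 * c / ε) - |N| - 1 - t by linarith)]

end Inverse

/-! ### Uniqueness for autonomous equations. -/

section Uniqueness

variable {V : Type*} [NormedAddCommGroup V] [NormedSpace ℝ V]

/-- Uniqueness of solutions of an autonomous equation with `C¹` right-hand side. -/
theorem eqOn_of_hasDerivWithinAt {v : V → V} {U : Set V} (hv : ∀ p ∈ U, ContDiffAt ℝ 1 v p)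
    {f g : ℝ → V} {J : Set ℝ} (hJ : J.OrdConnected) {t₀ : ℝ} (h0 : t₀ ∈ J)
    (hf : ∀ t ∈ J, f t ∈ U ∧ HasDerivWithinAt f (v (f t)) J t)
    (hg : ∀ t ∈ J, g t ∈ U ∧ HasDerivWithinAt g (v (g t)) J t) (hfg : f t₀ = g t₀) :
    EqOn f g J := by
  intro t ht
  have hsub : uIcc t₀ t ⊆ J := hJ.uIcc_subset h0 ht
  have hcf : ContinuousOn f (uIcc t₀ t) := fun s hs =>
    ((hf s (hsub hs)).2.mono hsub).continuousWithinAt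
  have hcg : ContinuousOn g (uIcc t₀ t) := fun s hs =>
    ((hg s (hsub hs)).2.mono hsub).continuousWithinAt
  -- A locally Lipschitz field is Lipschitz on a compact set, here the union of the two
  -- trajectories; no convexity is needed.
  set A := f '' uIcc t₀ t ∪ g '' uIcc t₀ t with hA
  have hAc : IsCompact A := (isCompact_uIcc.image_of_continuousOn hcf).union
    (isCompact_uIcc.image_of_continuousOn hcg)
  have hAU : A ⊆ U := by
    rintro _ (⟨s, hs, rfl⟩ | ⟨s, hs, rfl⟩)
    exacts [(hf s (hsub hs)).1, (hg s (hsub hs)).1]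
  obtain ⟨k, hk⟩ := LocallyLipschitzOn.exists_lipschitzOnWith_of_compact hAc
    (f := v) fun p hp => by
      obtain ⟨k, u, hu, hku⟩ := (hv p (hAU hp)).exists_lipschitzOnWith
      exact ⟨k, u, mem_nhdsWithin_of_mem_nhds hu, hku⟩
  have hfA : ∀ s ∈ uIcc t₀ t, f s ∈ A := fun s hs => Or.inl ⟨s, hs, rfl⟩
  have hgA : ∀ s ∈ uIcc t₀ t, g s ∈ A := fun s hs => Or.inr ⟨s, hs, rfl⟩
  rcases le_total t₀ t with h | h
  · rw [uIcc_of_le h] at *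
    refine ODE_solution_unique_of_mem_Icc_right (v := fun _ => v) (s := fun _ => A) (K := k)
      (fun _ _ => hk) hcf (fun s hs => ?_) (fun s hs => hfA s (Ico_subset_Icc_self hs))
      hcg (fun s hs => ?_) (fun s hs => hgA s (Ico_subset_Icc_self hs)) hfg ⟨h, le_rfl⟩
    · exact ((hf s (hsub (Ico_subset_Icc_self hs))).2.mono hsub).mono_of_mem_nhdsWithin
        (Icc_mem_nhdsGE_of_mem hs)
    · exact ((hg s (hsub (Ico_subset_Icc_self hs))).2.mono hsub).mono_of_mem_nhdsWithin
        (Icc_mem_nhdsGE_of_mem hs)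
  · rw [uIcc_of_ge h] at *
    refine ODE_solution_unique_of_mem_Icc_left (v := fun _ => v) (s := fun _ => A) (K := k)
      (fun _ _ => hk) hcf (fun s hs => ?_) (fun s hs => hfA s (Ioc_subset_Icc_self hs))
      hcg (fun s hs => ?_) (fun s hs => hgA s (Ioc_subset_Icc_self hs)) hfg ⟨le_rfl, h⟩
    · exact ((hf s (hsub (Ioc_subset_Icc_self hs))).2.mono hsub).mono_of_mem_nhdsWithin
        (Icc_mem_nhdsLE_of_mem hs)
    · exact ((hg s (hsub (Ioc_subset_Icc_self hs))).2.mono hsub).mono_of_mem_nhdsWithin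
        (Icc_mem_nhdsLE_of_mem hs)

end Uniqueness

/-! ### The planar system for (x₁, x₂). -/

section System

/-- The Ricci flow of the metrics `x₁ Q|_{𝔭₁} ⊕ x₂ Q|_{𝔭₂}`, as a vector field on the quadrant
`x₁, x₂ > 0`. -/
noncomputable def flowField (C D y₁ y₂ : ℝ) (p : ℝ × ℝ) : ℝ × ℝ :=
  (-2 * ((C + D) * y₁ * y₂ + C * (p.1 / p.2) ^ 2), -2 * ((C + D) * (y₁ + y₂) - D * (p.1 / p.2)))

theorem contDiffAt_flowField (C D y₁ y₂ : ℝ) {p : ℝ × ℝ} (hp : p.2 ≠ 0) :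
    ContDiffAt ℝ 1 (flowField C D y₁ y₂) p := by
  have h : ContDiffAt ℝ 1 (fun p : ℝ × ℝ => p.1 / p.2) p := contDiffAt_fst.div contDiffAt_snd hp
  exact (contDiffAt_const.mul (contDiffAt_const.add (contDiffAt_const.mul (h.pow 2)))).prodMk
    (contDiffAt_const.mul (contDiffAt_const.sub (contDiffAt_const.mul h)))

/-- The trajectories of the flow that start below `y₁` are ancient, become extinct in finite time with
`x₁ → 0`, and emanate from the direction `y₁`. -/
theorem exists_trajectory {C D y₁ y₂ a₁ a₂ : ℝ} (hC : 0 ≤ C) (hD : 0 ≤ D) (hCD : 0 < C + D)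
    (hy₁ : 0 < y₁) (hy₁₂ : y₁ < y₂) (ha₁ : 0 < a₁) (ha₂ : 0 < a₂) (hy0 : a₁ / a₂ < y₁) :
    ∃ T r : ℝ, 0 < T ∧ 0 < r ∧ ∃ x₁ x₂ : ℝ → ℝ, x₁ 0 = a₁ ∧ x₂ 0 = a₂ ∧
      (∀ t < T, 0 < x₁ t ∧ r ≤ x₂ t ∧
        HasDerivAt (fun s => (x₁ s, x₂ s)) (flowField C D y₁ y₂ (x₁ t, x₂ t)) t) ∧
      Tendsto x₁ (𝓝[<] T) (𝓝 0) ∧ Tendsto x₂ (𝓝[<] T) (𝓝 r) ∧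
      Tendsto (fun t => x₁ t / x₂ t) atBot (𝓝 y₁) ∧
      ∃ l, Tendsto (fun t => |t| / x₂ t) atBot (𝓝 l) := by
  set S := C + D with hS
  set y₀ := a₁ / a₂ with hy₀
  have hy₀0 : 0 < y₀ := div_pos ha₁ ha₂
  -- With y = x₁/x₂ the system becomes x₂' = -2 N(y) and y' = -2 P(y)/x₂. Therefore d(log x₂)/dy =
  -- N/P and dt/dy = -x₂/(2P).
  set N : ℝ → ℝ := fun y => S * (y₁ + y₂) - D * y with hN
  set P : ℝ → ℝ := fun y => S * (y₁ - y) * (y₂ - y) with hP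
  have hNpos : ∀ y ≤ y₁, 0 < N y := fun y hy => by
    have : D * y ≤ D * y₁ := mul_le_mul_of_nonneg_left hy hD
    have : D * y₁ ≤ S * y₁ := mul_le_mul_of_nonneg_right (by linarith) hy₁.le
    have : 0 < S * y₂ := mul_pos hCD (hy₁.trans hy₁₂)
    simp only [hN]; linarith
  have hPpos : ∀ y < y₁, 0 < P y := fun y hy =>
    mul_pos (mul_pos hCD (sub_pos.2 hy)) (sub_pos.2 (hy.trans hy₁₂))
  -- Partial fractions: N/P = α/(y₁ - y) + β/(y₂ - y). The function φ is the resulting primitive,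
  -- exponentiated and normalised by φ(y₀) = a₂; it gives x₂ along the orbit.
  set α := N y₁ / (S * (y₂ - y₁)) with hα
  set β := -N y₂ / (S * (y₂ - y₁)) with hβ
  set ψ : ℝ → ℝ := fun y => Real.exp (-α * Real.log (y₁ - y) - β * Real.log (y₂ - y)) with hψ
  set φ : ℝ → ℝ := fun y => a₂ / ψ y₀ * ψ y with hφ
  have hφpos : ∀ y, 0 < φ y := fun y => mul_pos (div_pos ha₂ (Real.exp_pos _)) (Real.exp_pos _)
  have hφ₀ : φ y₀ = a₂ := div_mul_cancel₀ _ (Real.exp_pos _).ne'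
  have hφ' : ∀ y < y₁, HasDerivAt φ (φ y * (N y / P y)) y := fun y hy => by
    have h1 : y₁ - y ≠ 0 := (sub_pos.2 hy).ne'
    have h2 : y₂ - y ≠ 0 := (sub_pos.2 (hy.trans hy₁₂)).ne'
    have h3 : y₂ - y₁ ≠ 0 := (sub_pos.2 hy₁₂).ne'
    have d1 := (((hasDerivAt_id y).const_sub y₁).log h1).const_mul (-α)
    have d2 := (((hasDerivAt_id y).const_sub y₂).log h2).const_mul β
    have d := ((d1.sub d2).exp).const_mul (a₂ / ψ y₀)
    have e : -α * (-1 / (y₁ - y)) - β * (-1 / (y₂ - y)) = N y / P y := by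
      simp only [hα, hβ, hN, hP]
      field_simp
      ring
    have d' : HasDerivAt φ (a₂ / ψ y₀ * (ψ y * (-α * (-1 / (y₁ - y)) - β * (-1 / (y₂ - y))))) y := d
    rw [e] at d'
    simpa only [hφ, mul_assoc] using d'
  have hφmono : MonotoneOn φ (Iio y₁) := by
    refine monotoneOn_of_deriv_nonneg (convex_Iio _)
      (fun y hy => (hφ' y hy).continuousAt.continuousWithinAt)
      (fun y hy => (hφ' y (interior_subset (s := Iio y₁) hy)).differentiableAt.differentiableWithinAt)
      fun y hy => ?_
    have hy := interior_subset (s := Iio y₁) hy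
    rw [(hφ' y hy).deriv]
    exact (mul_pos (hφpos y) (div_pos (hNpos y (le_of_lt hy)) (hPpos y hy))).le
  -- w is -dt/dy, so F(y) below is the time at which the ratio equals y, with time 0 at y₀.
  set w : ℝ → ℝ := fun y => φ y / (2 * P y) with hw
  have hwpos : ∀ y < y₁, 0 < w y := fun y hy => div_pos (hφpos y) (mul_pos two_pos (hPpos y hy))
  have hPc : Continuous P := by fun_prop
  have hwc : ContinuousOn w (Iio y₁) := fun y hy =>
    ((hφ' y hy).continuousAt.div (continuousAt_const.mul hPc.continuousAt)
      (mul_pos two_pos (hPpos y hy)).ne').continuousWithinAt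
  set F : ℝ → ℝ := fun y => ∫ s in y..y₀, w s with hF
  have hF' : ∀ y < y₁, HasDerivAt F (-w y) y := fun y hy => by
    refine intervalIntegral.integral_hasDerivAt_left ?_ ?_ (hwc.continuousAt (Iio_mem_nhds hy))
    · refine (hwc.mono fun s hs => ?_).intervalIntegrable
      exact hs.2.trans_lt (max_lt hy hy0)
    · exact hwc.stronglyMeasurableAtFilter isOpen_Iio y hy
  have hF₀ : F y₀ = 0 := intervalIntegral.integral_same
  have hlim : Tendsto F (𝓝[<] y₁) atBot := by
    -- On [y₀, y₁) one has φ ≥ a₂ and y₂ - y ≤ y₂ - y₀, so w ≥ c/(y₁ - y). The divergence of this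
    -- bound is what makes the solution ancient.
    set c := a₂ / (2 * (S * (y₂ - y₀))) with hc
    have hy02 : 0 < y₂ - y₀ := by linarith
    have hcpos : 0 < c := div_pos ha₂ (mul_pos two_pos (mul_pos hCD hy02))
    have hle : ∀ y ∈ Ico y₀ y₁, F y ≤ c * Real.log (y₁ - y) - c * Real.log (y₁ - y₀) := by
      intro y hy
      have hd : ∀ z < y₁, HasDerivAt (fun z => F z - c * Real.log (y₁ - z))
          (-w z - c * (-1 / (y₁ - z))) z := fun z hz =>
        (hF' z hz).sub ((((hasDerivAt_id z).const_sub y₁).log (sub_pos.2 hz).ne').const_mul c)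
      have hanti : AntitoneOn (fun z => F z - c * Real.log (y₁ - z)) (Ico y₀ y₁) := by
        refine antitoneOn_of_deriv_nonpos (convex_Ico _ _)
          (fun z hz => (hd z hz.2).continuousAt.continuousWithinAt)
          (fun z hz => (hd z (interior_subset hz).2).differentiableAt.differentiableWithinAt)
          fun z hz => ?_
        have hz := interior_subset hz
        rw [(hd z hz.2).deriv]
        have h1 : 0 < y₁ - z := sub_pos.2 hz.2
        have h2 : 0 < y₂ - z := by linarith
        have h3 : a₂ ≤ φ z := hφ₀ ▸ hφmono hy0 hz.2 hz.1
        have h4 : c * (1 / (y₁ - z)) ≤ w z := by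
          calc c * (1 / (y₁ - z)) = a₂ / (2 * (S * (y₁ - z) * (y₂ - y₀))) := by
                rw [hc]; field_simp
            _ ≤ φ z / (2 * (S * (y₁ - z) * (y₂ - z))) := by
                have := hz.1
                gcongr
        have h5 : c * (-1 / (y₁ - z)) = -(c * (1 / (y₁ - z))) := by ring
        linarith
      have := hanti ⟨le_rfl, hy0⟩ hy hy.1
      simp only [hF₀] at this
      linarith
    have h1 : Tendsto (fun y => y₁ - y) (𝓝[<] y₁) (𝓝[>] 0) := by
      refine tendsto_nhdsWithin_iff.2 ⟨?_, ?_⟩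
      · have : Tendsto (fun y => y₁ - y) (𝓝 y₁) (𝓝 (y₁ - y₁)) :=
          (continuous_const.sub continuous_id).tendsto y₁
        rw [sub_self] at this
        exact this.mono_left nhdsWithin_le_nhds
      · filter_upwards [self_mem_nhdsWithin] with y hy using sub_pos.2 (mem_Iio.1 hy)
    refine tendsto_atBot_mono' _ ?_ (tendsto_atBot_add_const_right _ (-(c * Real.log (y₁ - y₀)))
      ((Real.tendsto_log_nhdsGT_zero.comp h1).const_mul_atBot hcpos))
    filter_upwards [Ioo_mem_nhdsLT hy0] with y hy
    exact (hle y ⟨hy.1.le, hy.2⟩).trans_eq (sub_eq_add_neg _ _)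
  obtain ⟨Y, hY, hYT, hYbot⟩ := exists_decreasing_inverse hy₁ hF'
    (fun y hy => neg_neg_of_pos (hwpos y hy)) hlim
  have hanti : StrictAntiOn F (Iio y₁) := by
    refine strictAntiOn_of_deriv_neg (convex_Iio _)
      (fun y hy => (hF' y hy).continuousAt.continuousWithinAt) fun y hy => ?_
    have hy := interior_subset (s := Iio y₁) hy
    rw [(hF' y hy).deriv]
    exact neg_neg_of_pos (hwpos y hy)
  -- The extinction time is the time at which y would reach 0. It is finite since w is continuous on
  -- [0, y₀].
  have hT : 0 < F 0 := hF₀ ▸ hanti hy₁ hy0 hy₀0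
  have hY0 : Y 0 = y₀ := hanti.injOn (hY 0 hT).2.1 hy0 ((hY 0 hT).2.2.1.trans hF₀.symm)
  have hx₂' : ∀ t < F 0, HasDerivAt (fun s => φ (Y s)) (-2 * N (Y t)) t := fun t ht => by
    obtain ⟨-, h2, -, h4⟩ := hY t ht
    have hPY := (hPpos _ h2).ne'
    have hφY := (hφpos (Y t)).ne'
    have := (hφ' _ h2).comp t h4
    refine this.congr_deriv ?_
    simp only [hw]
    field_simp
  have hx₁' : ∀ t < F 0, HasDerivAt (fun s => Y s * φ (Y s))
      (-2 * (S * y₁ * y₂ + C * (Y t) ^ 2)) t := fun t ht => by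
    obtain ⟨-, h2, -, h4⟩ := hY t ht
    have hPY := (hPpos _ h2).ne'
    have hφY := (hφpos (Y t)).ne'
    refine (h4.mul (hx₂' t ht)).congr_deriv ?_
    have e : (-w (Y t))⁻¹ * φ (Y t) = -2 * P (Y t) := by
      simp only [hw]
      field_simp
    rw [e]
    -- What remains is the identity y N(y) + P(y) = S y₁ y₂ + C y².
    simp only [hP, hN, hS]
    ring
  have hYdiv : ∀ t, Y t * φ (Y t) / φ (Y t) = Y t := fun t =>
    mul_div_cancel_right₀ _ (hφpos _).ne'
  have hφT : Tendsto (fun t => φ (Y t)) (𝓝[<] (F 0)) (𝓝 (φ 0)) :=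
    (hφ' 0 hy₁).continuousAt.tendsto.comp hYT
  refine ⟨F 0, φ 0, hT, hφpos 0, fun t => Y t * φ (Y t), fun t => φ (Y t), ?_, ?_, fun t ht => ?_,
    ?_, hφT, ?_, ?_⟩
  · simp only [hY0, hφ₀]
    exact div_mul_cancel₀ _ ha₂.ne'
  · simp only [hY0, hφ₀]
  · obtain ⟨h1, h2, -, -⟩ := hY t ht
    refine ⟨mul_pos h1 (hφpos _), hφmono hy₁ h2 h1.le, ?_⟩
    have := (hx₁' t ht).prodMk (hx₂' t ht)
    refine this.congr_deriv ?_
    simp only [flowField, hYdiv, hN]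
    rfl
  · simpa using hYT.mul hφT
  · simpa only [hYdiv] using hYbot
  · have hNc : Continuous N := by fun_prop
    -- The derivative of x₂ tends to -2 N(y₁) < 0, so x₂ grows linearly as t → -∞.
    have h1 : Tendsto (fun t => -2 * N (Y t)) atBot (𝓝 (-2 * N y₁)) :=
      ((continuous_const.mul hNc).tendsto y₁).comp hYbot
    have h2 := tendsto_div_atBot_of_deriv hx₂' h1
    have h3 : -2 * N y₁ ≠ 0 := (by have := hNpos y₁ le_rfl; linarith : -2 * N y₁ < 0).ne
    refine ⟨-(-2 * N y₁)⁻¹, ((h2.inv₀ h3).neg).congr' ?_⟩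
    filter_upwards [Iio_mem_atBot 0] with t ht
    rw [abs_of_neg ht, inv_div, neg_div]

/-- Maximality and uniqueness of a trajectory along which `x₁ → 0`. -/
theorem trajectory_unique {C D y₁ y₂ T r : ℝ} (hT : 0 < T) (hr : 0 < r) {x₁ x₂ z₁ z₂ : ℝ → ℝ}
    (hx : ∀ t < T, 0 < x₁ t ∧ r ≤ x₂ t ∧
        HasDerivAt (fun s => (x₁ s, x₂ s)) (flowField C D y₁ y₂ (x₁ t, x₂ t)) t)
    (hlim : Tendsto x₁ (𝓝[<] T) (𝓝 0)) {J : Set ℝ} (hJ : J.OrdConnected) (h0 : 0 ∈ J)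
    (hz : ∀ t ∈ J, 0 < z₁ t ∧ 0 < z₂ t ∧
        HasDerivWithinAt (fun s => (z₁ s, z₂ s)) (flowField C D y₁ y₂ (z₁ t, z₂ t)) J t)
    (h₁ : z₁ 0 = x₁ 0) (h₂ : z₂ 0 = x₂ 0) :
    J ⊆ Iio T ∧ ∀ t ∈ J, z₁ t = x₁ t ∧ z₂ t = x₂ t := by
  have hU : ∀ p ∈ {p : ℝ × ℝ | 0 < p.2}, ContDiffAt ℝ 1 (flowField C D y₁ y₂) p :=
    fun p hp => contDiffAt_flowField _ _ _ _ (ne_of_gt hp)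
  have heq : EqOn (fun s => (z₁ s, z₂ s)) (fun s => (x₁ s, x₂ s)) (J ∩ Iio T) :=
    eqOn_of_hasDerivWithinAt hU (hJ.inter ordConnected_Iio) ⟨h0, hT⟩
      (fun t ht => ⟨(hz t ht.1).2.1, (hz t ht.1).2.2.mono inter_subset_left⟩)
      (fun t ht => ⟨hr.trans_le (hx t ht.2).2.1, (hx t ht.2).2.2.hasDerivWithinAt⟩)
      (Prod.ext h₁ h₂)
  have hsub : J ⊆ Iio T := by
    intro t ht
    by_contra hTt
    have hIcc : Icc 0 T ⊆ J := (Icc_subset_Icc_right (not_lt.1 hTt)).trans (hJ.out h0 ht)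
    -- A solution defined at T would agree with x₁ before T, so z₁(T) = 0 by continuity, against
    -- positivity.
    have hTJ : T ∈ J := hIcc ⟨hT.le, le_rfl⟩
    have hc : Tendsto (fun s => (z₁ s, z₂ s)) (𝓝[J] T) (𝓝 (z₁ T, z₂ T)) :=
      (hz T hTJ).2.2.continuousWithinAt
    have hle : 𝓝[<] T ≤ 𝓝[J] T := nhdsWithin_le_iff.2
      (mem_of_superset (Ioo_mem_nhdsLT hT) (Ioo_subset_Icc_self.trans hIcc))
    have hc₁ : Tendsto z₁ (𝓝[<] T) (𝓝 (z₁ T)) := (continuous_fst.tendsto _).comp (hc.mono_left hle)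
    have : z₁ T = 0 := tendsto_nhds_unique (hc₁.congr' (by
      filter_upwards [Ioo_mem_nhdsLT hT] with s hs
      exact congrArg Prod.fst (heq ⟨hIcc (Ioo_subset_Icc_self hs), hs.2⟩))) hlim
    exact (hz T hTJ).1.ne' this
  exact ⟨hsub, fun t ht => Prod.ext_iff.1 (heq ⟨ht, hsub ht⟩)⟩

end System

/-! ### Independence of the curvature norm from the orthonormal basis. -/

section Orthonormal

variable {V : Type*} [AddCommGroup V] [Module ℝ V] [FiniteDimensional ℝ V]

theorem exists_basis_of_orthonormal {g : LinearMap.BilinForm ℝ V}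
    {e : Fin (Module.finrank ℝ V) → V} (he : ∀ i j, g (e i) (e j) = if i = j then 1 else 0) :
    ∃ e' : Module.Basis (Fin (Module.finrank ℝ V)) ℝ V, ⇑e' = e := by
  have hli : LinearIndependent ℝ e := by
    rw [Fintype.linearIndependent_iff]
    intro c hc j
    have := congrArg (fun X => g X (e j)) hc
    simpa [map_sum, he] using this
  exact ⟨basisOfLinearIndependentOfCardEqFinrank' _ hli (Fintype.card_fin _), by simp⟩

-- Represent ℓ as g(u, ·); by Parseval both sums equal g(u, u).
omit [FiniteDimensional ℝ V] in
theorem sum_sq_orthonormal {ι : Type*} [Fintype ι] [DecidableEq ι] {g : LinearMap.BilinForm ℝ V}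
    (hg : ∀ X Y, g X Y = g Y X) {e e' : Module.Basis ι ℝ V}
    (he : ∀ i j, g (e i) (e j) = if i = j then 1 else 0)
    (he' : ∀ i j, g (e' i) (e' j) = if i = j then 1 else 0) (ℓ : V →ₗ[ℝ] ℝ) :
    ∑ i, ℓ (e i) ^ 2 = ∑ i, ℓ (e' i) ^ 2 := by
  have key : ∀ {b : Module.Basis ι ℝ V}, (∀ i j, g (b i) (b j) = if i = j then 1 else 0) → ∀ u : V,
      ∑ i, g u (b i) ^ 2 = g u u := fun {b} hb u => by
    have h := congrArg (g u) (b.sum_repr u)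
    rw [← h, map_sum]
    exact Finset.sum_congr rfl fun i _ => by
      rw [map_smul, repr_orthonormal hb, smul_eq_mul, sq]
  obtain ⟨u, hu⟩ : ∃ u, ∀ X, ℓ X = g u X := ⟨∑ i, ℓ (e i) • e i, fun X => by
    conv_lhs => rw [← e.sum_repr X]
    simp only [map_sum, map_smul, LinearMap.sum_apply, LinearMap.smul_apply, smul_eq_mul]
    exact Finset.sum_congr rfl fun i _ => by rw [repr_orthonormal he, hg, mul_comm]⟩
  simp only [hu]
  rw [key he, key he']

-- The basis is changed in one slot at a time. The sums are permuted so that the slot being changed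
-- is innermost.
omit [FiniteDimensional ℝ V] in
theorem sum_sq_orthonormal₄ {ι : Type*} [Fintype ι] [DecidableEq ι] {g : LinearMap.BilinForm ℝ V}
    (hg : ∀ X Y, g X Y = g Y X) {e e' : Module.Basis ι ℝ V}
    (he : ∀ i j, g (e i) (e j) = if i = j then 1 else 0)
    (he' : ∀ i j, g (e' i) (e' j) = if i = j then 1 else 0)
    (R : V →ₗ[ℝ] V →ₗ[ℝ] Module.End ℝ V) :
    ∑ i, ∑ j, ∑ k, ∑ l, g (R (e i) (e j) (e k)) (e l) ^ 2 =
      ∑ i, ∑ j, ∑ k, ∑ l, g (R (e' i) (e' j) (e' k)) (e' l) ^ 2 := by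
  have h4 : ∀ X Y Z, ∑ l, g (R X Y Z) (e l) ^ 2 = ∑ l, g (R X Y Z) (e' l) ^ 2 := fun X Y Z =>
    sum_sq_orthonormal hg he he' (g (R X Y Z))
  have h3 : ∀ X Y W, ∑ k, g (R X Y (e k)) W ^ 2 = ∑ k, g (R X Y (e' k)) W ^ 2 := fun X Y W =>
    sum_sq_orthonormal hg he he' ((g.flip W).comp (R X Y))
  have h2 : ∀ X Z W, ∑ j, g (R X (e j) Z) W ^ 2 = ∑ j, g (R X (e' j) Z) W ^ 2 := fun X Z W =>
    sum_sq_orthonormal hg he he' ((g.flip W).comp ((R X).flip Z))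
  have h1 : ∀ Y Z W, ∑ i, g (R (e i) Y Z) W ^ 2 = ∑ i, g (R (e' i) Y Z) W ^ 2 := fun Y Z W =>
    sum_sq_orthonormal hg he he' ((g.flip W).comp ((R.flip Y).flip Z))
  calc ∑ i, ∑ j, ∑ k, ∑ l, g (R (e i) (e j) (e k)) (e l) ^ 2
      = ∑ i, ∑ j, ∑ l, ∑ k, g (R (e i) (e j) (e' k)) (e' l) ^ 2 := by
        refine Finset.sum_congr rfl fun i _ => Finset.sum_congr rfl fun j _ => ?_
        simp only [h4]
        rw [Finset.sum_comm]
        simp only [h3]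
    _ = ∑ i, ∑ l, ∑ k, ∑ j, g (R (e i) (e' j) (e' k)) (e' l) ^ 2 := by
        refine Finset.sum_congr rfl fun i _ => ?_
        rw [Finset.sum_comm]
        refine Finset.sum_congr rfl fun l _ => ?_
        rw [Finset.sum_comm]
        simp only [h2]
    _ = ∑ l, ∑ k, ∑ j, ∑ i, g (R (e' i) (e' j) (e' k)) (e' l) ^ 2 := by
        rw [Finset.sum_comm]
        refine Finset.sum_congr rfl fun l _ => ?_
        rw [Finset.sum_comm]
        refine Finset.sum_congr rfl fun k _ => ?_
        rw [Finset.sum_comm]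
        simp only [h1]
    _ = _ := by
        rw [Finset.sum_comm' (t' := Finset.univ) (s' := fun _ => Finset.univ) (by simp)]
        have : ∀ k, ∑ l, ∑ j, ∑ i, g (R (e' i) (e' j) (e' k)) (e' l) ^ 2 =
            ∑ i, ∑ j, ∑ l, g (R (e' i) (e' j) (e' k)) (e' l) ^ 2 := fun k => by
          rw [Finset.sum_comm]
          simp only [Finset.sum_comm (s := Finset.univ (α := ι)) (f := fun l i =>
            g (R (e' i) (e' _) (e' k)) (e' l) ^ 2)]
          rw [Finset.sum_comm]
        simp only [this]
        rw [Finset.sum_comm]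
        refine Finset.sum_congr rfl fun i _ => ?_
        rw [Finset.sum_comm]

variable {L : Type*} [LieRing L] [LieAlgebra ℝ L] [FiniteDimensional ℝ L] {𝔨 𝔭 : Submodule ℝ L}

/-- The norm of the curvature tensor may be computed in any orthonormal frame. -/
theorem curvatureNorm_eq (hc : IsCompl 𝔭 𝔨) {g : LinearMap.BilinForm ℝ 𝔭}
    (hg : ∀ X Y, g X Y = g Y X) {e : Fin (Module.finrank ℝ 𝔭) → 𝔭}
    (he : ∀ i j, g (e i) (e j) = if i = j then 1 else 0) :
    curvatureNorm hc g = Real.sqrt (∑ i, ∑ j, ∑ k, ∑ l,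
      (g (curvature hc g (e i) (e j) (e k)) (e l)) ^ 2) := by
  obtain ⟨e', rfl⟩ := exists_basis_of_orthonormal he
  have h : ∃ e : Module.Basis (Fin (Module.finrank ℝ 𝔭)) ℝ 𝔭,
      ∀ i j, g (e i) (e j) = if i = j then 1 else 0 := ⟨e', he⟩
  rw [curvatureNorm, dif_pos h, sum_sq_orthonormal₄ hg h.choose_spec he]

end Orthonormal

/-! ### Continuity in a finite-dimensional space tested by linear forms. -/

section WeakContinuity

variable {V W : Type*} [AddCommGroup V] [Module ℝ V] [AddCommGroup W] [Module ℝ W]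

/-- Continuity at `z` of a function with values in a real vector space, tested by linear forms. -/
def WeaklyContinuousAt (f : ℝ → V) (z : ℝ) : Prop :=
  ∀ ℓ : V →ₗ[ℝ] ℝ, ContinuousAt (fun s => ℓ (f s)) z

namespace WeaklyContinuousAt

variable {f f' : ℝ → V} {z : ℝ}

theorem const (X : V) : WeaklyContinuousAt (fun _ => X) z := fun _ => continuousAt_const

theorem add (hf : WeaklyContinuousAt f z) (hf' : WeaklyContinuousAt f' z) :
    WeaklyContinuousAt (fun s => f s + f' s) z := fun ℓ => by
  simp only [map_add]
  exact (hf ℓ).add (hf' ℓ)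

theorem sub (hf : WeaklyContinuousAt f z) (hf' : WeaklyContinuousAt f' z) :
    WeaklyContinuousAt (fun s => f s - f' s) z := fun ℓ => by
  simp only [map_sub]
  exact (hf ℓ).sub (hf' ℓ)

theorem smul {c : ℝ → ℝ} (hc : ContinuousAt c z) (hf : WeaklyContinuousAt f z) :
    WeaklyContinuousAt (fun s => c s • f s) z := fun ℓ => by
  simp only [map_smul, smul_eq_mul]
  exact hc.mul (hf ℓ)

theorem map (A : V →ₗ[ℝ] W) (hf : WeaklyContinuousAt f z) :
    WeaklyContinuousAt (fun s => A (f s)) z := fun ℓ => hf (ℓ.comp A)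

/-- Expanding the first argument in a basis reduces the claim to products of real continuous
functions. -/
theorem apply [FiniteDimensional ℝ V] {U : Type*} [AddCommGroup U] [Module ℝ U]
    (b : V →ₗ[ℝ] W →ₗ[ℝ] U) (hf : WeaklyContinuousAt f z) {h : ℝ → W}
    (hh : WeaklyContinuousAt h z) : WeaklyContinuousAt (fun s => b (f s) (h s)) z := fun ℓ => by
  let e := Module.finBasis ℝ V
  have : ∀ s, ℓ (b (f s) (h s)) = ∑ i, e.coord i (f s) * ℓ (b (e i) (h s)) := fun s => by
    have h1 := congrArg (fun X => ℓ (b X (h s))) (e.sum_repr (f s))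
    simp only [map_sum, map_smul, LinearMap.sum_apply, LinearMap.smul_apply, smul_eq_mul] at h1
    exact h1.symm
  simp only [this]
  exact tendsto_finsetSum _ fun i _ => (hf (e.coord i)).mul (hh (ℓ.comp (b (e i))))

end WeaklyContinuousAt

end WeakContinuity

/-! ### Curvature norm of diagonal metrics and the type I property. -/

section TypeI

variable {L : Type*} [LieRing L] [LieAlgebra ℝ L] [FiniteDimensional ℝ L] {𝔨 𝔭 : Submodule ℝ L}
  {hc : IsCompl 𝔭 𝔨} {𝔭₁ 𝔭₂ : Submodule ℝ 𝔭}

/-- The curvature of `u₁ (-B)|_𝔭₁ ⊕ u₂ (-B)|_𝔭₂` as a function of `z = u₁/u₂`. -/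
noncomputable def diagCurvature (hc : IsCompl 𝔭 𝔨) (h12 : IsCompl 𝔭₁ 𝔭₂) (z : ℝ) (X Y Z : 𝔭) : 𝔭 :=
  diagConnection hc h12 z X (diagConnection hc h12 z Y Z)
    - diagConnection hc h12 z Y (diagConnection hc h12 z X Z)
    - diagConnection hc h12 z (bracketP hc X Y) Z - isotropyTerm hc X Y Z

theorem WeaklyContinuousAt.diagConnection (h12 : IsCompl 𝔭₁ 𝔭₂) {z : ℝ} {X Y : ℝ → 𝔭}
    (hX : WeaklyContinuousAt X z) (hY : WeaklyContinuousAt Y z) :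
    WeaklyContinuousAt (fun s => diagConnection hc h12 s (X s) (Y s)) z := by
  simp only [diagConnection_apply]
  refine .add (.smul continuousAt_const (.apply _ hX hY)) (.smul (by fun_prop) (.sub ?_ ?_))
  · exact .apply _ (.map _ hX) (.map _ hY)
  · exact .apply _ (.map _ hX) (.map _ hY)

theorem WeaklyContinuousAt.diagCurvature (h12 : IsCompl 𝔭₁ 𝔭₂) {z : ℝ} {X Y Z : ℝ → 𝔭}
    (hX : WeaklyContinuousAt X z) (hY : WeaklyContinuousAt Y z) (hZ : WeaklyContinuousAt Z z) :
    WeaklyContinuousAt (fun s => diagCurvature hc h12 s (X s) (Y s) (Z s)) z := by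
  refine .sub (.sub (.sub ?_ ?_) ?_) ?_
  · exact .diagConnection _ hX (.diagConnection _ hY hZ)
  · exact .diagConnection _ hY (.diagConnection _ hX hZ)
  · exact .diagConnection _ (.apply _ hX hY) hZ
  · exact .apply (LinearMap.id (R := ℝ) (M := Module.End ℝ 𝔭)) (.apply (isotropyTerm hc) hX hY) hZ

theorem IsFibred.curvature_diagMetric (h : IsFibred hc 𝔭₁ 𝔭₂) {u₁ u₂ : ℝ} (h₁ : 0 < u₁)
    (h₂ : 0 < u₂) (X Y Z : 𝔭) :
    curvature hc (diagMetric h.compl (killP 𝔭) u₁ u₂) X Y Z =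
      diagCurvature hc h.compl (u₁ / u₂) X Y Z := by
  rw [curvature_apply, h.leviCivita_diagMetric h₁ h₂, diagCurvature]

/-- `|Rm|` of `u₁ (-B)|_𝔭₁ ⊕ u₂ (-B)|_𝔭₂` is `1/u₂` times a continuous function of `u₁/u₂`. -/
theorem IsFibred.exists_curvatureNorm_diagMetric (h : IsFibred hc 𝔭₁ 𝔭₂) :
    ∃ Θ : ℝ → ℝ, (∀ z, 0 < z → ContinuousAt Θ z) ∧ ∀ u₁ u₂, 0 < u₁ → 0 < u₂ →
      curvatureNorm hc (diagMetric h.compl (killP 𝔭) u₁ u₂) = Θ (u₁ / u₂) / u₂ := by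
  set P₁ := 𝔭₁.projection 𝔭₂ h.compl with hP₁
  set P₂ := 𝔭₂.projection 𝔭₁ h.compl.symm with hP₂
  set B := diagMetric h.compl (killP 𝔭) 1 1 with hB
  have hBs : ∀ X Y, B X Y = B Y X := diagMetric_symm _ killP_symm _ _
  obtain ⟨e, he⟩ := exists_orthonormal_basis hBs
    (diagMetric_pos h.compl (killP_pos h.red) one_pos one_pos)
  -- Rescaling the 𝔭₁-part by z^(-1/2) gives a frame orthonormal for z(-B) ⊕ (-B); a further factor
  -- u₂^(-1/2) makes it orthonormal for the given metric. The θ's are the curvature components in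
  -- the frame f.
  set f : Fin (Module.finrank ℝ 𝔭) → ℝ → 𝔭 :=
    fun i z => (Real.sqrt z)⁻¹ • P₁ (e i) + P₂ (e i) with hf
  set θ := fun (i j k l : Fin (Module.finrank ℝ 𝔭)) (z : ℝ) =>
    z * (killP 𝔭).compl₁₂ P₁ P₁ (diagCurvature hc h.compl z (f i z) (f j z) (f k z)) (f l z) +
      (killP 𝔭).compl₁₂ P₂ P₂ (diagCurvature hc h.compl z (f i z) (f j z) (f k z)) (f l z) with hθ
  have hfc : ∀ i z, 0 < z → WeaklyContinuousAt (f i) z := fun i z hz =>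
    .add (.smul (Real.continuous_sqrt.continuousAt.inv₀ (Real.sqrt_pos.2 hz).ne') (.const _)) (.const _)
  have hθc : ∀ i j k l z, 0 < z → ContinuousAt (θ i j k l) z := fun i j k l z hz => by
    have hR := WeaklyContinuousAt.diagCurvature (hc := hc) h.compl
      (hfc i z hz) (hfc j z hz) (hfc k z hz)
    exact (continuousAt_id.mul (hR.apply ((killP 𝔭).compl₁₂ P₁ P₁) (hfc l z hz) LinearMap.id)).add
      (hR.apply ((killP 𝔭).compl₁₂ P₂ P₂) (hfc l z hz) LinearMap.id)
  refine ⟨fun z => Real.sqrt (∑ i, ∑ j, ∑ k, ∑ l, θ i j k l z ^ 2), fun z hz => ?_,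
    fun u₁ u₂ h₁ h₂ => ?_⟩
  · refine Real.continuous_sqrt.continuousAt.comp ?_
    exact tendsto_finsetSum _ fun i _ => tendsto_finsetSum _ fun j _ =>
      tendsto_finsetSum _ fun k _ => tendsto_finsetSum _ fun l _ => (hθc i j k l z hz).pow 2
  · set z := u₁ / u₂ with hz
    have hz0 : 0 < z := div_pos h₁ h₂
    set c := (Real.sqrt u₂)⁻¹ with hcdef
    have hcc : c * c = u₂⁻¹ := by
      rw [hcdef, ← mul_inv, Real.mul_self_sqrt h₂.le]
    have hss : (Real.sqrt z)⁻¹ * (Real.sqrt z)⁻¹ = z⁻¹ := by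
      rw [← mul_inv, Real.mul_self_sqrt hz0.le]
    have hu₁ : u₁ = u₂ * z := by rw [hz]; field_simp
    have hp11 : ∀ X, P₁ (P₁ X) = P₁ X := fun X =>
      Submodule.projection_apply_of_mem_left h.compl (Submodule.projection_apply_mem _ _)
    have hp22 : ∀ X, P₂ (P₂ X) = P₂ X := fun X =>
      Submodule.projection_apply_of_mem_left h.compl.symm (Submodule.projection_apply_mem _ _)
    have hp12 : ∀ X, P₁ (P₂ X) = 0 := fun X =>
      (Submodule.projection_apply_eq_zero_iff _).2 (Submodule.projection_apply_mem _ _)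
    have hp21 : ∀ X, P₂ (P₁ X) = 0 := fun X =>
      (Submodule.projection_apply_eq_zero_iff _).2 (Submodule.projection_apply_mem _ _)
    have hON : ∀ i j, diagMetric h.compl (killP 𝔭) u₁ u₂ (c • f i z) (c • f j z) =
        if i = j then 1 else 0 := fun i j => by
      rw [← he i j, hB, diagMetric_apply, diagMetric_apply, ← hP₁, ← hP₂]
      simp only [hf, map_smul, map_add, hp11, hp22, hp12, hp21, smul_zero, add_zero, zero_add,
        LinearMap.smul_apply, smul_eq_mul]
      rw [show ∀ A B s : ℝ, u₁ * (c * (s * (c * (s * A)))) + u₂ * (c * (c * B)) =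
        u₁ * (c * c) * (s * s) * A + u₂ * (c * c) * B by intros; ring, hcc, hss, hu₁]
      field_simp
    rw [curvatureNorm_eq hc (diagMetric_symm _ killP_symm _ _) hON]
    have hterm : ∀ i j k l, diagMetric h.compl (killP 𝔭) u₁ u₂
        (curvature hc (diagMetric h.compl (killP 𝔭) u₁ u₂) (c • f i z) (c • f j z) (c • f k z))
        (c • f l z) = u₂⁻¹ * θ i j k l z := fun i j k l => by
      have e1 : diagMetric h.compl (killP 𝔭) u₁ u₂ = u₂ • (z • (killP 𝔭).compl₁₂ P₁ P₁ +
          (killP 𝔭).compl₁₂ P₂ P₂) := by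
        rw [smul_add, smul_smul, ← hu₁]; rfl
      simp only [map_smul, LinearMap.smul_apply, h.curvature_diagMetric h₁ h₂, ← hz]
      rw [e1]
      simp only [LinearMap.smul_apply, LinearMap.add_apply, smul_eq_mul, hθ]
      -- Four frame vectors contribute c⁴ = u₂⁻² and the metric contributes u₂, which leaves 1/u₂.
      rw [show ∀ A B : ℝ, c * (c * (c * (c * (u₂ * (z * A + B))))) =
        (c * c) * (c * c) * u₂ * (z * A + B) by intros; ring, hcc]
      field_simp
    simp only [hterm, mul_pow, ← Finset.mul_sum]
    rw [Real.sqrt_mul (sq_nonneg _), Real.sqrt_sq (inv_pos.2 h₂).le, inv_mul_eq_div]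

/-- |t| |Rm| is the product of |t|/u₂ and Θ(u₁/u₂), and Θ is continuous at the limiting ratio z > 0.
-/
theorem IsFibred.isTypeIAncient (h : IsFibred hc 𝔭₁ 𝔭₂) {u₁ u₂ : ℝ → ℝ} {T z l : ℝ}
    (h₁ : ∀ t < T, 0 < u₁ t) (h₂ : ∀ t < T, 0 < u₂ t) (hz : 0 < z)
    (hu : Tendsto (fun t => u₁ t / u₂ t) atBot (𝓝 z))
    (hl : Tendsto (fun t => |t| / u₂ t) atBot (𝓝 l)) :
    IsTypeIAncient hc (fun t => diagMetric h.compl (killP 𝔭) (u₁ t) (u₂ t)) := by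
  obtain ⟨Θ, hΘ, hR⟩ := h.exists_curvatureNorm_diagMetric
  refine ⟨l * Θ z, (hl.mul ((hΘ z hz).tendsto.comp hu)).congr' ?_⟩
  filter_upwards [Iio_mem_atBot T] with t ht
  rw [hR _ _ (h₁ t ht) (h₂ t ht), Function.comp_apply]
  ring

end TypeI

/-! ### Left-invariant distances on G. -/

section LeftInvariant

variable {E : Type*} [NormedAddCommGroup E] [NormedSpace ℝ E]
  {G : Type*} [TopologicalSpace G] [ChartedSpace E G] [Group G]

/-- The left-invariant extended semi-norm on the tangent spaces of `G` defined by a form on the Lie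
algebra. -/
noncomputable abbrev leftENorm (q : LinearMap.BilinForm ℝ (GroupLieAlgebra 𝓘(ℝ, E) G)) (x : G) :
    ENorm (TangentSpace 𝓘(ℝ, E) x) :=
  ⟨fun v =>
    let w : GroupLieAlgebra 𝓘(ℝ, E) G :=
      (mfderiv 𝓘(ℝ, E) 𝓘(ℝ, E) (fun z : G => x⁻¹ * z) x : E →L[ℝ] E) v
    ENNReal.ofReal (Real.sqrt (q w w))⟩

/-- Homogeneity is the property of the norm that the results on path lengths ask for. No sign
condition on q is needed, because the square root of a negative number is 0. -/
theorem leftENorm_smul (q : LinearMap.BilinForm ℝ (GroupLieAlgebra 𝓘(ℝ, E) G)) (x : G) :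
    letI : ENorm (TangentSpace 𝓘(ℝ, E) x) := leftENorm q x
    ENormSMulClass ℝ (TangentSpace 𝓘(ℝ, E) x) := by
  let _ : ENorm (TangentSpace 𝓘(ℝ, E) x) := leftENorm q x
  refine ⟨fun c v => ?_⟩
  have key : ∀ (A : E →L[ℝ] GroupLieAlgebra 𝓘(ℝ, E) G) (v : E),
      ENNReal.ofReal (Real.sqrt (q (A (c • v)) (A (c • v)))) =
        ‖c‖ₑ * ENNReal.ofReal (Real.sqrt (q (A v) (A v))) := fun A v => by
    rw [map_smul, map_smul, map_smul, LinearMap.smul_apply, smul_eq_mul, smul_eq_mul, ← mul_assoc,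
      Real.sqrt_mul (mul_self_nonneg c), Real.sqrt_mul_self_eq_abs,
      ENNReal.ofReal_mul (abs_nonneg c), ← Real.enorm_eq_ofReal_abs]
  exact key _ v

/-- The left-invariant Riemannian distance on `G` defined by a form on the Lie algebra. -/
noncomputable def leftEDist (q : LinearMap.BilinForm ℝ (GroupLieAlgebra 𝓘(ℝ, E) G)) (x y : G) :
    ℝ≥0∞ :=
  letI : ∀ x : G, ENorm (TangentSpace 𝓘(ℝ, E) x) := leftENorm q
  Manifold.riemannianEDist 𝓘(ℝ, E) x y

theorem quotientEDist_eq (S : Subgroup G)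
    (q : LinearMap.BilinForm ℝ (GroupLieAlgebra 𝓘(ℝ, E) G)) (a b : G ⧸ S) :
    quotientEDist S q a b =
      ⨅ (x : G) (y : G) (_ : (x : G ⧸ S) = a) (_ : (y : G ⧸ S) = b), leftEDist q x y := rfl

variable (q : LinearMap.BilinForm ℝ (GroupLieAlgebra 𝓘(ℝ, E) G))

theorem leftEDist_comm (x y : G) : leftEDist q x y = leftEDist q y x := by
  let _ : ∀ x : G, ENorm (TangentSpace 𝓘(ℝ, E) x) := leftENorm q
  have := leftENorm_smul q
  exact Manifold.riemannianEDist_comm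

theorem leftEDist_triangle (x y z : G) : leftEDist q x z ≤ leftEDist q x y + leftEDist q y z := by
  let _ : ∀ x : G, ENorm (TangentSpace 𝓘(ℝ, E) x) := leftENorm q
  have := leftENorm_smul q
  exact Manifold.riemannianEDist_triangle

/-- The velocity `γ⁻¹γ'` of a curve in `G`, moved to the Lie algebra by left translation. -/
noncomputable def bodyVelocity (γ : ℝ → G) (t : ℝ) : GroupLieAlgebra 𝓘(ℝ, E) G :=
  (mfderiv 𝓘(ℝ, ℝ) 𝓘(ℝ, E) (fun s => (γ t)⁻¹ * γ s) t : ℝ →L[ℝ] E) 1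

/-- The speed of a curve in `G` for the left-invariant metric `q`. -/
noncomputable def leftSpeed (γ : ℝ → G) (t : ℝ) : ℝ≥0∞ :=
  ENNReal.ofReal (Real.sqrt (q (bodyVelocity (E := E) γ t) (bodyVelocity (E := E) γ t)))

variable [LieGroup 𝓘(ℝ, E) ∞ G]

theorem bodyVelocity_eq {γ : ℝ → G} {t : ℝ} (hγ : MDifferentiableAt 𝓘(ℝ, ℝ) 𝓘(ℝ, E) γ t) :
    bodyVelocity (E := E) γ t = (mfderiv 𝓘(ℝ, E) 𝓘(ℝ, E) (fun z : G => (γ t)⁻¹ * z) (γ t) : E →L[ℝ] E)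
      ((mfderiv 𝓘(ℝ, ℝ) 𝓘(ℝ, E) γ t : ℝ →L[ℝ] E) 1) := by
  have h : MDifferentiableAt 𝓘(ℝ, E) 𝓘(ℝ, E) (fun z : G => (γ t)⁻¹ * z) (γ t) :=
    (contMDiff_mul_left (I := 𝓘(ℝ, E)) (n := ∞)).mdifferentiableAt (by simp)
  exact DFunLike.congr_fun (mfderiv_comp t h hγ) (1 : ℝ)

theorem pathELength_leftENorm {γ : ℝ → G} {a b : ℝ}
    (hγ : ∀ t ∈ Ioo a b, MDifferentiableAt 𝓘(ℝ, ℝ) 𝓘(ℝ, E) γ t) :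
    letI : ∀ x : G, ENorm (TangentSpace 𝓘(ℝ, E) x) := leftENorm q
    Manifold.pathELength 𝓘(ℝ, E) γ a b = ∫⁻ t in Ioo a b, leftSpeed q γ t := by
  let _ : ∀ x : G, ENorm (TangentSpace 𝓘(ℝ, E) x) := leftENorm q
  refine Manifold.pathELength_eq_lintegral_mfderiv_Ioo.trans
    (setLIntegral_congr_fun measurableSet_Ioo fun t ht => ?_)
  rw [leftSpeed, bodyVelocity_eq (hγ t ht)]
  rfl

theorem leftEDist_le_lintegral {γ : ℝ → G} (hγ : ContMDiffOn 𝓘(ℝ, ℝ) 𝓘(ℝ, E) 1 γ (Icc 0 1)) :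
    leftEDist q (γ 0) (γ 1) ≤ ∫⁻ t in Ioo 0 1, leftSpeed q γ t := by
  let _ : ∀ x : G, ENorm (TangentSpace 𝓘(ℝ, E) x) := leftENorm q
  have := leftENorm_smul q
  rw [← pathELength_leftENorm q fun t ht => ((hγ t (Ioo_subset_Icc_self ht)).contMDiffAt
    (Icc_mem_nhds ht.1 ht.2)).mdifferentiableAt one_ne_zero]
  exact Manifold.riemannianEDist_le_pathELength hγ rfl rfl zero_le_one

theorem exists_path_of_leftEDist_lt {x y : G} {r : ℝ≥0∞} (h : leftEDist q x y < r) :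
    ∃ γ : ℝ → G, γ 0 = x ∧ γ 1 = y ∧ ContMDiff 𝓘(ℝ, ℝ) 𝓘(ℝ, E) 1 γ ∧
      ∫⁻ t in Ioo 0 1, leftSpeed q γ t < r := by
  let _ : ∀ x : G, ENorm (TangentSpace 𝓘(ℝ, E) x) := leftENorm q
  have := leftENorm_smul q
  obtain ⟨γ, h0, h1, hγ, hl, -⟩ :=
    Manifold.exists_lt_locally_constant_of_riemannianEDist_lt h zero_lt_one
  exact ⟨γ, h0, h1, hγ, (pathELength_leftENorm q fun t _ =>
    (hγ t).mdifferentiableAt one_ne_zero) ▸ hl⟩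

/-- If `φ` intertwines left translations through `ψ` and `dψ` increases lengths at most by the factor
`c`, then `φ` increases distances at most by `c`. -/
theorem leftEDist_map_le {E' : Type*} [NormedAddCommGroup E'] [NormedSpace ℝ E'] {G' : Type*}
    [TopologicalSpace G'] [ChartedSpace E' G'] [Group G'] [LieGroup 𝓘(ℝ, E') ∞ G']
    {q' : LinearMap.BilinForm ℝ (GroupLieAlgebra 𝓘(ℝ, E') G')} {φ ψ : G' → G}
    (hφ : ContMDiff 𝓘(ℝ, E') 𝓘(ℝ, E) ∞ φ) (hψ : ContMDiff 𝓘(ℝ, E') 𝓘(ℝ, E) ∞ ψ)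
    (hφψ : ∀ x y, (φ x)⁻¹ * φ y = ψ (x⁻¹ * y)) {c : ℝ} (hc : 0 < c)
    (hq : ∀ w : E', q ((mfderiv 𝓘(ℝ, E') 𝓘(ℝ, E) ψ 1 : E' →L[ℝ] E) w)
        ((mfderiv 𝓘(ℝ, E') 𝓘(ℝ, E) ψ 1 : E' →L[ℝ] E) w) ≤ c ^ 2 * q' w w) (x y : G') :
    leftEDist q (φ x) (φ y) ≤ ENNReal.ofReal c * leftEDist q' x y := by
  have hspeed : ∀ {γ : ℝ → G'}, ContMDiff 𝓘(ℝ, ℝ) 𝓘(ℝ, E') 1 γ → ∀ t,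
      leftSpeed q (φ ∘ γ) t ≤ ENNReal.ofReal c * leftSpeed q' γ t := fun {γ} hγ t => by
    have h1 : MDifferentiableAt 𝓘(ℝ, ℝ) 𝓘(ℝ, E') (fun s => (γ t)⁻¹ * γ s) t :=
      (contMDiff_const.mul hγ).mdifferentiableAt one_ne_zero
    have h2 : ∀ z, MDifferentiableAt 𝓘(ℝ, E') 𝓘(ℝ, E) ψ z := hψ.mdifferentiable (by simp)
    -- Hence the body velocity of φ ∘ γ is dψ at 1 applied to that of γ, and speeds are compared
    -- pointwise.
    have e1 : (fun s => ((φ ∘ γ) t)⁻¹ * (φ ∘ γ) s) = ψ ∘ fun s => (γ t)⁻¹ * γ s :=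
      funext fun s => hφψ _ _
    have aux : ∀ z : G', z = 1 → ∀ v : E', (mfderiv 𝓘(ℝ, E') 𝓘(ℝ, E) ψ z : E' →L[ℝ] E) v =
        (mfderiv 𝓘(ℝ, E') 𝓘(ℝ, E) ψ 1 : E' →L[ℝ] E) v := by rintro _ rfl v; rfl
    have e2 : bodyVelocity (E := E) (φ ∘ γ) t =
        (mfderiv 𝓘(ℝ, E') 𝓘(ℝ, E) ψ 1 : E' →L[ℝ] E) (bodyVelocity (E := E') γ t) := by
      rw [bodyVelocity, e1]
      exact (DFunLike.congr_fun (mfderiv_comp t (h2 _) h1) (1 : ℝ)).trans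
        (aux _ (inv_mul_cancel _) _)
    rw [leftSpeed, leftSpeed, e2, ← ENNReal.ofReal_mul hc.le]
    refine ENNReal.ofReal_le_ofReal ((Real.sqrt_le_sqrt (hq _)).trans_eq ?_)
    rw [Real.sqrt_mul (sq_nonneg c), Real.sqrt_sq hc.le]
  refine le_of_forall_gt fun r hr => ?_
  have hc' : ENNReal.ofReal c ≠ 0 := (ENNReal.ofReal_pos.2 hc).ne'
  obtain ⟨γ, rfl, rfl, hγ, hl⟩ := exists_path_of_leftEDist_lt q' (r := r / ENNReal.ofReal c) (by
    rwa [ENNReal.lt_div_iff_mul_lt (.inl hc') (.inl ENNReal.ofReal_ne_top), mul_comm])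
  have hφγ : ContMDiff 𝓘(ℝ, ℝ) 𝓘(ℝ, E) 1 (φ ∘ γ) :=
    (hφ.of_le (by exact_mod_cast le_top)).comp hγ
  calc leftEDist q ((φ ∘ γ) 0) ((φ ∘ γ) 1) ≤ ∫⁻ t in Ioo 0 1, leftSpeed q (φ ∘ γ) t :=
        leftEDist_le_lintegral q hφγ.contMDiffOn
    _ ≤ ∫⁻ t in Ioo 0 1, ENNReal.ofReal c * leftSpeed q' γ t := lintegral_mono fun t => hspeed hγ t
    _ = ENNReal.ofReal c * ∫⁻ t in Ioo 0 1, leftSpeed q' γ t :=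
        lintegral_const_mul' _ _ ENNReal.ofReal_ne_top
    _ < r := by
        rwa [mul_comm, ← ENNReal.lt_div_iff_mul_lt (.inl hc') (.inl ENNReal.ofReal_ne_top)]

theorem leftEDist_mul_left (a x y : G) : leftEDist q (a * x) (a * y) ≤ leftEDist q x y := by
  have h := leftEDist_map_le q (q' := q) (φ := fun x => a * x) (ψ := id)
    (contMDiff_mul_left (I := 𝓘(ℝ, E)) (n := ∞)) contMDiff_id (fun x y => by simp [mul_assoc])
    one_pos (fun w => by
      rw [mfderiv_id, one_pow, one_mul]
      exact le_rfl) x y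
  simpa using h

theorem leftEDist_eq_one_left (x y : G) : leftEDist q x y = leftEDist q 1 (x⁻¹ * y) := by
  refine le_antisymm ?_ ?_
  · simpa using leftEDist_mul_left q x 1 (x⁻¹ * y)
  · simpa using leftEDist_mul_left q x⁻¹ x y

theorem leftEDist_mono {q q' : LinearMap.BilinForm ℝ (GroupLieAlgebra 𝓘(ℝ, E) G)} {c : ℝ}
    (hc : 0 < c) (h : ∀ w, q w w ≤ c ^ 2 * q' w w) (x y : G) :
    leftEDist q x y ≤ ENNReal.ofReal c * leftEDist q' x y :=
  leftEDist_map_le q (φ := id) (ψ := id) contMDiff_id contMDiff_id (fun _ _ => rfl) hc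
    (fun w => by rw [mfderiv_id]; exact h w) x y

/-- Right translation by a changes body velocities by Ad(a⁻¹). -/
theorem leftEDist_mul_right {a : G} (ha : ∀ w, q (Ad E a⁻¹ w) (Ad E a⁻¹ w) = q w w) (x y : G) :
    leftEDist q (x * a) (y * a) ≤ leftEDist q x y := by
  have h := leftEDist_map_le q (q' := q) (φ := fun x => x * a) (ψ := fun x => a⁻¹ * x * a⁻¹⁻¹)
    (contMDiff_mul_right (I := 𝓘(ℝ, E)) (n := ∞)) (contMDiff_conj a⁻¹)
    (fun x y => by simp [mul_assoc]) one_pos (fun w => by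
      rw [one_pow, one_mul]
      exact (ha w).le) x y
  simpa using h

omit [Group G] [LieGroup 𝓘(ℝ, E) ∞ G] in
theorem mfderiv_eq_fderiv_extChartAt {F : Type*} [NormedAddCommGroup F] [NormedSpace ℝ F]
    {h : F → G} {x : F} (hh : MDifferentiableAt 𝓘(ℝ, F) 𝓘(ℝ, E) h x) {g : G} (hg : h x = g) :
    @Eq (F →L[ℝ] E) (mfderiv 𝓘(ℝ, F) 𝓘(ℝ, E) h x)
      (fderiv ℝ (fun z => extChartAt 𝓘(ℝ, E) g (h z)) x) := by
  subst hg
  refine hh.mfderiv.trans ?_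
  change fderivWithin ℝ (fun z => extChartAt 𝓘(ℝ, E) (h x) (h z)) (range id) x = _
  rw [range_id, fderivWithin_univ]

/-- For a `C¹` map `f` into `G`, the differential of `z ↦ f(x)⁻¹ f(z)` at `x` depends continuously on
`x`. -/
theorem continuousAt_mfderiv_inv_mul {F : Type*} [NormedAddCommGroup F] [NormedSpace ℝ F]
    {f : F → G} {p : F} (hf : ContMDiffAt 𝓘(ℝ, F) 𝓘(ℝ, E) 1 f p) :
    ContinuousAt (Y := F →L[ℝ] E)
      (fun x => mfderiv 𝓘(ℝ, F) 𝓘(ℝ, E) (fun z => (f x)⁻¹ * f z) x) p := by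
  let _ : LieGroup 𝓘(ℝ, E) 1 G := LieGroup.of_le (m := 1) (n := ∞) (by exact_mod_cast le_top)
  -- Since f(x)⁻¹ f(x) = 1 for every x, the single chart at 1 computes all these differentials: they
  -- are partial derivatives of Φ on the diagonal.
  set Φ : F × F → E := fun z => extChartAt 𝓘(ℝ, E) (1 : G) ((f z.1)⁻¹ * f z.2) with hΦ
  have hfst : ContMDiffAt 𝓘(ℝ, F × F) 𝓘(ℝ, E) 1 (fun z : F × F => (f z.1)⁻¹ * f z.2) (p, p) := by
    refine ContMDiffAt.mul (I := 𝓘(ℝ, E)) (ContMDiffAt.inv (I := 𝓘(ℝ, E)) ?_) ?_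
    · exact ContMDiffAt.comp (p, p) (g := f) (f := Prod.fst) hf contDiff_fst.contMDiff.contMDiffAt
    · exact ContMDiffAt.comp (p, p) (g := f) (f := Prod.snd) hf contDiff_snd.contMDiff.contMDiffAt
  have hΦs : ContDiffAt ℝ 1 Φ (p, p) := by
    rw [← contMDiffAt_iff_contDiffAt]
    refine ContMDiffAt.comp (p, p) (g := extChartAt 𝓘(ℝ, E) (1 : G)) ?_ hfst
    refine contMDiffAt_extChartAt' ?_
    simp
  have hdiag : ContinuousAt (fun x : F => (x, x)) p := by fun_prop
  have hc : ContinuousAt (fun x : F => (fderiv ℝ Φ (x, x)).comp (ContinuousLinearMap.inr ℝ F F)) p :=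
    ((hΦs.continuousAt_fderiv one_ne_zero).comp (f := fun x : F => (x, x)) hdiag).clm_comp
      continuousAt_const
  refine hc.congr ?_
  have h1 : ∀ᶠ x in 𝓝 p, ContDiffAt ℝ 1 Φ (x, x) := hdiag.eventually (hΦs.eventually (by simp))
  have h2 : ∀ᶠ x in 𝓝 p, ContMDiffAt 𝓘(ℝ, F) 𝓘(ℝ, E) 1 f x :=
    (contMDiffAt_iff_contMDiffAt_nhds (by simp)).1 hf
  filter_upwards [h1, h2] with x hx hx'
  have h3 : MDifferentiableAt 𝓘(ℝ, F) 𝓘(ℝ, E) (fun z => (f x)⁻¹ * f z) x :=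
    (contMDiffAt_const.mul hx').mdifferentiableAt one_ne_zero
  refine Eq.trans ?_ (mfderiv_eq_fderiv_extChartAt h3 (inv_mul_cancel _)).symm
  exact ((hx.differentiableAt one_ne_zero).hasFDerivAt.comp x
    (hasFDerivAt_prodMk_right x x)).fderiv.symm

variable [FiniteDimensional ℝ E]

omit [LieGroup 𝓘(ℝ, E) ∞ G] in
theorem continuous_sqrt_form :
    Continuous (fun w : E => ENNReal.ofReal (Real.sqrt (q (show GroupLieAlgebra 𝓘(ℝ, E) G from w)
      (show GroupLieAlgebra 𝓘(ℝ, E) G from w)))) := by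
  let q' : E →ₗ[ℝ] E →ₗ[ℝ] ℝ := q
  have h : Continuous (fun w : E => q' w w) := by
    have h1 : Continuous fun w : E => LinearMap.toContinuousLinearMap (q' w) :=
      (LinearMap.toContinuousLinearMap.toLinearMap.comp q').continuous_of_finiteDimensional
    exact h1.clm_apply continuous_id
  exact ENNReal.continuous_ofReal.comp (Real.continuous_sqrt.comp h)

/-- A `C¹` path has bounded speed on `[0, 1]`. -/
theorem exists_leftSpeed_le {γ : ℝ → G} (hγ : ContMDiff 𝓘(ℝ, ℝ) 𝓘(ℝ, E) 1 γ) :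
    ∃ C : ℝ, 0 ≤ C ∧ ∀ t ∈ Icc (0 : ℝ) 1, leftSpeed q γ t ≤ ENNReal.ofReal C := by
  have hc : Continuous (leftSpeed q γ) := continuous_iff_continuousAt.2 fun t =>
    (continuous_sqrt_form q).continuousAt.comp (f := fun t => bodyVelocity (E := E) γ t)
      ((continuousAt_mfderiv_inv_mul (hγ t)).clm_apply continuousAt_const)
  obtain ⟨t, -, ht⟩ := isCompact_Icc.exists_isMaxOn (nonempty_Icc.2 (zero_le_one (α := ℝ)))
    hc.continuousOn
  exact ⟨_, Real.sqrt_nonneg _, fun s hs => ht hs⟩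

/-- The left-invariant distance is small near the diagonal. -/
theorem eventually_leftEDist_lt {ε : ℝ≥0∞} (hε : 0 < ε) : ∀ᶠ u in 𝓝 (1 : G), leftEDist q 1 u < ε := by
  let _ : LieGroup 𝓘(ℝ, E) 1 G := LieGroup.of_le (m := 1) (n := ∞) (by exact_mod_cast le_top)
  set e := extChartAt 𝓘(ℝ, E) (1 : G) with he
  set p := e 1 with hp
  have htgt : e.target ∈ 𝓝 p := extChartAt_target_mem_nhds (1 : G)
  have hs : ContMDiffOn 𝓘(ℝ, E) 𝓘(ℝ, E) 1 e.symm e.target := contMDiffOn_extChartAt_symm (1 : G)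
  have hsp : ContMDiffAt 𝓘(ℝ, E) 𝓘(ℝ, E) 1 e.symm p := hs.contMDiffAt htgt
  obtain ⟨ε', hε', hεε'⟩ := exists_between hε
  -- The speed in the chart at a point z.1 in the direction z.2. It is continuous and vanishes for
  -- z.2 = 0, so straight segments from p to nearby points are short.
  have hN : ContinuousAt (fun z : E × E => ENNReal.ofReal (Real.sqrt
      (q ((mfderiv 𝓘(ℝ, E) 𝓘(ℝ, E) (fun y => (e.symm z.1)⁻¹ * e.symm y) z.1 : E →L[ℝ] E) z.2)
        ((mfderiv 𝓘(ℝ, E) 𝓘(ℝ, E) (fun y => (e.symm z.1)⁻¹ * e.symm y) z.1 : E →L[ℝ] E) z.2))))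
      (p, 0) :=
    (continuous_sqrt_form q).continuousAt.comp
      (((continuousAt_mfderiv_inv_mul hsp).comp (f := Prod.fst) (x := (p, (0 : E)))
        continuousAt_fst).clm_apply continuousAt_snd)
  have hN0 : ∀ᶠ z : E × E in 𝓝 (p, 0), ENNReal.ofReal (Real.sqrt
      (q ((mfderiv 𝓘(ℝ, E) 𝓘(ℝ, E) (fun y => (e.symm z.1)⁻¹ * e.symm y) z.1 : E →L[ℝ] E) z.2)
        ((mfderiv 𝓘(ℝ, E) 𝓘(ℝ, E) (fun y => (e.symm z.1)⁻¹ * e.symm y) z.1 : E →L[ℝ] E) z.2)))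
      < ε' := by
    have hz : ∀ A : E →L[ℝ] GroupLieAlgebra 𝓘(ℝ, E) G,
        ENNReal.ofReal (Real.sqrt (q (A 0) (A 0))) = 0 := fun A => by simp
    exact hN.eventually (Iio_mem_nhds ((hz _).trans_lt hε'))
  obtain ⟨δ, hδ, hball⟩ := Metric.eventually_nhds_iff_ball.1
    ((hN0.and ((continuous_fst.tendsto (p, (0 : E))).eventually htgt)))
  have hnear : ∀ᶠ u in 𝓝 (1 : G), e u ∈ Metric.ball p δ ∧ u ∈ e.source :=
    ((continuousAt_extChartAt (1 : G)).eventually (Metric.ball_mem_nhds p hδ)).and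
      (extChartAt_source_mem_nhds (1 : G))
  filter_upwards [hnear] with u ⟨hu, hus⟩
  set η : ℝ → E := fun t => p + t • (e u - p) with hη
  have hw : ‖e u - p‖ < δ := by rwa [← dist_eq_norm]
  have hηball : ∀ t ∈ Icc (0 : ℝ) 1, (η t, e u - p) ∈ Metric.ball (p, (0 : E)) δ := fun t ht => by
    rw [Metric.mem_ball, Prod.dist_eq, max_lt_iff, dist_eq_norm, dist_zero_right]
    refine ⟨?_, hw⟩
    simp only [hη, add_sub_cancel_left, norm_smul, Real.norm_of_nonneg ht.1]
    exact (mul_le_of_le_one_left (norm_nonneg _) ht.2).trans_lt hw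
  have hηt : ∀ t ∈ Icc (0 : ℝ) 1, η t ∈ e.target := fun t ht => (hball _ (hηball t ht)).2
  have hηs : ContMDiff 𝓘(ℝ, ℝ) 𝓘(ℝ, E) 1 η := by
    rw [contMDiff_iff_contDiff]
    fun_prop
  have hγ : ContMDiffOn 𝓘(ℝ, ℝ) 𝓘(ℝ, E) 1 (e.symm ∘ η) (Icc 0 1) := hs.comp hηs.contMDiffOn hηt
  have h0 : (e.symm ∘ η) 0 = 1 := by simp [hη, hp, he]
  have h1 : (e.symm ∘ η) 1 = u := by
    simp only [hη, Function.comp_apply, one_smul, add_sub_cancel]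
    exact e.left_inv hus
  have hle := leftEDist_le_lintegral q hγ
  rw [h0, h1] at hle
  refine (hle.trans (setLIntegral_mono' (g := fun _ => ε') measurableSet_Ioo
    fun t ht => ?_)).trans_lt (by simpa using hεε')
  have ht := Ioo_subset_Icc_self ht
  have d1 : MDifferentiableAt 𝓘(ℝ, E) 𝓘(ℝ, E) (fun y => (e.symm (η t))⁻¹ * e.symm y) (η t) :=
    (contMDiffAt_const.mul (hs.contMDiffAt (by
      exact (isOpen_extChartAt_target (1 : G)).mem_nhds (hηt t ht)))).mdifferentiableAt one_ne_zero
  have d2 : HasMFDerivAt 𝓘(ℝ, ℝ) 𝓘(ℝ, E) η t ((1 : ℝ →L[ℝ] ℝ).smulRight (e u - p)) := by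
    have := ((hasDerivAt_id t).smul_const (e u - p)).const_add p
    rw [one_smul] at this
    exact this.hasFDerivAt.hasMFDerivAt
  have e1 : bodyVelocity (E := E) (e.symm ∘ η) t =
      (mfderiv 𝓘(ℝ, E) 𝓘(ℝ, E) (fun y => (e.symm (η t))⁻¹ * e.symm y) (η t) : E →L[ℝ] E)
        (e u - p) := by
    refine (DFunLike.congr_fun (d1.hasMFDerivAt.comp t d2).mfderiv (1 : ℝ)).trans ?_
    have aux : ∀ A : E →L[ℝ] E, A (((1 : ℝ →L[ℝ] ℝ).smulRight (e u - p)) 1) = A (e u - p) :=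
      fun A => by simp
    exact aux _
  rw [leftSpeed, e1]
  exact (hball _ (hηball t ht)).1.le

end LeftInvariant

/-! ### Distances on quotients of G. -/

section Quotient

variable {E : Type*} [NormedAddCommGroup E] [NormedSpace ℝ E]
  {G : Type*} [TopologicalSpace G] [ChartedSpace E G] [Group G]
  (q : LinearMap.BilinForm ℝ (GroupLieAlgebra 𝓘(ℝ, E) G))

theorem quotientEDist_mk (S : Subgroup G) (x y : G) :
    quotientEDist S q x y = ⨅ (s : S) (s' : S), leftEDist q (x * s) (y * s') := by
  rw [quotientEDist_eq]
  refine le_antisymm (le_iInf fun s => le_iInf fun s' => ?_) ?_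
  · exact iInf₂_le_of_le (x * s) (y * s') (iInf₂_le_of_le (QuotientGroup.mk_mul_of_mem x s.2)
      (QuotientGroup.mk_mul_of_mem y s'.2) le_rfl)
  · refine le_iInf₂ fun x' y' => le_iInf₂ fun hx hy => ?_
    refine iInf₂_le_of_le ⟨x⁻¹ * x', QuotientGroup.eq.1 hx.symm⟩ ⟨y⁻¹ * y', QuotientGroup.eq.1 hy.symm⟩ ?_
    simp

theorem quotientEDist_le {S : Subgroup G} (x y : G) {s s' : G} (hs : s ∈ S) (hs' : s' ∈ S) :
    quotientEDist S q x y ≤ leftEDist q (x * s) (y * s') := by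
  rw [quotientEDist_mk]
  exact iInf₂_le (f := fun s s' : S => leftEDist q (x * s) (y * s')) ⟨s, hs⟩ ⟨s', hs'⟩

theorem quotientEDist_le_leftEDist (S : Subgroup G) (x y : G) :
    quotientEDist S q x y ≤ leftEDist q x y := by
  simpa using quotientEDist_le q x y S.one_mem S.one_mem

variable [LieGroup 𝓘(ℝ, E) ∞ G]

/-- The first curve ends at y s' and the second starts at y t. Right translation by t⁻¹ s' in S is
an isometry and moves the second curve to start where the first ends. -/
theorem quotientEDist_triangle {S : Subgroup G}
    (hS : ∀ a ∈ S, ∀ w, q (Ad E a w) (Ad E a w) = q w w) (x y z : G) :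
    quotientEDist S q x z ≤ quotientEDist S q x y + quotientEDist S q y z := by
  rw [quotientEDist_mk q S x y, quotientEDist_mk q S y z]
  simp only [ENNReal.iInf_add, ENNReal.add_iInf]
  refine le_iInf₂ fun t t' => le_iInf₂ fun s s' => ?_
  have h1 : leftEDist q (y * s') (z * (t' * t⁻¹ * s')) ≤ leftEDist q (y * t) (z * t') := by
    have := leftEDist_mul_right q (a := ((t⁻¹ * s' : S) : G))
      (hS _ (S.inv_mem (t⁻¹ * s' : S).2)) (y * t) (z * t')
    simpa [mul_assoc] using this
  calc quotientEDist S q x z ≤ leftEDist q (x * s) (z * (t' * t⁻¹ * s')) :=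
        quotientEDist_le q x z s.2 (S.mul_mem (S.mul_mem t'.2 (S.inv_mem t.2)) s'.2)
    _ ≤ leftEDist q (x * s) (y * s') + leftEDist q (y * s') (z * (t' * t⁻¹ * s')) :=
        leftEDist_triangle q _ _ _
    _ ≤ _ := by gcongr

variable [FiniteDimensional ℝ E] [CompactSpace G]

/-- The distance in question is that of 1 to the conjugate h⁻¹(x₀⁻¹x)h, and compactness of G makes
it small uniformly in h. This replaces right invariance, which q need not have. -/
theorem eventually_forall_leftEDist_lt (x₀ : G) {ε : ℝ≥0∞} (hε : 0 < ε) :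
    ∀ᶠ x in 𝓝 x₀, ∀ h : G, leftEDist q (x₀ * h) (x * h) < ε := by
  have : IsTopologicalGroup G := topologicalGroup_of_lieGroup 𝓘(ℝ, E) ∞
  have key : ∀ h ∈ (univ : Set G), ∀ᶠ z : G × G in 𝓝 (x₀, h),
      leftEDist q (x₀ * z.2) (z.1 * z.2) < ε := fun h _ => by
    have hc : Tendsto (fun z : G × G => (x₀ * z.2)⁻¹ * (z.1 * z.2)) (𝓝 (x₀, h)) (𝓝 1) := by
      have : Continuous fun z : G × G => (x₀ * z.2)⁻¹ * (z.1 * z.2) := by fun_prop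
      simpa using this.tendsto (x₀, h)
    filter_upwards [hc.eventually (eventually_leftEDist_lt q hε)] with z hz
    rwa [leftEDist_eq_one_left]
  filter_upwards [isCompact_univ.eventually_forall_of_forall_eventually
    (P := fun x h => leftEDist q (x₀ * h) (x * h) < ε) key] with x hx h
  exact hx h trivial

/-- In a connected quotient of a compact group, any two cosets are joined by paths of bounded
length. -/
theorem exists_leftEDist_le (S : Subgroup G) [ConnectedSpace (G ⧸ S)] :
    ∃ C : ℝ≥0∞, C ≠ ⊤ ∧ ∀ x y : G, ∃ s ∈ S, ∃ s' ∈ S, leftEDist q (x * s) (y * s') ≤ C := by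
  have hfin : ∀ x y, leftEDist q 1 x < ⊤ → leftEDist q x y < 1 → leftEDist q 1 y < ⊤ :=
    fun x y hx hxy => (leftEDist_triangle q 1 x y).trans_lt
      (ENNReal.add_lt_top.2 ⟨hx, hxy.trans ENNReal.one_lt_top⟩)
  -- G may be disconnected, so distances from 1 may be infinite; compactness bounds the finite ones.
  obtain ⟨C, hC, hbound⟩ : ∃ C : ℝ≥0∞, C ≠ ⊤ ∧
      ∀ x ∈ (univ : Set G), leftEDist q 1 x < ⊤ → leftEDist q 1 x ≤ C := by
    refine isCompact_univ.induction_on (p := fun s => ∃ C : ℝ≥0∞, C ≠ ⊤ ∧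
      ∀ x ∈ s, leftEDist q 1 x < ⊤ → leftEDist q 1 x ≤ C) ⟨0, by simp, by simp⟩ ?_ ?_ ?_
    · rintro s t hst ⟨C, hC, h⟩
      exact ⟨C, hC, fun x hx => h x (hst hx)⟩
    · rintro s t ⟨C, hC, h⟩ ⟨C', hC', h'⟩
      refine ⟨C + C', ENNReal.add_ne_top.2 ⟨hC, hC'⟩, ?_⟩
      rintro x (hx | hx) hlt
      · exact (h x hx hlt).trans le_self_add
      · exact (h' x hx hlt).trans le_add_self
    · intro x _
      refine ⟨_, mem_nhdsWithin_of_mem_nhds (eventually_forall_leftEDist_lt q x one_pos), ?_⟩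
      by_cases hx : leftEDist q 1 x < ⊤
      · refine ⟨leftEDist q 1 x + 1, ENNReal.add_ne_top.2 ⟨hx.ne, ENNReal.one_ne_top⟩,
          fun y hy _ => (leftEDist_triangle q 1 x y).trans ?_⟩
        gcongr
        simpa using (hy 1).le
      · refine ⟨0, by simp, fun y hy hlt => (hx (hfin y x hlt ?_)).elim⟩
        rw [leftEDist_comm]
        simpa using hy 1
  -- The elements whose coset can be reached from 1 by a curve of finite length. This set is open,
  -- closed and a union of cosets, so connectedness of the quotient makes it everything.
  set U : Set G := {x | ∃ s ∈ S, leftEDist q 1 (x * s) < ⊤} with hU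
  set B : Set (G ⧸ S) := {b | ∃ x ∈ U, (x : G ⧸ S) = b} with hB
  have hpre : ((↑) : G → G ⧸ S) ⁻¹' B = U := by
    ext x
    refine ⟨?_, fun hx => ⟨x, hx, rfl⟩⟩
    rintro ⟨y, ⟨s, hs, hys⟩, hxy⟩
    refine ⟨x⁻¹ * y * s, S.mul_mem (QuotientGroup.eq.1 hxy.symm) hs, ?_⟩
    simpa [mul_assoc] using hys
  have hlocal : ∀ x, ∀ᶠ y in 𝓝 x, (y ∈ U ↔ x ∈ U) := fun x => by
    filter_upwards [eventually_forall_leftEDist_lt q x one_pos] with y hy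
    constructor
    · rintro ⟨s, hs, h⟩
      exact ⟨s, hs, hfin _ _ h (leftEDist_comm q _ _ ▸ hy s)⟩
    · rintro ⟨s, hs, h⟩
      exact ⟨s, hs, hfin _ _ h (hy s)⟩
  have hUo : IsOpen U := isOpen_iff_mem_nhds.2 fun x hx => (hlocal x).mono fun y hy => hy.2 hx
  have hUc : IsOpen Uᶜ := isOpen_iff_mem_nhds.2 fun x hx =>
    (hlocal x).mono fun y hy hyU => hx (hy.1 hyU)
  have hBclopen : IsClopen B := by
    refine ⟨⟨?_⟩, ?_⟩
    · exact (QuotientGroup.isQuotientMap_mk (N := S)).isOpen_preimage.1 (by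
        rw [preimage_compl, hpre]; exact hUc)
    · exact (QuotientGroup.isQuotientMap_mk (N := S)).isOpen_preimage.1 (by rw [hpre]; exact hUo)
  have hself : leftEDist q 1 1 < ⊤ := by
    have := (eventually_leftEDist_lt q one_pos).self_of_nhds
    exact this.trans ENNReal.one_lt_top
  have hBuniv : B = univ := (isClopen_iff.1 hBclopen).resolve_left
    (Nonempty.ne_empty ⟨((1 : G) : G ⧸ S), 1, ⟨1, S.one_mem, by simpa using hself⟩, rfl⟩)
  have hall : ∀ x, x ∈ U := fun x => by rw [← hpre, hBuniv]; trivial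
  refine ⟨C + C, ENNReal.add_ne_top.2 ⟨hC, hC⟩, fun x y => ?_⟩
  obtain ⟨s, hs, hx⟩ := hall x
  obtain ⟨s', hs', hy⟩ := hall y
  refine ⟨s, hs, s', hs', (leftEDist_triangle q _ 1 _).trans (add_le_add ?_ (hbound _ trivial hy))⟩
  rw [leftEDist_comm]
  exact hbound _ trivial hx

end Quotient

/-! ### Collapse of G/K to G/H. -/

section Collapse

variable {E : Type*} [NormedAddCommGroup E] [NormedSpace ℝ E] [FiniteDimensional ℝ E]
  {G : Type*} [TopologicalSpace G] [ChartedSpace E G] [Group G] [LieGroup 𝓘(ℝ, E) ∞ G]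

/-- C depends on the reference form q' only, so the diameter tends to 0 with c. -/
theorem exists_ediam_quotientEDist_le [CompactSpace G] (S : Subgroup G) [ConnectedSpace (G ⧸ S)]
    (q' : LinearMap.BilinForm ℝ (GroupLieAlgebra 𝓘(ℝ, E) G)) :
    ∃ C : ℝ≥0∞, C ≠ ⊤ ∧ ∀ (q : LinearMap.BilinForm ℝ (GroupLieAlgebra 𝓘(ℝ, E) G)) (c : ℝ), 0 < c →
      (∀ w, q w w ≤ c ^ 2 * q' w w) → ediam (quotientEDist S q) ≤ ENNReal.ofReal c * C := by
  obtain ⟨C, hC, h⟩ := exists_leftEDist_le q' S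
  refine ⟨C, hC, fun q c hc hq => iSup₂_le fun a b => ?_⟩
  induction a using QuotientGroup.induction_on with | H x => ?_
  induction b using QuotientGroup.induction_on with | H y => ?_
  obtain ⟨s, hs, s', hs', hle⟩ := h x y
  calc quotientEDist S q x y ≤ leftEDist q (x * s) (y * s') := quotientEDist_le q x y hs hs'
    _ ≤ ENNReal.ofReal c * leftEDist q' (x * s) (y * s') := leftEDist_mono hc hq _ _
    _ ≤ _ := by gcongr

-- The inclusion of H does not increase length for the pulled-back form, and left translation by x
-- carries curves in H into the fibre through xK.
omit [FiniteDimensional ℝ E] in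
theorem quotientEDist_mul_le_ediam {F : Type*} [NormedAddCommGroup F] [NormedSpace ℝ F]
    (K H : Subgroup G) [ChartedSpace F H] [LieGroup 𝓘(ℝ, F) ∞ H]
    (hH : ContMDiff 𝓘(ℝ, F) 𝓘(ℝ, E) ∞ (Subtype.val : H → G))
    (q : LinearMap.BilinForm ℝ (GroupLieAlgebra 𝓘(ℝ, E) G)) (x : G) {h : G} (hh : h ∈ H) :
    quotientEDist K q x ((x * h : G) : G ⧸ K) ≤ ediam (quotientEDist (E := F) (K.subgroupOf H)
      (q.compl₁₂ (inclusionDeriv E F H) (inclusionDeriv E F H))) := by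
  set q' := q.compl₁₂ (inclusionDeriv E F H) (inclusionDeriv E F H) with hq'
  refine le_trans ?_ (le_iSup₂ (f := fun a b => quotientEDist (E := F) (K.subgroupOf H) q' a b)
    (((1 : H) : H ⧸ K.subgroupOf H)) ((⟨h, hh⟩ : H) : H ⧸ K.subgroupOf H))
  rw [quotientEDist_mk q']
  refine le_iInf₂ fun s s' => ?_
  have hle : leftEDist q (((1 * s : H) : G)) (((⟨h, hh⟩ * s' : H) : G)) ≤
      ENNReal.ofReal 1 * leftEDist q' (1 * s) (⟨h, hh⟩ * s') :=
    leftEDist_map_le q (φ := Subtype.val) (ψ := Subtype.val) hH hH (fun _ _ => rfl) one_pos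
      (fun w => by
        rw [one_pow, one_mul]
        exact le_rfl) _ _
  rw [ENNReal.ofReal_one, one_mul (leftEDist _ _ _)] at hle
  refine le_trans ?_ hle
  refine (quotientEDist_le q x (x * h) s.2 s'.2).trans ?_
  rw [mul_assoc]
  simpa using leftEDist_mul_left q x (s : H) (h * (s' : H))

/-- A family of invariant metrics `x₁ q₁ + x₂ q₂` on `G/K` collapses to the metric `r q₂` on `G/H` if
`x₁ → 0`, `x₂ → r` and the diameters of the fibres tend to `0`. -/
theorem tendsto_ghEDist [CompactSpace G] {K H : Subgroup G} (hKH : K ≤ H)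
    [ConnectedSpace (G ⧸ K)] {q₁ q₂ : LinearMap.BilinForm ℝ (GroupLieAlgebra 𝓘(ℝ, E) G)}
    (hq₁ : ∀ w, 0 ≤ q₁ w w) (hq₂ : ∀ w, 0 ≤ q₂ w w) {x₁ x₂ : ℝ → ℝ} {l : Filter ℝ} {r : ℝ}
    (hr : 0 < r) (hx₁ : ∀ᶠ t in l, 0 < x₁ t) (hx₂ : ∀ᶠ t in l, r ≤ x₂ t)
    (hx₁l : Tendsto x₁ l (𝓝 0)) (hx₂l : Tendsto x₂ l (𝓝 r))
    (hinv : ∀ t, ∀ a ∈ K, ∀ w, (x₁ t • q₁ + x₂ t • q₂) (Ad E a w) (Ad E a w) =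
      (x₁ t • q₁ + x₂ t • q₂) w w)
    {φ : ℝ → ℝ≥0∞} (hφ : Tendsto φ l (𝓝 0))
    (hfib : ∀ t, ∀ x : G, ∀ h ∈ H, quotientEDist K (x₁ t • q₁ + x₂ t • q₂) x ((x * h : G) : G ⧸ K) ≤ φ t) :
    Tendsto (fun t => ghEDist (quotientEDist K (x₁ t • q₁ + x₂ t • q₂)) (quotientEDist H (r • q₂)))
      l (𝓝 0) := by
  set Q : ℝ → LinearMap.BilinForm ℝ (GroupLieAlgebra 𝓘(ℝ, E) G) :=
    fun t => x₁ t • q₁ + x₂ t • q₂ with hQ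
  have hQw : ∀ t w, Q t w w = x₁ t * q₁ w w + x₂ t * q₂ w w := fun t w => rfl
  have hrw : ∀ w, (r • q₂) w w = r * q₂ w w := fun w => rfl
  have hBfin : ∀ x y : G, quotientEDist H (r • q₂) x y ≠ ⊤ := fun x y => by
    obtain ⟨C, hC, h⟩ := exists_leftEDist_le (r • q₂) K
    obtain ⟨s, hs, s', hs', hle⟩ := h x y
    exact ne_top_of_le_ne_top hC ((quotientEDist_le _ x y (hKH hs) (hKH hs')).trans hle)
  -- r q₂ ≤ x₁ q₁ + x₂ q₂ as x₂ ≥ r, and cosets of H offer more endpoints than cosets of K.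
  have hlower : ∀ᶠ t in l, ∀ x y : G, quotientEDist H (r • q₂) x y ≤ quotientEDist K (Q t) x y := by
    filter_upwards [hx₁, hx₂] with t h1 h2 x y
    rw [quotientEDist_mk]
    rw [quotientEDist_mk]
    refine le_iInf₂ fun s s' => ?_
    refine iInf₂_le_of_le ⟨s, hKH s.2⟩ ⟨s', hKH s'.2⟩ ?_
    have := leftEDist_mono (q := r • q₂) (q' := Q t) one_pos (fun w => by
      rw [one_pow, one_mul, hQw, hrw]
      have := mul_nonneg h1.le (hq₁ w)
      have := mul_le_mul_of_nonneg_right h2 (hq₂ w)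
      linarith) (x * s) (y * s')
    simpa using this
  -- The 8δ: two for replacing (x, y) by (x₀, y₀) in the base and two upstairs, two for the curve,
  -- two for moving along the fibres at its ends.
  have hupper : ∀ δ : ℝ≥0∞, 0 < δ → δ ≠ ⊤ → ∀ᶠ t in l, ∀ x y : G,
      quotientEDist K (Q t) x y ≤ quotientEDist H (r • q₂) x y + 8 * δ := by
    intro δ hδ hδt
    set M := Real.sqrt (r + 1) with hM
    have hMpos : 0 < M := Real.sqrt_pos.2 (by linarith)
    have hM2 : M ^ 2 = r + 1 := Real.sq_sqrt (by linarith)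
    have hM' : ENNReal.ofReal M ≠ 0 := (ENNReal.ofReal_pos.2 hMpos).ne'
    have hη : 0 < δ / ENNReal.ofReal M := ENNReal.div_pos hδ.ne' ENNReal.ofReal_ne_top
    have hdom : ∀ᶠ t in l, ∀ x y : G, leftEDist (Q t) x y ≤ ENNReal.ofReal M * leftEDist (q₁ + q₂) x y := by
      filter_upwards [hx₁l.eventually (Iio_mem_nhds (show (0 : ℝ) < r + 1 by linarith)),
        hx₂l.eventually (Iio_mem_nhds (show r < r + 1 by linarith))] with t h1 h2 x y
      refine leftEDist_mono hMpos (fun w => ?_) x y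
      have e : (q₁ + q₂) w w = q₁ w w + q₂ w w := rfl
      rw [hQw, hM2, e, mul_add]
      exact add_le_add (mul_le_mul_of_nonneg_right (le_of_lt h1) (hq₁ w))
        (mul_le_mul_of_nonneg_right (le_of_lt h2) (hq₂ w))
    have hφδ : ∀ᶠ t in l, φ t ≤ δ := ENNReal.tendsto_nhds_zero.1 hφ δ hδ
    have hlocal : ∀ p ∈ (univ : Set (G × G)), {z : ℝ × (G × G) | quotientEDist K (Q z.1) z.2.1 z.2.2 ≤
        quotientEDist H (r • q₂) z.2.1 z.2.2 + 8 * δ} ∈ l ×ˢ 𝓝 p := by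
      rintro ⟨x₀, y₀⟩ -
      set B₀ := quotientEDist H (r • q₂) x₀ y₀ with hB₀
      have hB₀t : B₀ + δ ≠ ⊤ := ENNReal.add_ne_top.2 ⟨hBfin x₀ y₀, hδt⟩
      -- an almost minimal path in the base
      obtain ⟨h, h', hlt⟩ : ∃ h h' : H, leftEDist (r • q₂) (x₀ * h) (y₀ * h') < B₀ + δ := by
        have : B₀ < B₀ + δ := ENNReal.lt_add_right (hBfin x₀ y₀) hδ.ne'
        conv_lhs at this => rw [hB₀, quotientEDist_mk]
        simpa only [iInf_lt_iff] using this
      obtain ⟨γ, hγ0, hγ1, hγ, hlen⟩ := exists_path_of_leftEDist_lt (r • q₂) hlt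
      obtain ⟨C, hC0, hC⟩ := exists_leftSpeed_le q₁ hγ
      -- The curve is fixed while t varies. Its q₁-speed is bounded by C and enters with weight √x₁
      -- → 0; its base length is multiplied by √(x₂/r) → 1.
      have hpath : ∀ᶠ t in l, leftEDist (Q t) (x₀ * h) (y₀ * h') ≤
          ENNReal.ofReal (Real.sqrt (x₁ t) * C) + ENNReal.ofReal (Real.sqrt (x₂ t / r)) * (B₀ + δ) := by
        filter_upwards [hx₁, hx₂] with t h1 h2
        have h2' : 0 < x₂ t := hr.trans_le h2
        have hsp : ∀ s ∈ Ioo (0 : ℝ) 1, leftSpeed (Q t) γ s ≤ ENNReal.ofReal (Real.sqrt (x₁ t) * C) +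
            ENNReal.ofReal (Real.sqrt (x₂ t / r)) * leftSpeed (r • q₂) γ s := by
          intro s hs
          set w := bodyVelocity (E := E) γ s with hw
          have e1 : leftSpeed (Q t) γ s ≤ ENNReal.ofReal (Real.sqrt (x₁ t)) * leftSpeed q₁ γ s +
              ENNReal.ofReal (Real.sqrt (x₂ t / r)) * leftSpeed (r • q₂) γ s := by
            simp only [leftSpeed, ← hw]
            rw [hQw, hrw, ← ENNReal.ofReal_mul (Real.sqrt_nonneg _),
              ← ENNReal.ofReal_mul (Real.sqrt_nonneg _), ← Real.sqrt_mul h1.le,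
              ← Real.sqrt_mul (div_pos h2' hr).le,
              ← ENNReal.ofReal_add (Real.sqrt_nonneg _) (Real.sqrt_nonneg _)]
            refine ENNReal.ofReal_le_ofReal ?_
            rw [show x₂ t / r * (r * q₂ w w) = x₂ t * q₂ w w by field_simp]
            rw [Real.sqrt_le_iff]
            refine ⟨by positivity, ?_⟩
            have := mul_nonneg (Real.sqrt_nonneg (x₁ t * q₁ w w)) (Real.sqrt_nonneg (x₂ t * q₂ w w))
            nlinarith [Real.sq_sqrt (mul_nonneg h1.le (hq₁ w)),
              Real.sq_sqrt (mul_nonneg h2'.le (hq₂ w))]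
          refine e1.trans ?_
          gcongr
          rw [ENNReal.ofReal_mul (Real.sqrt_nonneg _)]
          gcongr
          exact hC s (Ioo_subset_Icc_self hs)
        calc leftEDist (Q t) (x₀ * h) (y₀ * h') ≤ ∫⁻ s in Ioo 0 1, leftSpeed (Q t) γ s := by
              rw [← hγ0, ← hγ1]
              exact leftEDist_le_lintegral _ hγ.contMDiffOn
          _ ≤ ∫⁻ s in Ioo 0 1, (ENNReal.ofReal (Real.sqrt (x₁ t) * C) +
              ENNReal.ofReal (Real.sqrt (x₂ t / r)) * leftSpeed (r • q₂) γ s) :=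
            setLIntegral_mono' measurableSet_Ioo hsp
          _ = ENNReal.ofReal (Real.sqrt (x₁ t) * C) +
              ENNReal.ofReal (Real.sqrt (x₂ t / r)) * ∫⁻ s in Ioo 0 1, leftSpeed (r • q₂) γ s := by
            rw [lintegral_add_left measurable_const, lintegral_const_mul' _ _ ENNReal.ofReal_ne_top]
            simp
          _ ≤ _ := by gcongr
      have hlim : Tendsto (fun t => ENNReal.ofReal (Real.sqrt (x₁ t) * C) +
          ENNReal.ofReal (Real.sqrt (x₂ t / r)) * (B₀ + δ)) l (𝓝 (B₀ + δ)) := by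
        have l1 : Tendsto (fun t => ENNReal.ofReal (Real.sqrt (x₁ t) * C)) l (𝓝 0) := by
          have := ENNReal.tendsto_ofReal ((Real.continuous_sqrt.tendsto 0).comp hx₁l |>.mul_const C)
          simpa using this
        have l2 : Tendsto (fun t => ENNReal.ofReal (Real.sqrt (x₂ t / r))) l (𝓝 1) := by
          have := ENNReal.tendsto_ofReal
            ((Real.continuous_sqrt.tendsto (r / r)).comp (hx₂l.div_const r))
          simpa [div_self hr.ne'] using this
        have := l1.add (ENNReal.Tendsto.mul_const l2 (.inr hB₀t) (b := B₀ + δ))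
        simpa using this
      have hmid : ∀ᶠ t in l, leftEDist (Q t) (x₀ * h) (y₀ * h') ≤ B₀ + 2 * δ := by
        have : B₀ + δ < B₀ + 2 * δ := by
          rw [two_mul, ← add_assoc]
          exact ENNReal.lt_add_right hB₀t hδ.ne'
        filter_upwards [hpath, hlim.eventually (Iio_mem_nhds this)] with t ht ht'
        exact ht.trans (le_of_lt ht')
      -- nearby points
      have hnear : ∀ᶠ p in 𝓝 (x₀, y₀),
          ((∀ k : G, leftEDist (r • q₂) (x₀ * k) (p.1 * k) < δ) ∧
            ∀ k : G, leftEDist (r • q₂) (y₀ * k) (p.2 * k) < δ) ∧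
          (∀ k : G, leftEDist (q₁ + q₂) (x₀ * k) (p.1 * k) < δ / ENNReal.ofReal M) ∧
            ∀ k : G, leftEDist (q₁ + q₂) (y₀ * k) (p.2 * k) < δ / ENNReal.ofReal M :=
        (((continuous_fst.tendsto (x₀, y₀)).eventually (eventually_forall_leftEDist_lt _ x₀ hδ)).and
          ((continuous_snd.tendsto (x₀, y₀)).eventually
            (eventually_forall_leftEDist_lt _ y₀ hδ))).and
        (((continuous_fst.tendsto (x₀, y₀)).eventually (eventually_forall_leftEDist_lt _ x₀ hη)).and
          ((continuous_snd.tendsto (x₀, y₀)).eventually (eventually_forall_leftEDist_lt _ y₀ hη)))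
      refine ((hmid.and (hdom.and hφδ)).prod_mk hnear).mono ?_
      rintro ⟨t, x, y⟩ ⟨⟨hm, hd, hp⟩, ⟨hxr, hyr⟩, hxq, hyq⟩
      -- The same s multiplies x₀ and x, and the same s' multiplies y₀ and y, so the uniform
      -- estimates suffice and Ad(H)-invariance of q₂ is not called for.
      have hB : B₀ ≤ δ + (quotientEDist H (r • q₂) x y + δ) := by
        rw [quotientEDist_mk (r • q₂) H x y]
        simp only [ENNReal.iInf_add, ENNReal.add_iInf]
        refine le_iInf₂ fun s s' => ?_
        calc B₀ ≤ leftEDist (r • q₂) (x₀ * s) (y₀ * s') := quotientEDist_le _ _ _ s.2 s'.2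
          _ ≤ leftEDist (r • q₂) (x₀ * s) (x * s) + leftEDist (r • q₂) (x * s) (y₀ * s') :=
            leftEDist_triangle _ _ _ _
          _ ≤ δ + (leftEDist (r • q₂) (x * s) (y * s') + leftEDist (r • q₂) (y * s') (y₀ * s')) :=
            add_le_add (hxr s).le (leftEDist_triangle _ _ _ _)
          _ ≤ _ := by
            gcongr
            rw [leftEDist_comm]
            exact (hyr s').le
      have hnearQ : ∀ {a b : G}, (∀ k : G, leftEDist (q₁ + q₂) (a * k) (b * k) < δ / ENNReal.ofReal M) →
          leftEDist (Q t) a b ≤ δ := fun {a b} hab => by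
        refine (hd a b).trans ?_
        have := (hab 1).le
        rw [mul_one, mul_one] at this
        calc _ ≤ ENNReal.ofReal M * (δ / ENNReal.ofReal M) := by gcongr
          _ = δ := ENNReal.mul_div_cancel hM' ENNReal.ofReal_ne_top
      have tri := quotientEDist_triangle (Q t) (S := K) (hinv t)
      have s1 : quotientEDist K (Q t) x x₀ ≤ δ := by
        refine (quotientEDist_le_leftEDist _ _ _ _).trans ?_
        rw [leftEDist_comm]
        exact hnearQ hxq
      have s2 : quotientEDist K (Q t) x₀ ((x₀ * h : G) : G ⧸ K) ≤ δ := (hfib t x₀ h h.2).trans hp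
      have s3 : quotientEDist K (Q t) ((x₀ * h : G) : G ⧸ K) ((y₀ * h' : G) : G ⧸ K) ≤ B₀ + 2 * δ :=
        (quotientEDist_le_leftEDist _ _ _ _).trans hm
      have s4 : quotientEDist K (Q t) ((y₀ * h' : G) : G ⧸ K) y₀ ≤ δ := by
        have := (hfib t (y₀ * h') _ (H.inv_mem h'.2)).trans hp
        simpa using this
      have s5 : quotientEDist K (Q t) y₀ y ≤ δ :=
        (quotientEDist_le_leftEDist _ _ _ _).trans (hnearQ hyq)
      change quotientEDist K (Q t) x y ≤ quotientEDist H (r • q₂) x y + 8 * δ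
      calc quotientEDist K (Q t) x y
          ≤ quotientEDist K (Q t) x x₀ + (quotientEDist K (Q t) x₀ ((x₀ * h : G) : G ⧸ K) +
            (quotientEDist K (Q t) ((x₀ * h : G) : G ⧸ K) ((y₀ * h' : G) : G ⧸ K) +
            (quotientEDist K (Q t) ((y₀ * h' : G) : G ⧸ K) y₀ + quotientEDist K (Q t) y₀ y))) :=
          (tri _ x₀ _).trans (add_le_add le_rfl ((tri _ (x₀ * h) _).trans (add_le_add le_rfl
            ((tri _ (y₀ * h') _).trans (add_le_add le_rfl (tri _ y₀ _))))))
        _ ≤ δ + (δ + (δ + (quotientEDist H (r • q₂) x y + δ) + 2 * δ + (δ + δ))) := by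
          gcongr
          exact s3.trans (by gcongr)
        _ = _ := by ring
    -- Compactness of G × G makes the local estimates uniform in x and y.
    have hmem := isCompact_univ.mem_prod_nhdsSet_of_forall hlocal
    rw [nhdsSet_univ, ← principal_univ] at hmem
    filter_upwards [eventually_prod_principal_iff.1 hmem] with t ht x y
    exact ht (x, y) trivial
  refine ENNReal.tendsto_nhds_zero.2 fun ε hε => ?_
  set ε' := min ε 1 with hε'
  have hε'0 : 0 < ε' := lt_min hε one_pos
  have hε't : ε' ≠ ⊤ := ne_top_of_le_ne_top ENNReal.one_ne_top (min_le_right _ _)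
  have h16 : 8 * (ε' / 16) < ε' := by
    have : 8 * (ε' / 16) = ε' / 2 := by
      rw [show (16 : ℝ≥0∞) = 8 * 2 by norm_num, ENNReal.div_eq_inv_mul, ENNReal.mul_inv (by simp)
        (by simp), ← mul_assoc, ← mul_assoc, ENNReal.mul_inv_cancel (by simp) (by simp), one_mul,
        ENNReal.div_eq_inv_mul]
    rw [this]
    exact ENNReal.half_lt_self hε'0.ne' hε't
  filter_upwards [hlower, hupper (ε' / 16) (ENNReal.div_pos hε'0.ne' (by simp))
    (ENNReal.div_ne_top hε't (by simp))] with t hlo hup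
  refine (sInf_le ?_ : ghEDist _ _ ≤ ε').trans (min_le_left _ _)
  -- The correspondence is the graph of the projection G/K → G/H.
  refine ⟨{p | ∃ x : G, (x : G ⧸ K) = p.1 ∧ (x : G ⧸ H) = p.2}, fun a => ?_, fun b => ?_, ?_⟩
  · induction a using QuotientGroup.induction_on with | H x => exact ⟨x, x, rfl, rfl⟩
  · induction b using QuotientGroup.induction_on with | H x => exact ⟨x, x, rfl, rfl⟩
  · rintro ⟨_, _⟩ ⟨x, rfl, rfl⟩ ⟨_, _⟩ ⟨y, rfl, rfl⟩
    have hlt : quotientEDist K (Q t) x y < quotientEDist H (r • q₂) x y + ε' :=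
      (hup x y).trans_lt (ENNReal.add_lt_add_left (hBfin x y) h16)
    refine ⟨hlt, (hlo x y).trans_lt (ENNReal.lt_add_right ?_ hε'0.ne')⟩
    exact (hlt.trans_le le_top).ne

end Collapse

/-! ### Invariant Ricci flows as solutions of the planar system. -/

section Flow

variable {E EK : Type*}
  [NormedAddCommGroup E] [NormedSpace ℝ E] [FiniteDimensional ℝ E] [CompleteSpace E]
  [NormedAddCommGroup EK] [NormedSpace ℝ EK]
  {G : Type*} [TopologicalSpace G] [ChartedSpace E G] [Group G] [LieGroup 𝓘(ℝ, E) ∞ G]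
  {K : Subgroup G} {𝔨 𝔭 : Submodule ℝ (GroupLieAlgebra 𝓘(ℝ, E) G)}
  {hc : IsCompl 𝔭 𝔨} {𝔭₁ 𝔭₂ : Submodule ℝ 𝔭} (h12 : IsCompl 𝔭₁ 𝔭₂)
  (hirr₁ : IsIrreducibleSummand K hc 𝔭₁) (hirr₂ : IsIrreducibleSummand K hc 𝔭₂)
  {Q : LinearMap.BilinForm ℝ 𝔭} (hQ : IsInvariantMetric K hc Q)
  {C D y₁ y₂ : ℝ}
  (hric : ∀ x₁ x₂ : ℝ, 0 < x₁ → 0 < x₂ → ∀ X Y, ricci hc (diagMetric h12 Q x₁ x₂) X Y =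
    diagMetric h12 Q ((C + D) * y₁ * y₂ + C * (x₁ / x₂) ^ 2)
      ((C + D) * (y₁ + y₂) - D * (x₁ / x₂)) X Y)

include hirr₁ hirr₂ hQ hric

/-- A solution of the system of equations for `x₁, x₂` is a Ricci flow. -/
theorem isRicciFlow_diagMetric {x₁ x₂ : ℝ → ℝ} {J : Set ℝ}
    (hx : ∀ t ∈ J, 0 < x₁ t ∧ 0 < x₂ t ∧
      HasDerivAt (fun s => (x₁ s, x₂ s)) (flowField C D y₁ y₂ (x₁ t, x₂ t)) t) :
    IsRicciFlow K hc (fun t => diagMetric h12 Q (x₁ t) (x₂ t)) J := by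
  intro t ht
  obtain ⟨h1, h2, hd⟩ := hx t ht
  refine ⟨isInvariantMetric_diagMetric hQ h12 hirr₁.1 hirr₂.1 h1 h2, fun X Y => ?_⟩
  have d1 : HasDerivAt x₁ (flowField C D y₁ y₂ (x₁ t, x₂ t)).1 t := hd.fst
  have d2 : HasDerivAt x₂ (flowField C D y₁ y₂ (x₁ t, x₂ t)).2 t := hd.snd
  rw [hric _ _ h1 h2]
  have := ((d1.mul_const (Q (𝔭₁.projection 𝔭₂ h12 X) (𝔭₁.projection 𝔭₂ h12 Y))).add
    (d2.mul_const (Q (𝔭₂.projection 𝔭₁ h12.symm X) (𝔭₂.projection 𝔭₁ h12.symm Y)))).hasDerivWithinAt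
      (s := J)
  refine this.congr_deriv ?_
  rw [diagMetric_apply]
  simp only [flowField]
  ring

/-- Every Ricci flow of invariant metrics is given by a solution of the system of equations for
`x₁, x₂`. -/
theorem exists_of_isRicciFlow (hineq : ¬ AreEquivalent K hc 𝔭₁ 𝔭₂)
    {g : ℝ → LinearMap.BilinForm ℝ 𝔭} {J : Set ℝ} (hg : IsRicciFlow K hc g J) {a₁ a₂ : ℝ}
    (hg0 : g 0 = diagMetric h12 Q a₁ a₂) :
    ∃ z₁ z₂ : ℝ → ℝ, z₁ 0 = a₁ ∧ z₂ 0 = a₂ ∧ ∀ t ∈ J, g t = diagMetric h12 Q (z₁ t) (z₂ t) ∧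
      0 < z₁ t ∧ 0 < z₂ t ∧
      HasDerivWithinAt (fun s => (z₁ s, z₂ s)) (flowField C D y₁ y₂ (z₁ t, z₂ t)) J t := by
  obtain ⟨Y₁, hY₁, hY₁0⟩ := hirr₁.exists_ne_zero
  obtain ⟨Y₂, hY₂, hY₂0⟩ := hirr₂.exists_ne_zero
  have hq₁ := hQ.pos Y₁ hY₁0
  have hq₂ := hQ.pos Y₂ hY₂0
  -- Evaluating on fixed vectors recovers the coefficients for all t at once, so they inherit
  -- differentiability from g.
  set z₁ : ℝ → ℝ := fun t => g t Y₁ Y₁ / Q Y₁ Y₁ with hz₁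
  set z₂ : ℝ → ℝ := fun t => g t Y₂ Y₂ / Q Y₂ Y₂ with hz₂
  have hcoef : ∀ t c₁ c₂, g t = diagMetric h12 Q c₁ c₂ → z₁ t = c₁ ∧ z₂ t = c₂ := by
    intro t c₁ c₂ h
    simp only [hz₁, hz₂, h, diagMetric_apply_left h12 Q c₁ c₂ hY₁ hY₁,
      diagMetric_apply_right h12 Q c₁ c₂ hY₂ hY₂]
    exact ⟨mul_div_cancel_right₀ _ hq₁.ne', mul_div_cancel_right₀ _ hq₂.ne'⟩
  refine ⟨z₁, z₂, (hcoef 0 _ _ hg0).1, (hcoef 0 _ _ hg0).2, fun t ht => ?_⟩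
  obtain ⟨hm, hd⟩ := hg t ht
  obtain ⟨c₁, c₂, hgc⟩ := eq_diagMetric_of_invariant hQ h12 hirr₁ hirr₂ hineq hm.symm hm.invariant
  obtain ⟨e₁, e₂⟩ := hcoef t c₁ c₂ hgc
  rw [← e₁, ← e₂] at hgc
  have p₁ : 0 < z₁ t := div_pos (hm.pos _ hY₁0) hq₁
  have p₂ : 0 < z₂ t := div_pos (hm.pos _ hY₂0) hq₂
  refine ⟨hgc, p₁, p₂, ?_⟩
  have d1 := (hd Y₁ Y₁).div_const (Q Y₁ Y₁)
  have d2 := (hd Y₂ Y₂).div_const (Q Y₂ Y₂)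
  rw [hgc, hric _ _ p₁ p₂, diagMetric_apply_left h12 Q _ _ hY₁ hY₁, mul_div_assoc,
    mul_div_cancel_right₀ _ hq₁.ne'] at d1
  rw [hgc, hric _ _ p₁ p₂, diagMetric_apply_right h12 Q _ _ hY₂ hY₂, mul_div_assoc,
    mul_div_cancel_right₀ _ hq₂.ne'] at d2
  exact d1.prodMk d2

end Flow

/-! ### The fibre and the collapse for diagonal metrics. -/

section Geometry

variable {E EK EH : Type*}
  [NormedAddCommGroup E] [NormedSpace ℝ E] [FiniteDimensional ℝ E]
  [NormedAddCommGroup EK] [NormedSpace ℝ EK]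
  [NormedAddCommGroup EH] [NormedSpace ℝ EH] [FiniteDimensional ℝ EH]
  {G : Type*} [TopologicalSpace G] [ChartedSpace E G] [Group G] [LieGroup 𝓘(ℝ, E) ∞ G]
  {K H : Subgroup G} [ChartedSpace EK K] [LieGroup 𝓘(ℝ, EK) ∞ K]
  [ChartedSpace EH H] [LieGroup 𝓘(ℝ, EH) ∞ H]
  {𝔭 : Submodule ℝ (GroupLieAlgebra 𝓘(ℝ, E) G)} {hc : IsCompl 𝔭 (lieSub E EK K)}
  {𝔭₁ 𝔭₂ : Submodule ℝ 𝔭} (h12 : IsCompl 𝔭₁ 𝔭₂)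

omit [FiniteDimensional ℝ E] in
theorem projectionOnto_Ad (hKsmooth : ContMDiff 𝓘(ℝ, EK) 𝓘(ℝ, E) ∞ (Subtype.val : K → G)) {a : G}
    (ha : a ∈ K) (w : GroupLieAlgebra 𝓘(ℝ, E) G) :
    𝔭.projectionOnto (lieSub E EK K) hc (Ad E a w) =
      isotropyRep hc a (𝔭.projectionOnto (lieSub E EK K) hc w) := by
  have h : Ad E a ((lieSub E EK K).projectionOnto 𝔭 hc.symm w) ∈ lieSub E EK K :=
    Ad_mem_lieSub hKsmooth ha (Submodule.coe_mem _)
  have hw : w = (𝔭.projectionOnto (lieSub E EK K) hc w : GroupLieAlgebra 𝓘(ℝ, E) G) +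
      (lieSub E EK K).projectionOnto 𝔭 hc.symm w :=
    (Submodule.projection_add_projection_eq_self hc w).symm
  conv_lhs => rw [hw, map_add, map_add, (Submodule.projectionOnto_apply_eq_zero_iff hc).2 h, add_zero]
  rfl

-- Hence only x₁ enters the metric of the fibre, which is x₁ times a fixed one.
omit [FiniteDimensional ℝ E] [LieGroup 𝓘(ℝ, E) ∞ G] [LieGroup 𝓘(ℝ, EK) ∞ K]
  [FiniteDimensional ℝ EH] [LieGroup 𝓘(ℝ, EH) ∞ H] in
theorem projectionOnto_inclusionDeriv_mem (hLieH : lieSub E EH H = lieSub E EK K ⊔ 𝔭₁.map 𝔭.subtype)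
    (w : GroupLieAlgebra 𝓘(ℝ, EH) H) :
    𝔭.projectionOnto (lieSub E EK K) hc (inclusionDeriv E EH H w) ∈ 𝔭₁ := by
  have hw : inclusionDeriv E EH H w ∈ lieSub E EH H := ⟨w, rfl⟩
  rw [hLieH] at hw
  obtain ⟨k, hk, _, ⟨p, hp, rfl⟩, hkp⟩ := Submodule.mem_sup.1 hw
  rw [← hkp, map_add, (Submodule.projectionOnto_apply_eq_zero_iff hc).2 hk, zero_add]
  have : 𝔭.projectionOnto (lieSub E EK K) hc (𝔭.subtype p) = p :=
    Submodule.projectionOnto_apply_left hc p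
  rwa [this]

omit [LieGroup 𝓘(ℝ, EK) ∞ K] in
/-- The diameter of the fibre `H/K` tends to `0` with `x₁`. -/
theorem tendsto_ediam_fibreEDist [CompactSpace H] [ConnectedSpace (H ⧸ K.subgroupOf H)]
    (hLieH : lieSub E EH H = lieSub E EK K ⊔ 𝔭₁.map 𝔭.subtype) (Q : LinearMap.BilinForm ℝ 𝔭)
    {x₁ x₂ : ℝ → ℝ} {l : Filter ℝ} (hx₁ : ∀ᶠ t in l, 0 < x₁ t) (hx₁l : Tendsto x₁ l (𝓝 0)) :
    Tendsto (fun t => ediam (fibreEDist (F := EH) K H hc (diagMetric h12 Q (x₁ t) (x₂ t)))) l (𝓝 0) := by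
  set f := (𝔭.projectionOnto (lieSub E EK K) hc).comp (inclusionDeriv E EH H) with hf
  obtain ⟨M, hM, hle⟩ := exists_ediam_quotientEDist_le (K.subgroupOf H) (Q.compl₁₂ f f)
  have hlim : Tendsto (fun t => ENNReal.ofReal (Real.sqrt (x₁ t)) * M) l (𝓝 0) := by
    have h1 := ENNReal.tendsto_ofReal ((Real.continuous_sqrt.tendsto 0).comp hx₁l)
    rw [Real.sqrt_zero, ENNReal.ofReal_zero] at h1
    simpa using ENNReal.Tendsto.mul_const h1 (.inr hM)
  refine tendsto_of_tendsto_of_tendsto_of_le_of_le' tendsto_const_nhds hlim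
    (Eventually.of_forall fun _ => zero_le) ?_
  filter_upwards [hx₁] with t ht
  refine hle _ (Real.sqrt (x₁ t)) (Real.sqrt_pos.2 ht) fun w => ?_
  rw [Real.sq_sqrt ht.le]
  have hw : f w ∈ 𝔭₁ := projectionOnto_inclusionDeriv_mem hLieH w
  exact (diagMetric_apply_left h12 Q (x₁ t) (x₂ t) hw hw).le

omit [FiniteDimensional ℝ EH] in
/-- `G/K` converges to `G/H` as the fibres shrink. -/
theorem tendsto_ghEDist_diagMetric [CompactSpace G] [ConnectedSpace (G ⧸ K)] (hKH : K ≤ H)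
    (hKsmooth : ContMDiff 𝓘(ℝ, EK) 𝓘(ℝ, E) ∞ (Subtype.val : K → G))
    (hHsmooth : ContMDiff 𝓘(ℝ, EH) 𝓘(ℝ, E) ∞ (Subtype.val : H → G))
    (h₁ : IsInvariant K hc 𝔭₁) (h₂ : IsInvariant K hc 𝔭₂)
    {Q : LinearMap.BilinForm ℝ 𝔭} (hQ : IsInvariantMetric K hc Q)
    {x₁ x₂ : ℝ → ℝ} {l : Filter ℝ} {r : ℝ} (hr : 0 < r)
    (hx₁ : ∀ᶠ t in l, 0 < x₁ t) (hx₂ : ∀ᶠ t in l, r ≤ x₂ t)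
    (hx₁l : Tendsto x₁ l (𝓝 0)) (hx₂l : Tendsto x₂ l (𝓝 r))
    (hfib : Tendsto (fun t => ediam (fibreEDist (F := EH) K H hc (diagMetric h12 Q (x₁ t) (x₂ t))))
      l (𝓝 0)) :
    Tendsto (fun t => ghEDist (totalEDist K hc (diagMetric h12 Q (x₁ t) (x₂ t)))
      (baseEDist H hc h12 (r • Q))) l (𝓝 0) := by
  set π := 𝔭.projectionOnto (lieSub E EK K) hc with hπ
  set P₁ := 𝔭₁.projection 𝔭₂ h12 with hP₁
  set P₂ := 𝔭₂.projection 𝔭₁ h12.symm with hP₂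
  have hnn : ∀ X, 0 ≤ Q X X := fun X => by
    rcases eq_or_ne X 0 with rfl | h
    · simp
    · exact (hQ.pos X h).le
  refine tendsto_ghEDist (q₁ := (Q.compl₁₂ P₁ P₁).compl₁₂ π π) (q₂ := (Q.compl₁₂ P₂ P₂).compl₁₂ π π)
    hKH (fun w => hnn _) (fun w => hnn _) hr hx₁ hx₂ hx₁l hx₂l (fun t a ha w => ?_) hfib
    (fun t x h hh => quotientEDist_mul_le_ediam K H hHsmooth _ x hh)
  change diagMetric h12 Q (x₁ t) (x₂ t) (π (Ad E a w)) (π (Ad E a w)) =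
    diagMetric h12 Q (x₁ t) (x₂ t) (π w) (π w)
  rw [hπ, projectionOnto_Ad hKsmooth ha, diagMetric_apply, diagMetric_apply,
    projection_isotropyRep h12 h₁ h₂ ha, projection_isotropyRep h12.symm h₂ h₁ ha,
    hQ.invariant a ha, hQ.invariant a ha]

end Geometry

end HRF

theorem mainTheorem3
    -- a compact Lie group `G` with Lie subgroups `K ≤ H`
    {E EK EH : Type*}
    [NormedAddCommGroup E] [NormedSpace ℝ E] [FiniteDimensional ℝ E] [CompleteSpace E]
    [NormedAddCommGroup EK] [NormedSpace ℝ EK] [FiniteDimensional ℝ EK]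
    [NormedAddCommGroup EH] [NormedSpace ℝ EH] [FiniteDimensional ℝ EH]
    {G : Type*} [TopologicalSpace G] [ChartedSpace E G] [Group G] [LieGroup 𝓘(ℝ, E) ∞ G]
    [CompactSpace G] [T2Space G]
    (K H : Subgroup G) (hKH : K ≤ H)
    [ChartedSpace EK K] [LieGroup 𝓘(ℝ, EK) ∞ K]
    [ChartedSpace EH H] [LieGroup 𝓘(ℝ, EH) ∞ H]
    (hKclosed : IsClosed (K : Set G)) (hHclosed : IsClosed (H : Set G))
    (hKsmooth : ContMDiff 𝓘(ℝ, EK) 𝓘(ℝ, E) ∞ (Subtype.val : K → G))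
    (hHsmooth : ContMDiff 𝓘(ℝ, EH) 𝓘(ℝ, E) ∞ (Subtype.val : H → G))
    -- `G/K` is connected and effective, the fibre `H/K` is connected
    (hconn : ConnectedSpace (G ⧸ K)) (heff : K.normalCore = ⊥)
    (hfibre : ConnectedSpace (H ⧸ K.subgroupOf H))
    -- `𝔤 = 𝔨 ⊕ 𝔭`, `𝔭 = 𝔭₁ ⊕ 𝔭₂` with inequivalent irreducible summands, `𝔥 = 𝔨 ⊕ 𝔭₁`
    (hc : IsCompl (HRF.isotropySpace E EK K) (HRF.lieSub E EK K))
    (𝔭₁ 𝔭₂ : Submodule ℝ (HRF.isotropySpace E EK K)) (h12 : IsCompl 𝔭₁ 𝔭₂)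
    (hirr₁ : HRF.IsIrreducibleSummand K hc 𝔭₁) (hirr₂ : HRF.IsIrreducibleSummand K hc 𝔭₂)
    (hineq : ¬ HRF.AreEquivalent K hc 𝔭₁ 𝔭₂)
    (hLieH : HRF.lieSub E EH H =
      HRF.lieSub E EK K ⊔ 𝔭₁.map (HRF.isotropySpace E EK K).subtype)
    -- the background metric `Q`, a negative multiple of the Killing form on each summand
    (Q : LinearMap.BilinForm ℝ (HRF.isotropySpace E EK K)) (hQ : HRF.IsInvariantMetric K hc Q)
    (b₁ b₂ : ℝ) (hb₁ : 0 < b₁) (hb₂ : 0 < b₂)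
    (hQ₁ : ∀ X ∈ 𝔭₁, ∀ Y ∈ 𝔭₁,
      -killingForm ℝ (GroupLieAlgebra 𝓘(ℝ, E) G) X Y = b₁ * Q X Y)
    (hQ₂ : ∀ X ∈ 𝔭₂, ∀ Y ∈ 𝔭₂,
      -killingForm ℝ (GroupLieAlgebra 𝓘(ℝ, E) G) X Y = b₂ * Q X Y)
    -- up to scaling there are exactly two invariant Einstein metrics, given by `y₁ < y₂`
    (y₁ y₂ : ℝ) (hy₁ : 0 < y₁) (hy₁₂ : y₁ < y₂)
    (hEinstein : ∀ g, HRF.IsInvariantMetric K hc g →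
      (HRF.IsEinstein hc g ↔ ∃ s : ℝ, 0 < s ∧
        (g = HRF.diagMetric h12 Q (s * y₁) s ∨ g = HRF.diagMetric h12 Q (s * y₂) s)))
    -- the initial metric, with `y(0) < y₁`
    (a₁ a₂ : ℝ) (ha₁ : 0 < a₁) (ha₂ : 0 < a₂) (hy0 : a₁ / a₂ < y₁) :
    ∃ T : ℝ, 0 < T ∧ ∃ x₁ x₂ : ℝ → ℝ,
      x₁ 0 = a₁ ∧ x₂ 0 = a₂ ∧
      -- an ancient solution on `(-∞, T)`, of type I
      HRF.IsRicciFlow K hc (fun t => HRF.diagMetric h12 Q (x₁ t) (x₂ t)) (Iio T) ∧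
      HRF.IsTypeIAncient hc (fun t => HRF.diagMetric h12 Q (x₁ t) (x₂ t)) ∧
      -- it is maximal and unique: every solution with the same initial metric is a restriction of it
      (∀ (J : Set ℝ) (g : ℝ → LinearMap.BilinForm ℝ (HRF.isotropySpace E EK K)),
        J.OrdConnected → 0 ∈ J → HRF.IsRicciFlow K hc g J → g 0 = HRF.diagMetric h12 Q a₁ a₂ →
        J ⊆ Iio T ∧ ∀ t ∈ J, g t = HRF.diagMetric h12 Q (x₁ t) (x₂ t)) ∧
      -- as `t → T` the fibre `H/K` shrinks to a point and `G/K` collapses to `G/H`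
      Tendsto x₁ (𝓝[<] T) (𝓝 0) ∧
      Tendsto (fun t => HRF.ediam (HRF.fibreEDist (F := EH) K H hc
        (HRF.diagMetric h12 Q (x₁ t) (x₂ t)))) (𝓝[<] T) (𝓝 0) ∧
      (∃ r : ℝ, 0 < r ∧ Tendsto x₂ (𝓝[<] T) (𝓝 r) ∧
        Tendsto (fun t => HRF.ghEDist
          (HRF.totalEDist K hc (HRF.diagMetric h12 Q (x₁ t) (x₂ t)))
          (HRF.baseEDist H hc h12 (r • Q))) (𝓝[<] T) (𝓝 0)) ∧
      -- as `t → -∞` the ratio tends to `y₁`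
      Tendsto (fun t => x₁ t / x₂ t) atBot (𝓝 y₁) := by
  obtain ⟨C, D, hC, hD, hCD, hric⟩ := HRF.exists_ricci_diagMetric_of_einstein hKsmooth hHsmooth h12
    hirr₁ hirr₂ hineq hLieH hQ hb₁ hb₂ hQ₁ hQ₂ hy₁ hy₁₂ hEinstein
  obtain ⟨T, r, hT, hr, x₁, x₂, hx₁0, hx₂0, hx, hx₁T, hx₂T, hy, l, hl⟩ :=
    HRF.exists_trajectory hC hD hCD hy₁ hy₁₂ ha₁ ha₂ hy0
  have hfib := HRF.isFibred_isotropySpace hKsmooth hHsmooth h12 hirr₁ hirr₂ hineq hLieH hQ hb₁ hb₂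
    hQ₁ hQ₂
  have hx₁pos : ∀ᶠ t in 𝓝[<] T, 0 < x₁ t :=
    eventually_nhdsWithin_of_forall fun t ht => (hx t ht).1
  have hx₂r : ∀ᶠ t in 𝓝[<] T, r ≤ x₂ t :=
    eventually_nhdsWithin_of_forall fun t ht => (hx t ht).2.1
  have : CompactSpace H := isCompact_iff_compactSpace.1 hHclosed.isCompact
  have hdiam := HRF.tendsto_ediam_fibreEDist (EH := EH) (H := H) (hc := hc) h12 hLieH Q (x₂ := x₂)
    hx₁pos hx₁T
  refine ⟨T, hT, x₁, x₂, hx₁0, hx₂0, ?_, ?_, fun J g hJ h0 hg hg0 => ?_, hx₁T, hdiam,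
    ⟨r, hr, hx₂T, ?_⟩, hy⟩
  · exact HRF.isRicciFlow_diagMetric h12 hirr₁ hirr₂ hQ hric fun t ht =>
      ⟨(hx t ht).1, hr.trans_le (hx t ht).2.1, (hx t ht).2.2⟩
  -- The curvature estimate is stated for -B, so the coefficients are divided by b₁ and b₂.
  · have hu : Tendsto (fun t => (x₁ t / b₁) / (x₂ t / b₂)) atBot (𝓝 (y₁ * (b₂ / b₁))) :=
      (hy.mul_const (b₂ / b₁)).congr fun t => by field_simp
    have hl' : Tendsto (fun t => |t| / (x₂ t / b₂)) atBot (𝓝 (l * b₂)) :=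
      (hl.mul_const b₂).congr fun t => by field_simp
    have := hfib.isTypeIAncient (fun t ht => div_pos (hx t ht).1 hb₁)
      (fun t ht => div_pos (hr.trans_le (hx t ht).2.1) hb₂) (by positivity) hu hl'
    simpa only [HRF.diagMetric_eq_killP h12 hb₁ hb₂ hQ₁ hQ₂] using this
  · obtain ⟨z₁, z₂, hz₁, hz₂, hz⟩ :=
      HRF.exists_of_isRicciFlow h12 hirr₁ hirr₂ hQ hric hineq hg hg0
    obtain ⟨hJT, heq⟩ := HRF.trajectory_unique hT hr hx hx₁T hJ h0 (fun t ht => (hz t ht).2)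
      (hz₁.trans hx₁0.symm) (hz₂.trans hx₂0.symm)
    refine ⟨hJT, fun t ht => ?_⟩
    rw [(hz t ht).1, (heq t ht).1, (heq t ht).2]
  · exact HRF.tendsto_ghEDist_diagMetric h12 hKH hKsmooth hHsmooth hirr₁.1 hirr₂.1 hQ hr hx₁pos
      hx₂r hx₁T hx₂T hdiam
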